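/- **Setting.** Let $m\ge 0$, $p,q_1,\dots,q_m\in\mathbb N$, and let real processes $y_k,\ u_{i,k},\ \omega_k$ on a probability space satisfy $$y_{k+1}=\sum_{j=1}^p a_jy_{k+1-j}+\sum_{i=1}^m\sum_{l=1}^{q_i}b_{i,l}u_{i,k+1-l}+\omega_{k+1}=\theta^T\varphi_k+\omega_{k+1}\qquad(k\ge 0),$$ with $y_k=0$ for $k\le 0$ and $u_{i,k}=0$ for $k<0$, where $\theta=[a_1,\dots,a_p,b_{1,1},\dots,b_{m,q_m}]^T$ and $\varphi_k=[y_k,\dots,y_{k+1-p},u_{1,k},\dots,u_{1,k+1-q_1},\dots,u_{m,k},\dots,u_{m,k+1-q_m}]^T$. Participant $0$ sends $\bar y_k=y_k+\eta_k$ and participant $i\ge1$ sends $\bar u_{i,k}=u_{i,k}+\xi_{i,k}$, where for noise levels $s=(b_0,\dots,b_m)\in(0,\infty)^{m+1}$ the noises $\eta_k$ ($k\ge1$) have the Laplace law $L(0,b_0)$, the $\xi_{i,k}$ ($k\ge 0$) have the law $L(0,b_i)$, all noises are mutually independent, and they are jointly independent of $(y,u,\omega)$; noises vanish at all other times. With $\bar\varphi_k$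 built from $\bar y,\bar u$ as $\varphi_k$ is from $y,u$, with $\bar P_0=\alpha^{-1}I$ ($\alpha>0$) and an arbitrary fixed $\theta_0$, the recursive least-squares algorithm is $$\bar a_k=(1+\bar\varphi_k^T\bar P_k\bar\varphi_k)^{-1},\quad \theta_{k+1}=\theta_k+\bar a_k\bar P_k\bar\varphi_k(\bar y_{k+1}-\bar\varphi_k^T\theta_k),\quad \bar P_{k+1}=\bar P_k-\bar a_k\bar P_k\bar\varphi_k\bar\varphi_k^T\bar P_k .$$ **Privacy.** Let $\varepsilon,\delta>0$. The algorithm is called $\varepsilon$-differentially private under $\delta$-adjacency for each participant if, for all $T_2\ge T_1\ge 1$, the following random mechanisms $\mathcal M$ satisfy $\mathbb P(\mathcal M(x)\in D)\le e^{\varepsilon}\,\mathbb P(\mathcal M(x')\in D)$ for all $x,x'\in\mathbb R^{T_1}$ with $\|x-x'\|_1\le\delta$ and all Borel sets $D$. Participant $0$: $\mathcal M(x)=(\bar y_1,\dots,\bar y_{T_2})$, where $(y_1,\dots,y_{T_1})=x$ and the later outputs are generated by the system. Participant $i\ge1$: $\mathcal M(x)=(\bar y_1,\dots,\bar y_{T_2},\bar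 u_{i,0},\dots,\bar u_{i,T_2-1})$, where $(u_{i,0},\dots,u_{i,T_1-1})=x$, all other inputs are the given ones, and the output is generated by the system. **Hypotheses on the system.** (i) $1-a_1z-\dots-a_pz^p\ne0$ for all complex $|z|\le1$. (ii) For a filtration $(\mathscr F_k)$ and some $\beta\ge2$, $(\omega_k,\mathscr F_k)$ is a martingale difference sequence with $\sup_kE(|\omega_{k+1}|^\beta\mid\mathscr F_k)<\infty$ a.s., and $\varphi_k$ is $\mathscr F_k$-measurable for all $k\ge 0$. (iii) $\sum_{t=1}^k\|\varphi_t\|^2=O(k)$ a.s. (iv) There is $\gamma_3>0$ with $\gamma_3<\liminf_{k\to\infty}\lambda_{\min}(P_k^{-1})/k$ a.s., where $P_k^{-1}=\sum_{t=0}^{k-1}\varphi_t\varphi_t^T+\alpha I$. **Optimization problem.** Let $A$ be the $p\times p$ companion matrix with ones on the superdiagonal and last row $(a_p,\dots,a_1)$. For constants $c_0>0$, $\lambda\in(0,1)$ with $\|A^k\|\le c_0\lambda^k$ for all $k\ge 0$, put $C_1=1+\frac{\sqrt p\,c_0\lambda}{1-\lambda}$, $C_{i,2}=C_1\sum_{j=1}^{q_i}|b_{i,j}|$,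 and consider $$\min\ f(b_0,\dots,b_m)=\frac{p\,b_0^2+\sum_{i=1}^mq_ib_i^2}{\gamma_3+2\min_{0\le i\le m}b_i^2}\quad\text{subject to}\quad \frac{C_1}{b_0}\delta\le\varepsilon,\quad\Big(\frac{C_{i,2}}{b_0}+\frac1{b_i}\Big)\delta\le\varepsilon\ (1\le i\le m),\quad b_0,\dots,b_m>0.$$ **Theorem 6.** Under these hypotheses, such constants $c_0,\lambda$ exist, and for every such pair the following hold. 1. If $p\ge1$, the minimum $f^*$ is attained in a bounded set: there is $r$ such that some minimizer satisfies $b_i\le r$ for all $i$, and every minimizer satisfies $b_0\le r$ and $b_i\le r$ for all $i\ge1$ with $q_i\ge1$. 2. For all noise levels satisfying the constraints, the algorithm is $\varepsilon$-differentially private under $\delta$-adjacency for each participant. 3. Suppose the noise levels satisfy the constraints and, with $r_k=e+\sum_{t=0}^k\|\bar\varphi_t\|^2$, for some $\kappa>1$, a.s. as $k\to\infty$, $$\frac{\ln r_{k-1}\,(\ln(e+\ln r_{k-1}))^{\kappa}}{\lambda_{\min}(\bar P_k^{-1})}\to0\ \ (\text{if }\beta=2),\qquad \frac{\ln r_{k-1}}{\lambda_{\min}(\bar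 P_k^{-1})}\to0\ \ (\text{if }\beta>2).$$ Then $\limsup_{k\to\infty}\|\theta-\theta_k\|\le2\|\theta\|\sqrt{f(b_0,\dots,b_m)}$ a.s.; in particular, if the noise levels minimize $f$ under the constraints, then a.s. $\limsup_{k\to\infty}\|\theta-\theta_k\|\le2\|\theta\|\sqrt{f^*}$. -/

import Mathlib

open MeasureTheory ProbabilityTheory Filter Topology
open scoped ENNReal Matrix

noncomputable section

/-- Orders and coefficients of an ARX system with one output participant `0` and `m` input
participants `1, ..., m`.  Here `a j` is the coefficient of `y_{k-j}` and `b i l` is the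
coefficient of `u_{i,k-l}` in the equation for `y_{k+1}` (indices counted from `0`). -/
structure MPARX (m : ℕ) where
  p : ℕ
  q : Fin m → ℕ
  a : Fin p → ℝ
  b : (i : Fin m) → Fin (q i) → ℝ

namespace MPARX

variable {m : ℕ}

/-- Index set of the coordinates of the parameter vector and of the regression vectors; it has
`p + q_1 + ... + q_m` elements. -/
abbrev Idx (S : MPARX m) : Type := Fin S.p ⊕ (Σ i : Fin m, Fin (S.q i))

/-- The parameter vector `θ`. -/
def theta (S : MPARX m) : S.Idx → ℝ := Sum.elim S.a (fun z => S.b z.1 z.2)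

/-- The value `x_{k-j}`, with the convention that signals vanish at negative times. -/
def lag (x : ℕ → ℝ) (k j : ℕ) : ℝ := if j ≤ k then x (k - j) else 0

/-- The regression vector at time `k` built from an output signal `y` and input signals `u`. -/
def regressor (S : MPARX m) (y : ℕ → ℝ) (u : Fin m → ℕ → ℝ) (k : ℕ) : S.Idx → ℝ :=
  Sum.elim (fun j => lag y k j) (fun z => lag (u z.1) k z.2)

/-- Euclidean norm. -/
def eNorm {ι : Type*} [Fintype ι] (x : ι → ℝ) : ℝ := Real.sqrt (∑ i, x i ^ 2)

/-- `y` is the output of the system with inputs `u` and system noise `w`, started at rest. -/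
def IsOutput (S : MPARX m) (y : ℕ → ℝ) (u : Fin m → ℕ → ℝ) (w : ℕ → ℝ) : Prop :=
  y 0 = 0 ∧ ∀ k, y (k + 1) = S.theta ⬝ᵥ S.regressor y u k + w (k + 1)

/-- The output trajectory when `y_1, ..., y_T` are prescribed to be `x_1, ..., x_T`
(with `y_0 = 0`) and `y_{T+1}, y_{T+2}, ...` are generated by the system equation. -/
def outputFrom (S : MPARX m) (T : ℕ) (x : ℕ → ℝ) (u : Fin m → ℕ → ℝ) (w : ℕ → ℝ) : ℕ → ℝ
  | 0 => 0
  | k + 1 =>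
    if k + 1 ≤ T then x (k + 1)
    else
      (∑ j : Fin S.p, S.a j * if (j : ℕ) ≤ k then outputFrom S T x u w (k - j) else 0)
        + (∑ i : Fin m, ∑ l : Fin (S.q i), S.b i l * lag (u i) k l) + w (k + 1)
  termination_by k => k
  decreasing_by omega

/-! ### The recursive least-squares algorithm -/

/-- The pair `(θ_k, P̄_k)` computed from the received signals `ybar`, `ubar`, with
`P̄_0⁻¹ = α I`. -/
def rls (S : MPARX m) (α : ℝ) (θ0 : S.Idx → ℝ) (ybar : ℕ → ℝ) (ubar : Fin m → ℕ → ℝ) :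
    ℕ → (S.Idx → ℝ) × Matrix S.Idx S.Idx ℝ
  | 0 => (θ0, α⁻¹ • (1 : Matrix S.Idx S.Idx ℝ))
  | k + 1 =>
    let θ := (rls S α θ0 ybar ubar k).1
    let P := (rls S α θ0 ybar ubar k).2
    let φ := S.regressor ybar ubar k
    let abar := (1 + φ ⬝ᵥ (P *ᵥ φ))⁻¹
    (θ + (abar * (ybar (k + 1) - φ ⬝ᵥ θ)) • (P *ᵥ φ),
      P - abar • Matrix.vecMulVec (P *ᵥ φ) (φ ᵥ* P))

/-- The estimate `θ_k`. -/
def estimate (S : MPARX m) (α : ℝ) (θ0 : S.Idx → ℝ) (ybar : ℕ → ℝ) (ubar : Fin m → ℕ → ℝ)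
    (k : ℕ) : S.Idx → ℝ := (S.rls α θ0 ybar ubar k).1

/-- The matrix `P̄_k`. -/
def gain (S : MPARX m) (α : ℝ) (θ0 : S.Idx → ℝ) (ybar : ℕ → ℝ) (ubar : Fin m → ℕ → ℝ)
    (k : ℕ) : Matrix S.Idx S.Idx ℝ := (S.rls α θ0 ybar ubar k).2

/-- Smallest eigenvalue of a symmetric real matrix. -/
def lambdaMin {ι : Type*} [Fintype ι] [DecidableEq ι] (M : Matrix ι ι ℝ) : ℝ :=
  sInf (spectrum ℝ M)

/-- `∑_{t < k} φ_t φ_tᵀ + α I` for the unperturbed regression vectors `φ_t`. -/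
def information (S : MPARX m) (α : ℝ) (y : ℕ → ℝ) (u : Fin m → ℕ → ℝ) (k : ℕ) :
    Matrix S.Idx S.Idx ℝ :=
  ∑ t ∈ Finset.range k, Matrix.vecMulVec (S.regressor y u t) (S.regressor y u t)
    + α • (1 : Matrix S.Idx S.Idx ℝ)

/-- `r_k = e + ∑_{t ≤ k} ‖φ_t‖²`. -/
def energy (S : MPARX m) (ybar : ℕ → ℝ) (ubar : Fin m → ℕ → ℝ) (k : ℕ) : ℝ :=
  Real.exp 1 + ∑ t ∈ Finset.range (k + 1), eNorm (S.regressor ybar ubar t) ^ 2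

/-- The excitation condition: with `L = log r_{k-1}`, the quotient
`L (log (e + L))^κ / λ_min(P̄_k⁻¹)` (if `β = 2`) or `L / λ_min(P̄_k⁻¹)` (if `β > 2`) tends
to `0`. -/
def Excited (S : MPARX m) (α β κ : ℝ) (θ0 : S.Idx → ℝ) (ybar : ℕ → ℝ)
    (ubar : Fin m → ℕ → ℝ) : Prop :=
  Tendsto (fun k =>
      (Real.log (S.energy ybar ubar k) *
          (if β = 2 then Real.log (Real.exp 1 + Real.log (S.energy ybar ubar k)) ^ κ else 1)) /
        lambdaMin (S.gain α θ0 ybar ubar (k + 1))⁻¹)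
    atTop (𝓝 0)

/-! ### Stability and the constants in the privacy constraints -/

/-- Asymptotic stability: `1 - a_1 z - ... - a_p z^p ≠ 0` for all complex `|z| ≤ 1`. -/
def Stable (S : MPARX m) : Prop :=
  ∀ z : ℂ, ‖z‖ ≤ 1 → 1 - ∑ j : Fin S.p, (S.a j : ℂ) * z ^ ((j : ℕ) + 1) ≠ 0

/-- The `p × p` companion matrix: ones on the superdiagonal, last row `a_p, ..., a_1`. -/
def companion (S : MPARX m) : Matrix (Fin S.p) (Fin S.p) ℝ := fun r c =>
  if (r : ℕ) + 1 = S.p then S.a c.rev else if (c : ℕ) = (r : ℕ) + 1 then 1 else 0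

/-- `c0 > 0` and `lam ∈ (0,1)` satisfy `‖A^k‖ ≤ c0 lam^k` for all `k` (spectral norm, `A` the
companion matrix). -/
def IsDecay (S : MPARX m) (c0 lam : ℝ) : Prop :=
  0 < c0 ∧ 0 < lam ∧ lam < 1 ∧
    ∀ k : ℕ, ‖Matrix.toEuclideanCLM (𝕜 := ℝ) (S.companion ^ k)‖ ≤ c0 * lam ^ k

/-- `C_1`. -/
def C1 (S : MPARX m) (c0 lam : ℝ) : ℝ := 1 + Real.sqrt S.p * c0 * lam / (1 - lam)

/-- `C_{i,2}`. -/
def C2 (S : MPARX m) (c0 lam : ℝ) (i : Fin m) : ℝ :=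
  (1 + Real.sqrt S.p * c0 * lam / (1 - lam)) * ∑ l, |S.b i l|

/-- The admissible noise levels `s = (b_0, b_1, ..., b_m)`. -/
def admissible (S : MPARX m) (c0 lam ε δ : ℝ) : Set (Fin (m + 1) → ℝ) :=
  {s | (∀ i, 0 < s i) ∧ S.C1 c0 lam / s 0 * δ ≤ ε ∧
    ∀ i : Fin m, (S.C2 c0 lam i / s 0 + 1 / s i.succ) * δ ≤ ε}

/-- The objective function `f(b_0, ..., b_m)`. -/
def objective (S : MPARX m) (γ : ℝ) (s : Fin (m + 1) → ℝ) : ℝ :=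
  (S.p * s 0 ^ 2 + ∑ i : Fin m, S.q i * s i.succ ^ 2) / (γ + 2 * ⨅ i, s i ^ 2)

/-! ### Random signals and noises -/

/-- The centred Laplace distribution `L(0, b)`. -/
def laplace (b : ℝ) : Measure ℝ :=
  volume.withDensity (fun x => ENNReal.ofReal (1 / (2 * b) * Real.exp (-|x| / b)))

variable {Ω : Type*} [MeasurableSpace Ω]

/-- The privacy noises: `η_k` (`k ≥ 1`, with `η_0 = 0`) has law `L(0, b_0)`, `ξ_{i,k}`
(`k ≥ 0`) has law `L(0, b_i)`, all of them are mutually independent, and they are independent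
of the outputs, inputs and system noises. -/
structure PrivacyNoise (μ : Measure Ω) (s : Fin (m + 1) → ℝ)
    (y : ℕ → Ω → ℝ) (u : Fin m → ℕ → Ω → ℝ) (w : ℕ → Ω → ℝ)
    (η : ℕ → Ω → ℝ) (ξ : Fin m → ℕ → Ω → ℝ) : Prop where
  meas_output : ∀ k, Measurable (η k)
  meas_input : ∀ i k, Measurable (ξ i k)
  zero : ∀ ω, η 0 ω = 0
  law_output : ∀ k, μ.map (η (k + 1)) = laplace (s 0)
  law_input : ∀ i k, μ.map (ξ i k) = laplace (s i.succ)
  indep : iIndepFun (fun n : ℕ ⊕ (Fin m × ℕ) => Sum.elim η (fun z => ξ z.1 z.2) n) μ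
  indep_system : IndepFun
    (fun ω => ((fun k => η k ω), (fun i k => ξ i k ω)))
    (fun ω => ((fun k => y k ω), (fun i k => u i k ω), (fun k => w k ω))) μ

/-- `(w_k, ℱ_k)` is a martingale difference sequence with
`sup_k E(|w_{k+1}|^β | ℱ_k) < ∞` almost surely. -/
structure NoiseMDS (μ : Measure Ω) (ℱ : Filtration ℕ ‹MeasurableSpace Ω›) (β : ℝ)
    (w : ℕ → Ω → ℝ) : Prop where
  adapted : ∀ k, StronglyMeasurable[ℱ (k + 1)] (w (k + 1))
  integrable : ∀ k, Integrable (w (k + 1)) μ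
  condExp_zero : ∀ k, μ[w (k + 1) | ℱ k] =ᵐ[μ] 0
  moment : ∀ᵐ ω ∂μ, (⨆ k, (μ⁻[fun ω' => ‖w (k + 1) ω'‖ₑ ^ β | ℱ k]) ω) < ∞

/-! ### Differential privacy -/

/-- `ε`-differential privacy under `δ`-adjacency in `ℓ¹` of a mechanism whose sensitive data is
a vector of length `n`. -/
def DiffPrivate {n : ℕ} {Y : Type*} [MeasurableSpace Y] (μ : Measure Ω) (ε δ : ℝ)
    (M : (Fin n → ℝ) → Ω → Y) : Prop :=
  ∀ x x' : Fin n → ℝ, ∑ k, |x k - x' k| ≤ δ → ∀ D : Set Y, MeasurableSet D →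
    μ {ω | M x ω ∈ D} ≤ ENNReal.ofReal (Real.exp ε) * μ {ω | M x' ω ∈ D}

/-- What is observed from participant `0`: the sensitive data is `x = (y_1, ..., y_{T₁})`, the
later outputs are generated by the system, and `ȳ_k = y_k + η_k` is sent for
`1 ≤ k ≤ T₂`. -/
def outputMechanism (S : MPARX m) (u : Fin m → ℕ → Ω → ℝ) (w η : ℕ → Ω → ℝ) (T₁ T₂ : ℕ)
    (x : Fin T₁ → ℝ) (ω : Ω) : Fin T₂ → ℝ := fun k =>
  S.outputFrom T₁ (fun n => if h : n - 1 < T₁ then x ⟨n - 1, h⟩ else 0)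
    (fun i n => u i n ω) (fun n => w n ω) (k + 1) + η (k + 1) ω

/-- The inputs, with `u_{i,0}, ..., u_{i,T-1}` replaced by the data `x`. -/
def replaceInput (i : Fin m) (T : ℕ) (x : Fin T → ℝ) (u : Fin m → ℕ → ℝ) : Fin m → ℕ → ℝ :=
  Function.update u i (fun k => if h : k < T then x ⟨k, h⟩ else u i k)

/-- What is observed about participant `i ≥ 1`: the sensitive data is
`x = (u_{i,0}, ..., u_{i,T₁-1})`, the output is generated by the system from time `0`, and
`ȳ_k` (`1 ≤ k ≤ T₂`) and `ū_{i,k} = u_{i,k} + ξ_{i,k}` (`0 ≤ k < T₂`) are sent. -/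
def inputMechanism (S : MPARX m) (u : Fin m → ℕ → Ω → ℝ) (w η : ℕ → Ω → ℝ)
    (ξ : Fin m → ℕ → Ω → ℝ) (i : Fin m) (T₁ T₂ : ℕ) (x : Fin T₁ → ℝ) (ω : Ω) :
    (Fin T₂ → ℝ) × (Fin T₂ → ℝ) :=
  let v := replaceInput i T₁ x (fun j n => u j n ω)
  (fun k => S.outputFrom 0 (fun _ => 0) v (fun n => w n ω) (k + 1) + η (k + 1) ω,
    fun k => v i k + ξ i k ω)

/-- The algorithm is `ε`-differentially private under `δ`-adjacency for every participant, for
all lengths `T₁ ≥ 1` of the sensitive data and all attack durations `T₂ ≥ T₁`. -/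
def PrivateForAll (S : MPARX m) (μ : Measure Ω) (ε δ : ℝ) (u : Fin m → ℕ → Ω → ℝ)
    (w η : ℕ → Ω → ℝ) (ξ : Fin m → ℕ → Ω → ℝ) : Prop :=
  ∀ T₁ T₂ : ℕ, 1 ≤ T₁ → T₁ ≤ T₂ →
    DiffPrivate μ ε δ (S.outputMechanism u w η T₁ T₂) ∧
    ∀ i : Fin m, DiffPrivate μ ε δ (S.inputMechanism u w η ξ i T₁ T₂)

/-- Almost surely `limsup_k ‖θ - θ_k‖ ≤ C`, where `θ_k` is computed from the perturbed signals
(the upper limit is taken in the extended reals). -/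
def ErrorBound (S : MPARX m) (μ : Measure Ω) (α : ℝ) (θ0 : S.Idx → ℝ)
    (y : ℕ → Ω → ℝ) (u : Fin m → ℕ → Ω → ℝ) (η : ℕ → Ω → ℝ) (ξ : Fin m → ℕ → Ω → ℝ)
    (C : ℝ) : Prop :=
  ∀ᵐ ω ∂μ, limsup (fun k => ((eNorm (S.theta - S.estimate α θ0
      (fun n => y n ω + η n ω) (fun i n => u i n ω + ξ i n ω) k) : ℝ) : EReal)) atTop
    ≤ (C : EReal)

end MPARX

end

/-! Error bound. Write the received regressors as `φ̄ = φ + ζ`, with `ζ` built from the privacy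
noises. Recursive least squares solves a regularised normal equation, so the error `e = θ - θ_k`
satisfies `R̄ e = ∑_{t<k} (⟨ζ_t, θ⟩ - n_t) φ̄_t + α (θ - θ_0)`, where `R̄` is the regularised Gram
matrix of `φ̄` and `n_t = w_{t+1} + η_{t+1}` (`rls_spec`, `gram_mulVec_error`). Laws of large
numbers show that `n` is asymptotically uncorrelated with `φ̄`, that `φ` is so with `ζ`, and that
distinct coordinates of `ζ` are so with each other. Hence `R̄ / k` is eventually bounded below by `γ
+ 2 min b_i²`, and the `n`-part of the right side is `o(k)`. Pairing the equation with `e` and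
applying Cauchy-Schwarz gives `limsup |e|² ≤ (∑ θ_a² · 2 b_a²) / (γ + 2 min b_i²)`, where `b_a` is
the noise level at coordinate `a`; this is at most `4 |θ|² f` (`limsup_eNorm_le`,
`sqrt_noise_energy_le`). The averages come from martingale convergence, localised by conditional
variances, and Kronecker's lemma (`ae_tendsto_average_mul_of_condVar`).

Privacy. Stability forces the eigenvalues of the companion matrix into the open unit disc, so its
powers decay geometrically (`exists_isDecay`). Summing the free and the impulse response bounds the
`ℓ¹` sensitivity of the outputs by `C_1` and `C_{i,2}`. Conditionally on the system, the messages
are shifted product Laplace laws, and a shift costs the exponential of its weighted `ℓ¹` size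
(`laplace_mechanism_le`).

Minimum. With `n = p + ∑ q_i`, the numerator of `f` is at least `n · min b_i²`, while at constant
levels `f` is strictly below `n / 2`. A sublevel set of `f` therefore bounds the minimum of the
`b_i²`, hence the numerator, hence every level of positive weight. Levels of weight zero can be
truncated, and compactness finishes (`exists_bounded_minimizer`). -/

open MeasureTheory ProbabilityTheory Filter Topology
open scoped ENNReal Matrix

noncomputable section

/-! ### Averages: Kronecker's lemma and summation by parts. -/

section Averages

/-- **Kronecker's lemma** for the weights `1 / (t + 1)`. -/
theorem tendsto_average_of_tendsto_sum_div {x : ℕ → ℝ} {l : ℝ}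
    (h : Tendsto (fun k => ∑ t ∈ Finset.range k, x t / (t + 1)) atTop (𝓝 l)) :
    Tendsto (fun k : ℕ => (∑ t ∈ Finset.range k, x t) / k) atTop (𝓝 0) := by
  set s : ℕ → ℝ := fun k => ∑ t ∈ Finset.range k, x t / (t + 1) with hs
  -- Abel summation: the average is `s k` minus the Cesàro mean of `s`, and both have the same
  -- limit.
  have key : ∀ k : ℕ, ∑ t ∈ Finset.range k, x t = k * s k - ∑ t ∈ Finset.range k, s t := by
    intro k
    induction k with
    | zero => simp
    | succ k ih =>
      have : s (k + 1) = s k + x k / (k + 1) := by simp [hs, Finset.sum_range_succ]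
      rw [Finset.sum_range_succ, Finset.sum_range_succ, ih, this]
      have : (k : ℝ) + 1 ≠ 0 := by positivity
      push_cast
      field_simp
      ring
  have h2 := h.sub h.cesaro
  rw [sub_self] at h2
  refine h2.congr' ?_
  filter_upwards [eventually_gt_atTop 0] with k hk
  have : (k : ℝ) ≠ 0 := by positivity
  rw [key k]
  field_simp

/-- Summation by parts: linearly growing partial sums are summable against `1 / (t + 1)²`. -/
theorem summable_div_sq_of_sum_le {x : ℕ → ℝ} (hx : ∀ t, 0 ≤ x t) {C : ℝ}
    (h : ∀ k : ℕ, ∑ t ∈ Finset.range k, x t ≤ C * k) :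
    Summable (fun t : ℕ => x t / ((t : ℝ) + 1) ^ 2) := by
  have hC : 0 ≤ C := by
    have := (hx 0).trans (by simpa using h 1)
    exact this
  -- An invariant that survives induction: changing the weight of the partial sum `T ≤ C (k+1)` from
  -- `1/(k+1)²` to `1/(k+2)²` costs at most the increment of the second term, because `2k+3 ≤
  -- 2(k+2)`.
  have key : ∀ k : ℕ, ∑ t ∈ Finset.range (k + 1), x t / ((t : ℝ) + 1) ^ 2 ≤
      (∑ t ∈ Finset.range (k + 1), x t) / ((k : ℝ) + 1) ^ 2 + 2 * C * (1 - 1 / ((k : ℝ) + 1)) := by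
    intro k
    induction k with
    | zero => simp
    | succ k ih =>
      rw [Finset.sum_range_succ, Finset.sum_range_succ _ (k + 1)]
      have hS := h (k + 1)
      set T := ∑ t ∈ Finset.range (k + 1), x t
      have hb : T / ((k : ℝ) + 1) ^ 2 + 2 * C * (1 - 1 / ((k : ℝ) + 1)) ≤
          T / ((k : ℝ) + 1 + 1) ^ 2 + 2 * C * (1 - 1 / ((k : ℝ) + 1 + 1)) := by
        have e1 : T / ((k : ℝ) + 1) ^ 2 - T / ((k : ℝ) + 1 + 1) ^ 2 =
            T * (2 * (k : ℝ) + 3) / (((k : ℝ) + 1) ^ 2 * ((k : ℝ) + 1 + 1) ^ 2) := by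
          field_simp
          ring
        have e2 : 2 * C * (1 - 1 / ((k : ℝ) + 1 + 1)) - 2 * C * (1 - 1 / ((k : ℝ) + 1)) =
            C * ((k : ℝ) + 1) * (2 * ((k : ℝ) + 1 + 1)) /
              (((k : ℝ) + 1) ^ 2 * ((k : ℝ) + 1 + 1) ^ 2) := by
          field_simp
          ring
        have : T * (2 * (k : ℝ) + 3) / (((k : ℝ) + 1) ^ 2 * ((k : ℝ) + 1 + 1) ^ 2) ≤
            C * ((k : ℝ) + 1) * (2 * ((k : ℝ) + 1 + 1)) /
              (((k : ℝ) + 1) ^ 2 * ((k : ℝ) + 1 + 1) ^ 2) := by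
          push_cast at hS
          gcongr
          linarith
        linarith
      push_cast
      rw [add_div]
      linarith
  refine summable_of_sum_range_le (c := C + 2 * C) (fun t => by have := hx t; positivity) ?_
  intro k
  refine (Finset.sum_le_sum_of_subset_of_nonneg (Finset.range_subset_range.2 (Nat.le_succ k))
    (fun t _ _ => by have := hx t; positivity)).trans ((key k).trans ?_)
  have h1 : (∑ t ∈ Finset.range (k + 1), x t) / ((k : ℝ) + 1) ^ 2 ≤ C := by
    rw [div_le_iff₀ (by positivity)]
    refine (h (k + 1)).trans ?_
    push_cast
    have : (k : ℝ) + 1 ≤ ((k : ℝ) + 1) ^ 2 := by nlinarith [(Nat.cast_nonneg k : (0 : ℝ) ≤ k)]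
    gcongr
  have h2 : 2 * C * (1 - 1 / ((k : ℝ) + 1)) ≤ 2 * C * 1 := by
    gcongr
    have : (0 : ℝ) ≤ 1 / ((k : ℝ) + 1) := by positivity
    linarith
  linarith

end Averages

/-! ### Strong laws for martingale differences with controlled conditional variance. -/

section Martingale

theorem measurable_enorm_sq {Ω : Type*} {m : MeasurableSpace Ω} {f : Ω → ℝ} (hf : Measurable f) :
    Measurable (fun ω => ‖f ω‖ₑ ^ 2) :=
  hf.enorm.pow_const 2

theorem measurable_enorm_sq_mul {Ω : Type*} {m : MeasurableSpace Ω} {f : Ω → ℝ} {V : Ω → ℝ≥0∞}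
    (hf : Measurable f) (hV : Measurable V) : Measurable (fun ω => ‖f ω‖ₑ ^ 2 * V ω) :=
  (measurable_enorm_sq hf).mul hV

theorem measurableSet_sum_le {Ω : Type*} {m : MeasurableSpace Ω} {f : ℕ → Ω → ℝ≥0∞} {k : ℕ}
    (hf : ∀ s < k, Measurable (f s)) (N : ℕ) :
    MeasurableSet {ω | ∑ s ∈ Finset.range k, f s ω ≤ N} :=
  measurableSet_le (Finset.measurable_fun_sum _ fun s hs => hf s (Finset.mem_range.1 hs))
    measurable_const

/-- The hypothesis compares two measures with densities on the smaller σ-algebra, and integrals of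
its measurable functions respect that order. This lets `V` act as a bound for a conditional
expectation without forming one. -/
theorem lintegral_mul_le_of_setLIntegral_le {Ω : Type*} {m mΩ : MeasurableSpace Ω} {μ : Measure Ω} (hm : m ≤ mΩ)
    {f V g : Ω → ℝ≥0∞} (hf : Measurable f) (hV : Measurable V)
    (h : ∀ A, MeasurableSet[m] A → ∫⁻ ω in A, f ω ∂μ ≤ ∫⁻ ω in A, V ω ∂μ)
    (hg : Measurable[m] g) : ∫⁻ ω, g ω * f ω ∂μ ≤ ∫⁻ ω, g ω * V ω ∂μ := by
  have hle : (μ.withDensity f).trim hm ≤ (μ.withDensity V).trim hm := by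
    refine Measure.le_iff.2 fun A hA => ?_
    rw [trim_measurableSet_eq hm hA, trim_measurableSet_eq hm hA, withDensity_apply _ (hm A hA),
      withDensity_apply _ (hm A hA)]
    exact h A hA
  have h1 := lintegral_mono' hle (le_refl g)
  rw [lintegral_trim hm hg, lintegral_trim hm hg,
    lintegral_withDensity_eq_lintegral_mul _ hf (hg.mono hm le_rfl),
    lintegral_withDensity_eq_lintegral_mul _ hV (hg.mono hm le_rfl)] at h1
  simpa [mul_comm] using h1

variable {Ω : Type*} {mΩ : MeasurableSpace Ω} {μ : Measure Ω} [IsProbabilityMeasure μ]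
  {ℱ : Filtration ℕ mΩ}

/-- Increments are orthogonal, so the partial sums are bounded in `L²`, hence in `L¹`, and Doob's
convergence theorem applies. -/
theorem ae_tendsto_sum_of_martingaleDiff {d : ℕ → Ω → ℝ}
    (hadp : ∀ t, StronglyMeasurable[ℱ (t + 1)] (d t)) (hL : ∀ t, MemLp (d t) 2 μ)
    (h0 : ∀ t, μ[d t | ℱ t] =ᵐ[μ] 0) (R : ℝ)
    (hb : ∀ k, ∑ t ∈ Finset.range k, ∫ ω, d t ω ^ 2 ∂μ ≤ R) :
    ∀ᵐ ω ∂μ, ∃ l, Tendsto (fun k => ∑ t ∈ Finset.range k, d t ω) atTop (𝓝 l) := by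
  set f : ℕ → Ω → ℝ := fun k ω => ∑ t ∈ Finset.range k, d t ω with hf
  have hfL : ∀ k, MemLp (f k) 2 μ := fun k => memLp_finsetSum _ fun t _ => hL t
  have hfi : ∀ k, Integrable (f k) μ := fun k => (hfL k).integrable one_le_two
  have hfs : ∀ k ω, f (k + 1) ω = f k ω + d k ω := fun k ω => Finset.sum_range_succ _ _
  have hfm : ∀ k, StronglyMeasurable[ℱ k] (f k) := fun k =>
    Finset.stronglyMeasurable_fun_sum _ fun t ht =>
      (hadp t).mono (ℱ.mono (Finset.mem_range.1 ht))
  have hmart : Martingale f ℱ μ := by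
    refine martingale_of_condExp_sub_eq_zero_nat hfm hfi fun k => ?_
    have : f (k + 1) - f k = d k := by
      ext ω
      simp [hfs]
    rw [this]
    exact h0 k
  have hsq : ∀ k, ∫ ω, f k ω ^ 2 ∂μ = ∑ t ∈ Finset.range k, ∫ ω, d t ω ^ 2 ∂μ := by
    intro k
    induction k with
    | zero => simp [hf]
    | succ k ih =>
      have hprod : Integrable (f k * d k) μ := (hfL k).integrable_mul (hL k)
      -- Orthogonality: `f k` is known at time `k` and comes out of the conditional expectation of
      -- `d k`, which vanishes.
      have hz : ∫ ω, (f k * d k) ω ∂μ = 0 := by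
        rw [← integral_condExp (ℱ.le k)]
        have := condExp_mul_of_stronglyMeasurable_left (hfm k) hprod
          ((hL k).integrable one_le_two)
        rw [integral_congr_ae this, integral_congr_ae
          ((EventuallyEq.refl _ (f k)).mul (h0 k))]
        simp
      have : ∀ ω, f (k + 1) ω ^ 2 = f k ω ^ 2 + 2 * (f k * d k) ω + d k ω ^ 2 := by
        intro ω
        rw [hfs, Pi.mul_apply]
        ring
      have hint : Integrable (fun ω => f k ω ^ 2 + 2 * (f k * d k) ω) μ :=
        (hfL k).integrable_sq.add (hprod.const_mul 2)
      simp_rw [this]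
      rw [integral_add hint (hL k).integrable_sq,
        integral_add (hfL k).integrable_sq (hprod.const_mul 2), integral_const_mul, hz, ih,
        Finset.sum_range_succ]
      ring
  refine hmart.submartingale.exists_ae_tendsto_of_bdd (R := Real.toNNReal (1 + R)) fun k => ?_
  rw [eLpNorm_one_eq_lintegral_enorm, ← ofReal_integral_norm_eq_lintegral_enorm (hfi k)]
  refine ENNReal.ofReal_le_ofReal ?_
  calc ∫ ω, ‖f k ω‖ ∂μ ≤ ∫ ω, (1 + f k ω ^ 2) ∂μ := by
        refine integral_mono (hfi k).norm ((integrable_const _).add (hfL k).integrable_sq) ?_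
        intro ω
        simp only [Real.norm_eq_abs]
        nlinarith [sq_abs (f k ω), sq_nonneg (|f k ω| - 1)]
    _ = 1 + ∫ ω, f k ω ^ 2 ∂μ := by
        rw [integral_add (integrable_const _) (hfL k).integrable_sq]
        simp
    _ ≤ 1 + R := by
        rw [hsq k]
        linarith [hb k]

/-- Localisation: switch the weights off once the accumulated conditional variance exceeds `N`. The
stopped series has total variance at most `N` and converges; almost every path is left untouched by
some `N`. -/
theorem ae_tendsto_sum_mul_of_condVar {c n : ℕ → Ω → ℝ} {V : ℕ → Ω → ℝ≥0∞}
    (hc : ∀ t, Measurable[ℱ t] (c t)) (hn : ∀ t, StronglyMeasurable[ℱ (t + 1)] (n t))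
    (hi : ∀ t, Integrable (n t) μ) (h0 : ∀ t, μ[n t | ℱ t] =ᵐ[μ] 0)
    (hVm : ∀ t, Measurable[ℱ t] (V t))
    (hV : ∀ t A, MeasurableSet[ℱ t] A → ∫⁻ ω in A, ‖n t ω‖ₑ ^ 2 ∂μ ≤ ∫⁻ ω in A, V t ω ∂μ)
    (hsum : ∀ᵐ ω ∂μ, ∑' t, ‖c t ω‖ₑ ^ 2 * V t ω < ∞) :
    ∀ᵐ ω ∂μ, ∃ l, Tendsto (fun k => ∑ t ∈ Finset.range k, c t ω * n t ω) atTop (𝓝 l) := by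
  classical
  -- The sum includes the term `s = t`, which is already known at time `t`; so the indicator is
  -- predictable and the bound `N` is never overshot.
  set A : ℕ → ℕ → Set Ω := fun N t =>
    {ω | ∑ s ∈ Finset.range (t + 1), ‖c s ω‖ₑ ^ 2 * V s ω ≤ N} with hA
  have hAm : ∀ N t, MeasurableSet[ℱ t] (A N t) := by
    intro N t
    refine measurableSet_sum_le (fun s hs => ?_) N
    have hle := ℱ.mono (Nat.lt_succ_iff.1 hs)
    exact measurable_enorm_sq_mul ((hc s).mono hle le_rfl) ((hVm s).mono hle le_rfl)
  set c' : ℕ → ℕ → Ω → ℝ := fun N t => (A N t).indicator (c t) with hc'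
  have hc'm : ∀ N t, Measurable[ℱ t] (c' N t) := fun N t => (hc t).indicator (hAm N t)
  have hL : ∀ N t, ∫⁻ ω, ‖c' N t ω * n t ω‖ₑ ^ 2 ∂μ ≤ ∫⁻ ω, ‖c' N t ω‖ₑ ^ 2 * V t ω ∂μ := by
    intro N t
    have := lintegral_mul_le_of_setLIntegral_le (ℱ.le t) (f := fun ω => ‖n t ω‖ₑ ^ 2) (V := V t)
      (g := fun ω => ‖c' N t ω‖ₑ ^ 2)
      (((hn t).mono (ℱ.le _)).measurable.enorm.pow_const 2) ((hVm t).mono (ℱ.le t) le_rfl)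
      (hV t) (measurable_enorm_sq (hc'm N t))
    simpa [enorm_mul, mul_pow] using this
  -- Either the whole untruncated sum up to `k` is at most `N`, or the last truncated term is zero.
  have hpt : ∀ N k ω, ∑ t ∈ Finset.range k, ‖c' N t ω‖ₑ ^ 2 * V t ω ≤ N := by
    intro N k ω
    induction k with
    | zero => simp
    | succ k ih =>
      by_cases hω : ω ∈ A N k
      · refine le_trans (Finset.sum_le_sum fun t _ => ?_) hω
        gcongr
        by_cases h : ω ∈ A N t <;> simp [hc', h]
      · rw [Finset.sum_range_succ]
        simpa [hc', hω] using ih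
  have hbd : ∀ N k, ∑ t ∈ Finset.range k, ∫⁻ ω, ‖c' N t ω * n t ω‖ₑ ^ 2 ∂μ ≤ N := by
    intro N k
    refine (Finset.sum_le_sum fun t _ => hL N t).trans ?_
    rw [← lintegral_finsetSum]
    · refine (lintegral_mono (hpt N k)).trans ?_
      simp
    · intro t _
      exact (((hc'm N t).mono (ℱ.le t) le_rfl).enorm.pow_const 2).mul ((hVm t).mono (ℱ.le t) le_rfl)
  have hmeas : ∀ N t, StronglyMeasurable[ℱ (t + 1)] (fun ω => c' N t ω * n t ω) := fun N t =>
    (((hc'm N t).mono (ℱ.mono (Nat.le_succ t)) le_rfl).stronglyMeasurable).mul (hn t)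
  have hmem : ∀ N t, MemLp (fun ω => c' N t ω * n t ω) 2 μ := by
    intro N t
    refine ⟨((hmeas N t).mono (ℱ.le _)).aestronglyMeasurable, ?_⟩
    rw [eLpNorm_lt_top_iff_lintegral_rpow_enorm_lt_top (by norm_num) (by norm_num)]
    have := hbd N (t + 1)
    rw [Finset.sum_range_succ] at this
    have := (le_add_self.trans this).trans_lt (ENNReal.natCast_lt_top N)
    simpa using this
  have hconv : ∀ N : ℕ, ∀ᵐ ω ∂μ, ∃ l,
      Tendsto (fun k => ∑ t ∈ Finset.range k, c' N t ω * n t ω) atTop (𝓝 l) := by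
    intro N
    refine ae_tendsto_sum_of_martingaleDiff (hmeas N) (hmem N) (fun t => ?_) N (fun k => ?_)
    · have := condExp_mul_of_stronglyMeasurable_left (hc'm N t).stronglyMeasurable
        ((hmem N t).integrable one_le_two) (hi t)
      refine this.trans (((EventuallyEq.refl _ (c' N t)).mul (h0 t)).trans ?_)
      exact Eventually.of_forall fun ω => by simp
    · have heq : ∀ t, ∫ ω, (c' N t ω * n t ω) ^ 2 ∂μ =
          (∫⁻ ω, ‖c' N t ω * n t ω‖ₑ ^ 2 ∂μ).toReal := by
        intro t
        rw [integral_eq_lintegral_of_nonneg_ae (Eventually.of_forall fun ω => sq_nonneg _)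
          ((hmem N t).integrable_sq.aestronglyMeasurable)]
        congr 1
        refine lintegral_congr fun ω => ?_
        rw [← ofReal_norm, ← ENNReal.ofReal_pow (norm_nonneg _), Real.norm_eq_abs, sq_abs]
      have hfin : ∀ t, ∫⁻ ω, ‖c' N t ω * n t ω‖ₑ ^ 2 ∂μ ≠ ∞ := by
        intro t
        have := hbd N (t + 1)
        rw [Finset.sum_range_succ] at this
        exact ((le_add_self.trans this).trans_lt (ENNReal.natCast_lt_top N)).ne
      simp_rw [heq]
      rw [← ENNReal.toReal_sum fun t _ => hfin t]
      exact ENNReal.toReal_le_of_le_ofReal (Nat.cast_nonneg N) (by simpa using hbd N k)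
  filter_upwards [ae_all_iff.2 hconv, hsum] with ω hω hs
  obtain ⟨N, hN⟩ := ENNReal.exists_nat_gt hs.ne
  obtain ⟨l, hl⟩ := hω N
  refine ⟨l, hl.congr fun k => Finset.sum_congr rfl fun t _ => ?_⟩
  have : ω ∈ A N t := (ENNReal.sum_le_tsum _).trans hN.le
  simp [hc', this]

/-- Strong law for weighted martingale differences. -/
theorem ae_tendsto_average_mul_of_condVar {c n : ℕ → Ω → ℝ} {V : ℕ → Ω → ℝ≥0∞}
    (hc : ∀ t, Measurable[ℱ t] (c t)) (hn : ∀ t, StronglyMeasurable[ℱ (t + 1)] (n t))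
    (hi : ∀ t, Integrable (n t) μ) (h0 : ∀ t, μ[n t | ℱ t] =ᵐ[μ] 0)
    (hVm : ∀ t, Measurable[ℱ t] (V t))
    (hV : ∀ t A, MeasurableSet[ℱ t] A → ∫⁻ ω in A, ‖n t ω‖ₑ ^ 2 ∂μ ≤ ∫⁻ ω in A, V t ω ∂μ)
    (hVb : ∀ᵐ ω ∂μ, ⨆ t, V t ω < ∞)
    (hsum : ∀ᵐ ω ∂μ, Summable fun t : ℕ => c t ω ^ 2 / ((t : ℝ) + 1) ^ 2) :
    ∀ᵐ ω ∂μ, Tendsto (fun k : ℕ => (∑ t ∈ Finset.range k, c t ω * n t ω) / k) atTop (𝓝 0) := by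
  have := ae_tendsto_sum_mul_of_condVar (c := fun t ω => c t ω / ((t : ℝ) + 1))
    (fun t => (hc t).div_const _) hn hi h0 hVm hV (by
      filter_upwards [hVb, hsum] with ω h1 h2
      calc ∑' t : ℕ, ‖c t ω / ((t : ℝ) + 1)‖ₑ ^ 2 * V t ω
          ≤ ∑' t : ℕ, ENNReal.ofReal (c t ω ^ 2 / ((t : ℝ) + 1) ^ 2) * ⨆ t, V t ω := by
            refine ENNReal.tsum_le_tsum fun t => ?_
            gcongr
            · rw [← ofReal_norm, ← ENNReal.ofReal_pow (norm_nonneg _),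
                Real.norm_eq_abs, sq_abs, div_pow]
            · exact le_iSup (fun t => V t ω) t
        _ < ∞ := by
            rw [ENNReal.tsum_mul_right]
            exact ENNReal.mul_lt_top h2.tsum_ofReal_lt_top h1)
  filter_upwards [this] with ω ⟨l, hl⟩
  refine tendsto_average_of_tendsto_sum_div (l := l) (hl.congr fun k => ?_)
  refine Finset.sum_congr rfl fun t _ => ?_
  ring

/-- If the conditional second moments stay bounded, the squares are summable against
`1 / (t + 1)²`. -/
theorem ae_summable_sq_div_of_condVar {n : ℕ → Ω → ℝ} {V : ℕ → Ω → ℝ≥0∞}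
    (hn : ∀ t, Measurable (n t)) (hVm : ∀ t, Measurable[ℱ t] (V t))
    (hV : ∀ t A, MeasurableSet[ℱ t] A → ∫⁻ ω in A, ‖n t ω‖ₑ ^ 2 ∂μ ≤ ∫⁻ ω in A, V t ω ∂μ)
    (hVb : ∀ᵐ ω ∂μ, ⨆ t, V t ω < ∞) :
    ∀ᵐ ω ∂μ, Summable fun t : ℕ => n t ω ^ 2 / ((t : ℝ) + 1) ^ 2 := by
  have hsm : Summable fun t : ℕ => 1 / ((t : ℝ) + 1) ^ 2 := by
    have := (summable_nat_add_iff 1).2 (Real.summable_one_div_nat_pow.2 one_lt_two)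
    simpa using this
  -- On `A N t` the second moment is at most `N`, so the truncated series has finite expectation; a
  -- path with bounded `V` lies in every `A N t` for some `N`.
  set A : ℕ → ℕ → Set Ω := fun N t => {ω | V t ω ≤ N} with hA
  have hAm : ∀ N t, MeasurableSet[ℱ t] (A N t) := fun N t => measurableSet_le (hVm t) measurable_const
  have hN : ∀ N : ℕ, ∀ᵐ ω ∂μ, ∑' t : ℕ, ENNReal.ofReal (1 / ((t : ℝ) + 1) ^ 2) *
      (A N t).indicator (fun ω => ‖n t ω‖ₑ ^ 2) ω < ∞ := by
    intro N
    have hm1 : ∀ t, Measurable ((A N t).indicator (fun ω => ‖n t ω‖ₑ ^ 2)) := fun t =>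
      ((hn t).enorm.pow_const 2).indicator (ℱ.le t _ (hAm N t))
    refine ae_lt_top (Measurable.tsum fun t => (hm1 t).const_mul _) ?_
    rw [lintegral_tsum fun t => ((hm1 t).const_mul _).aemeasurable]
    refine ne_of_lt (lt_of_le_of_lt (b := ∑' t : ℕ, ENNReal.ofReal (1 / ((t : ℝ) + 1) ^ 2) * N)
      (ENNReal.tsum_le_tsum fun t => ?_) ?_)
    · rw [lintegral_const_mul _ (hm1 t), lintegral_indicator (ℱ.le t _ (hAm N t))]
      gcongr
      refine (hV t _ (hAm N t)).trans ?_
      refine (setLIntegral_mono' (ℱ.le t _ (hAm N t)) (g := fun _ => (N : ℝ≥0∞))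
        (fun ω hω => hω)).trans ?_
      rw [setLIntegral_const]
      exact mul_le_of_le_one_right' prob_le_one
    · rw [ENNReal.tsum_mul_right]
      exact ENNReal.mul_lt_top hsm.tsum_ofReal_lt_top (ENNReal.natCast_lt_top N)
  filter_upwards [ae_all_iff.2 hN, hVb] with ω h1 h2
  obtain ⟨N, hN⟩ := ENNReal.exists_nat_gt h2.ne
  have h3 := h1 N
  have : ∀ t, ω ∈ A N t := fun t => (le_iSup (fun t => V t ω) t).trans hN.le
  simp only [Set.indicator_of_mem (this _)] at h3
  have h4 : ∑' t : ℕ, ENNReal.ofReal (n t ω ^ 2 / ((t : ℝ) + 1) ^ 2) ≠ ∞ := by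
    refine ne_of_lt (lt_of_le_of_lt (le_of_eq (tsum_congr fun t => ?_)) h3)
    rw [← ofReal_norm, ← ENNReal.ofReal_pow (norm_nonneg _), Real.norm_eq_abs, sq_abs,
      ← ENNReal.ofReal_mul (by positivity)]
    congr 1
    ring
  have h5 := ENNReal.summable_toReal h4
  refine h5.congr fun t => ?_
  rw [ENNReal.toReal_ofReal (by positivity)]

end Martingale

namespace MPARX

/-! ### Moments of the Laplace law. -/

section Laplace

theorem integral_laplace (b : ℝ) (hb : 0 < b) (f : ℝ → ℝ) :
    ∫ x, f x ∂laplace b = ∫ x, 1 / (2 * b) * Real.exp (-|x| / b) * f x := by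
  rw [laplace, integral_withDensity_eq_integral_toReal_smul (by fun_prop) (by simp)]
  refine integral_congr_ae (Eventually.of_forall fun x => ?_)
  simp only [smul_eq_mul]
  rw [ENNReal.toReal_ofReal (by positivity)]

theorem integral_sq_laplace {b : ℝ} (hb : 0 < b) : ∫ x, x ^ 2 ∂laplace b = 2 * b ^ 2 := by
  rw [integral_laplace b hb]
  have h1 : ∀ x : ℝ, 1 / (2 * b) * Real.exp (-|x| / b) * x ^ 2 =
      (fun r => 1 / (2 * b) * Real.exp (-r / b) * r ^ 2) |x| := by
    intro x
    simp
  simp_rw [h1]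
  rw [integral_comp_abs (f := fun r => 1 / (2 * b) * Real.exp (-r / b) * r ^ 2)]
  have h2 := Real.integral_rpow_mul_exp_neg_mul_Ioi (a := 3) (r := 1 / b) (by norm_num)
    (by positivity)
  have h3 : ∫ x in Set.Ioi (0 : ℝ), 1 / (2 * b) * Real.exp (-x / b) * x ^ 2 =
      1 / (2 * b) * ∫ t in Set.Ioi (0 : ℝ), t ^ ((3 : ℝ) - 1) * Real.exp (-(1 / b * t)) := by
    rw [← integral_const_mul]
    refine integral_congr_ae (Eventually.of_forall fun x => ?_)
    have : ((3 : ℝ) - 1) = ((2 : ℕ) : ℝ) := by norm_num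
    simp only [this, Real.rpow_natCast]
    have : -x / b = -(1 / b * x) := by ring
    rw [this]
    ring
  have hG : Real.Gamma 3 = 2 := by
    rw [show (3 : ℝ) = ((2 : ℕ) : ℝ) + 1 by norm_num, Real.Gamma_nat_eq_factorial]
    simp [Nat.factorial]
  have hp : (1 / (1 / b)) ^ (3 : ℝ) = b ^ 3 := by
    rw [one_div_one_div]
    exact_mod_cast Real.rpow_natCast b 3
  rw [h3, h2, hG, hp]
  field_simp

theorem integral_id_laplace {b : ℝ} (hb : 0 < b) : ∫ x, x ∂laplace b = 0 := by
  rw [integral_laplace b hb]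
  have := integral_neg_eq_self (fun x : ℝ => 1 / (2 * b) * Real.exp (-|x| / b) * x) volume
  simp only [abs_neg, mul_neg, integral_neg] at this
  linarith

theorem memLp_id_laplace {b : ℝ} (hb : 0 < b) : MemLp (fun x : ℝ => x) 2 (laplace b) := by
  rw [memLp_two_iff_integrable_sq measurable_id'.aestronglyMeasurable]
  -- The integral of a non-integrable function is zero by convention, so the nonzero value of the
  -- second moment already proves integrability.
  refine Integrable.of_integral_ne_zero ?_
  rw [integral_sq_laplace hb]
  positivity

end Laplace

/-! ### Laws of large numbers for the privacy noises. -/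

section IndepNoise

/-- The index `none` will carry the σ-algebra of the whole system, so that system and noises become
one independent family. -/
theorem iIndep_option_elim {ι Ω : Type*} {mΩ : MeasurableSpace Ω} {μ : Measure Ω}
    [IsProbabilityMeasure μ]
    {m : ι → MeasurableSpace Ω} {m₀ : MeasurableSpace Ω} (h : iIndep m μ)
    (h₀ : Indep (⨆ i, m i) m₀ μ) : iIndep (fun o : Option ι => o.elim m₀ m) μ := by
  classical
  rw [iIndep_iff]
  intro s f hf
  have hT : ∀ i ∈ s.eraseNone, MeasurableSet[m i] (f (some i)) := fun i hi =>
    hf (some i) (Finset.mem_eraseNone.1 hi)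
  have hprod := h.meas_biInter hT
  by_cases hn : none ∈ s
  · have hs : s = Finset.insertNone s.eraseNone := by
      rw [Finset.insertNone_eraseNone, Finset.insert_eq_self.2 hn]
    have hI : ⋂ o ∈ s, f o = (⋂ i ∈ s.eraseNone, f (some i)) ∩ f none := by
      ext x
      simp only [Set.mem_iInter, Set.mem_inter_iff, Finset.mem_eraseNone]
      refine ⟨fun hx => ⟨fun i hi => hx _ hi, hx _ hn⟩, fun hx o ho => ?_⟩
      cases o with
      | none => exact hx.2
      | some i => exact hx.1 i ho
    have hm : MeasurableSet[⨆ i, m i] (⋂ i ∈ s.eraseNone, f (some i)) :=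
      Finset.measurableSet_biInter _ fun i hi => le_iSup m i _ (hT i hi)
    rw [hI, (Indep_iff _ _ _).1 h₀ _ _ hm (hf none hn), hprod]
    conv_rhs => rw [hs]
    rw [Finset.prod_insertNone, mul_comm]
  · have hs : s = s.eraseNone.map Function.Embedding.some := by
      rw [Finset.map_some_eraseNone, Finset.erase_eq_of_notMem hn]
    have hI : ⋂ o ∈ s, f o = ⋂ i ∈ s.eraseNone, f (some i) := by
      ext x
      simp only [Set.mem_iInter, Finset.mem_eraseNone]
      refine ⟨fun hx i hi => hx _ hi, fun hx o ho => ?_⟩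
      cases o with
      | none => exact absurd ho hn
      | some i => exact hx i ho
    rw [hI, hprod]
    conv_rhs => rw [hs]
    rw [Finset.prod_map]
    rfl

/-- Mutually independent centred noise sequences with uniformly bounded second moments that are
independent of the `σ`-algebra `m₀`. -/
structure IndepNoise {Ω I : Type*} (m₀ : MeasurableSpace Ω) {mΩ : MeasurableSpace Ω} (μ : Measure Ω)
    (N : I → ℕ → Ω → ℝ) : Prop where
  le : m₀ ≤ mΩ
  meas : ∀ i t, Measurable (N i t)
  indep : iIndep (fun o : Option (I × ℕ) =>
    o.elim m₀ fun z => MeasurableSpace.comap (N z.1 z.2) inferInstance) μ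
  memLp : ∀ i t, MemLp (N i t) 2 μ
  mean : ∀ i t, ∫ ω, N i t ω ∂μ = 0
  moment : ∃ C : ℝ≥0∞, C < ∞ ∧ ∀ i t, ∫⁻ ω, ‖N i t ω‖ₑ ^ 2 ∂μ ≤ C

namespace IndepNoise

variable {Ω I : Type*} {m₀ mΩ : MeasurableSpace Ω} {μ : Measure Ω} {N : I → ℕ → Ω → ℝ}

/-- The `σ`-algebras generated by the system and by the individual noise variables. -/
abbrev source (m₀ : MeasurableSpace Ω) (N : I → ℕ → Ω → ℝ) (o : Option (I × ℕ)) :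
    MeasurableSpace Ω :=
  o.elim m₀ fun z => MeasurableSpace.comap (N z.1 z.2) inferInstance

theorem source_le (h : IndepNoise m₀ μ N) (o : Option (I × ℕ)) : source m₀ N o ≤ mΩ := by
  cases o with
  | none => exact h.le
  | some z => exact (h.meas z.1 z.2).comap_le

/-- Everything known before the noise `N i` at time `t + 1 - j` is revealed: the system, all other
noise sequences, and the noise `N i` at earlier times. -/
def past (h : IndepNoise m₀ μ N) (i : I) (j : ℕ) : Filtration ℕ mΩ where
  seq t := ⨆ o ∈ {o : Option (I × ℕ) | ∀ s, o = some (i, s) → s + j < t + 1}, source m₀ N o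
  mono' t t' htt := by
    refine biSup_mono fun o ho s hs => ?_
    have := ho s hs
    omega
  le' t := iSup₂_le fun o _ => h.source_le o

theorem measurable_past_of_system (h : IndepNoise m₀ μ N) (i : I) (j t : ℕ) {c : Ω → ℝ}
    (hc : Measurable[m₀] c) : Measurable[h.past i j t] c := by
  refine hc.mono ?_ le_rfl
  exact le_iSup₂_of_le (f := fun o (_ : o ∈ {o : Option (I × ℕ) |
    ∀ s, o = some (i, s) → s + j < t + 1}) => source m₀ N o) none (by intro s hs; cases hs) le_rfl

/-- The second alternative says `t' + 1 - j' < t + 1 - j` without truncated subtraction: the noise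
was drawn strictly before the current one of participant `i`. Before time zero the lag is constantly
zero. -/
theorem measurable_past_lag (h : IndepNoise m₀ μ N) {i i' : I} {j j' t t' : ℕ}
    (hij : i' ≠ i ∨ t' + j < t + j') :
    Measurable[h.past i j t] (fun ω => lag (fun s => N i' s ω) (t' + 1) j') := by
  unfold lag
  split_ifs with hle
  · refine (comap_measurable (N i' (t' + 1 - j'))).mono ?_ le_rfl
    refine le_iSup₂_of_le (f := fun o (_ : o ∈ {o : Option (I × ℕ) |
      ∀ s, o = some (i, s) → s + j < t + 1}) => source m₀ N o) (some (i', t' + 1 - j')) ?_ le_rfl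
    intro s hs
    simp only [Option.some.injEq, Prod.mk.injEq] at hs
    obtain ⟨rfl, rfl⟩ := hs
    rcases hij with h | h
    · exact absurd rfl h
    · omega
  · exact measurable_const

theorem indep_past (h : IndepNoise m₀ μ N) {i : I} {j t : ℕ} (hj : j ≤ t + 1) :
    Indep (MeasurableSpace.comap (N i (t + 1 - j)) inferInstance) (h.past i j t) μ := by
  have := indep_iSup_of_disjoint (m := source m₀ N) h.source_le h.indep
    (S := {some (i, t + 1 - j)})
    (T := {o : Option (I × ℕ) | ∀ s, o = some (i, s) → s + j < t + 1}) (by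
      rw [Set.disjoint_singleton_left]
      intro hmem
      have := hmem _ rfl
      omega)
  rw [iSup_singleton] at this
  exact this

variable [IsProbabilityMeasure μ]

theorem integrable_lag (h : IndepNoise m₀ μ N) (i : I) (j t : ℕ) :
    Integrable (fun ω => lag (fun s => N i s ω) t j) μ := by
  unfold lag
  split_ifs
  · exact (h.memLp i _).integrable one_le_two
  · exact integrable_zero _ _ _

theorem condExp_lag (h : IndepNoise m₀ μ N) (i : I) (j t : ℕ) :
    μ[fun ω => lag (fun s => N i s ω) (t + 1) j | h.past i j t] =ᵐ[μ] 0 := by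
  by_cases hj : j ≤ t + 1
  · have e : (fun ω => lag (fun s => N i s ω) (t + 1) j) = N i (t + 1 - j) := by
      ext ω
      simp [lag, hj]
    rw [e]
    have := condExp_indep_eq (h.meas i (t + 1 - j)).comap_le ((h.past i j).le t)
      (comap_measurable (N i (t + 1 - j))).stronglyMeasurable (h.indep_past hj)
    rw [h.mean] at this
    exact this
  · have e : (fun ω => lag (fun s => N i s ω) (t + 1) j) = 0 := by
      ext ω
      simp [lag, hj]
    rw [e, condExp_zero]

omit [IsProbabilityMeasure μ] in
theorem setLIntegral_lag_sq_le (h : IndepNoise m₀ μ N) {C : ℝ≥0∞}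
    (hC : ∀ i t, ∫⁻ ω, ‖N i t ω‖ₑ ^ 2 ∂μ ≤ C) (i : I) (j t : ℕ) {A : Set Ω}
    (hA : MeasurableSet[h.past i j t] A) :
    ∫⁻ ω in A, ‖lag (fun s => N i s ω) (t + 1) j‖ₑ ^ 2 ∂μ ≤ ∫⁻ _ in A, C ∂μ := by
  by_cases hj : j ≤ t + 1
  · simp only [lag, hj, if_true]
    have hA' := (h.past i j).le t _ hA
    have hm : Measurable[MeasurableSpace.comap (N i (t + 1 - j)) inferInstance]
        (fun ω => ‖N i (t + 1 - j) ω‖ₑ ^ 2) := measurable_enorm_sq (comap_measurable _)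
    -- The square and the indicator of the past event are independent, so the integral factors.
    have key := lintegral_mul_eq_lintegral_mul_lintegral_of_independent_measurableSpace
      (h.meas i (t + 1 - j)).comap_le ((h.past i j).le t) (h.indep_past hj) hm
      (g := A.indicator fun _ => 1) (measurable_const.indicator hA)
    have e : ∫⁻ ω in A, ‖N i (t + 1 - j) ω‖ₑ ^ 2 ∂μ =
        ∫⁻ ω, ‖N i (t + 1 - j) ω‖ₑ ^ 2 * A.indicator (fun _ => 1) ω ∂μ := by
      rw [← lintegral_indicator hA']
      refine lintegral_congr fun ω => ?_
      by_cases hω : ω ∈ A <;> simp [hω]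
    rw [e, key, setLIntegral_const, lintegral_indicator hA', setLIntegral_const, one_mul]
    gcongr
    exact hC _ _
  · simp [lag, hj]

/-- Strong law for a noise sequence with random weights that are known in advance. -/
theorem ae_tendsto_average_mul (h : IndepNoise m₀ μ N) (i : I) (j : ℕ) {c : ℕ → Ω → ℝ}
    (hc : ∀ t, Measurable[h.past i j t] (c t))
    (hsum : ∀ᵐ ω ∂μ, Summable fun t : ℕ => c t ω ^ 2 / ((t : ℝ) + 1) ^ 2) :
    ∀ᵐ ω ∂μ, Tendsto (fun k : ℕ =>
      (∑ t ∈ Finset.range k, c t ω * lag (fun s => N i s ω) (t + 1) j) / k) atTop (𝓝 0) := by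
  obtain ⟨C, hC, hCb⟩ := h.moment
  refine ae_tendsto_average_mul_of_condVar (ℱ := h.past i j) (V := fun _ _ => C) hc
    (fun t => ?_) (fun t => h.integrable_lag i j _) (fun t => h.condExp_lag i j t)
    (fun t => measurable_const) (fun t A hA => h.setLIntegral_lag_sq_le hCb i j t hA)
    (by simp [hC]) hsum
  exact (h.measurable_past_lag (Or.inr (by omega))).stronglyMeasurable

theorem ae_summable_lag_sq (h : IndepNoise m₀ μ N) (i : I) (j : ℕ) :
    ∀ᵐ ω ∂μ, Summable fun t : ℕ =>
      lag (fun s => N i s ω) (t + 1) j ^ 2 / ((t : ℝ) + 1) ^ 2 := by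
  obtain ⟨C, hC, hCb⟩ := h.moment
  refine ae_summable_sq_div_of_condVar (ℱ := h.past i j) (V := fun _ _ => C)
    (fun t => ?_) (fun t => measurable_const)
    (fun t A hA => h.setLIntegral_lag_sq_le hCb i j t hA) (by simp [hC])
  have := h.measurable_past_lag (i := i) (i' := i) (j := j) (j' := j) (t := t + 1) (t' := t)
    (Or.inr (by omega))
  exact this.mono ((h.past i j).le _) le_rfl

/-- Different noises are asymptotically uncorrelated. -/
theorem ae_tendsto_average_lag_mul_lag (h : IndepNoise m₀ μ N) {i i' : I} {j j' : ℕ}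
    (hne : (i, j) ≠ (i', j')) :
    ∀ᵐ ω ∂μ, Tendsto (fun k : ℕ => (∑ t ∈ Finset.range k,
      lag (fun s => N i s ω) (t + 1) j * lag (fun s => N i' s ω) (t + 1) j') / k)
      atTop (𝓝 0) := by
  -- The factor with the larger delay, or from another participant, belongs to the past of the other
  -- one and serves as its weight. Equal participants with unequal delays are brought into this
  -- order by commutativity.
  have key : ∀ {i i' : I} {j j' : ℕ}, i ≠ i' ∨ j' < j → ∀ᵐ ω ∂μ, Tendsto (fun k : ℕ =>
      (∑ t ∈ Finset.range k,
        lag (fun s => N i s ω) (t + 1) j * lag (fun s => N i' s ω) (t + 1) j') / k)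
      atTop (𝓝 0) := by
    intro i i' j j' hij
    refine h.ae_tendsto_average_mul i' j' (fun t => h.measurable_past_lag ?_)
      (h.ae_summable_lag_sq i j)
    rcases hij with h | h
    · exact Or.inl h
    · exact Or.inr (by omega)
  by_cases hi : i = i'
  · subst hi
    rcases lt_trichotomy j j' with hlt | heq | hlt
    · simpa only [mul_comm] using key (i := i) (i' := i) (j := j') (j' := j) (Or.inr hlt)
    · exact absurd (by rw [heq]) hne
    · exact key (Or.inr hlt)
  · exact key (Or.inl hi)

theorem tendsto_average_of_shift {f g : ℕ → ℝ} {v : ℝ} (hfg : ∀ t, f (t + 1) = g t)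
    (h : Tendsto (fun k : ℕ => (∑ t ∈ Finset.range k, g t) / k) atTop (𝓝 v)) :
    Tendsto (fun k : ℕ => (∑ t ∈ Finset.range k, f t) / k) atTop (𝓝 v) := by
  rw [← tendsto_add_atTop_iff_nat 1]
  have h1 : Tendsto (fun k : ℕ => f 0 / ((k : ℝ) + 1)) atTop (𝓝 0) :=
    tendsto_const_nhds.div_atTop (tendsto_atTop_add_const_right _ _ tendsto_natCast_atTop_atTop)
  have h2 := tendsto_natCast_div_add_atTop (𝕜 := ℝ) 1
  have h3 := h1.add (h.mul h2)
  rw [zero_add, mul_one] at h3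
  refine h3.congr' ?_
  filter_upwards [eventually_gt_atTop 0] with k hk
  have : (k : ℝ) ≠ 0 := by positivity
  rw [Finset.sum_range_succ']
  simp_rw [hfg]
  push_cast
  field_simp
  ring

omit [IsProbabilityMeasure μ] in
-- The strong law for independent identically distributed variables, applied to the squares from
-- time `1` on because the output noise at time `0` is zero; further delays only shift the sequence.
theorem ae_tendsto_average_lag_sq (h : IndepNoise m₀ μ N) (i : I) {b : ℝ} (hb : 0 < b)
    (hlaw : ∀ t, μ.map (N i (t + 1)) = laplace b) (j : ℕ) :
    ∀ᵐ ω ∂μ, Tendsto (fun k : ℕ => (∑ t ∈ Finset.range k,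
      lag (fun s => N i s ω) (t + 1) j ^ 2) / k) atTop (𝓝 (2 * b ^ 2)) := by
  have hmean : ∫ ω, N i 1 ω ^ 2 ∂μ = 2 * b ^ 2 := by
    rw [← integral_sq_laplace hb, ← hlaw 0, integral_map (h.meas i _).aemeasurable]
    exact (measurable_id.pow_const 2).aestronglyMeasurable
  have hind : Pairwise (Function.onFun (fun f g => IndepFun f g μ)
      fun t ω => N i (t + 1) ω ^ 2) := by
    intro s t hst
    have h1 := iIndep.indep h.indep (i := some (i, s + 1)) (j := some (i, t + 1)) (by
      simpa using hst)
    have h2 : IndepFun (N i (s + 1)) (N i (t + 1)) μ := h1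
    exact h2.comp (φ := fun x => x ^ 2) (ψ := fun x => x ^ 2) (measurable_id.pow_const 2)
      (measurable_id.pow_const 2)
  have hid : ∀ t, IdentDistrib (fun ω => N i (t + 1) ω ^ 2) (fun ω => N i (0 + 1) ω ^ 2) μ μ := by
    intro t
    have : IdentDistrib (N i (t + 1)) (N i (0 + 1)) μ μ :=
      ⟨(h.meas i _).aemeasurable, (h.meas i _).aemeasurable, by rw [hlaw, hlaw]⟩
    exact this.comp (u := fun x => x ^ 2) (measurable_id.pow_const 2)
  have := strong_law_ae_real (fun t ω => N i (t + 1) ω ^ 2) (h.memLp i _).integrable_sq hind hid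
  filter_upwards [this] with ω hω
  rw [hmean] at hω
  induction j with
  | zero => simpa [lag] using hω
  | succ j ih =>
    refine tendsto_average_of_shift (fun t => ?_) ih
    simp [lag]

end IndepNoise

end IndepNoise

end MPARX

namespace MPARX

/-! ### Gram matrices and the deterministic least-squares estimate. -/

section Gram

section Norm

variable {ι : Type*} [Fintype ι]

theorem eNorm_sq (x : ι → ℝ) : eNorm x ^ 2 = x ⬝ᵥ x := by
  rw [eNorm, Real.sq_sqrt (Finset.sum_nonneg fun i _ => sq_nonneg _)]
  simp [dotProduct, sq]

theorem eNorm_nonneg (x : ι → ℝ) : 0 ≤ eNorm x := Real.sqrt_nonneg _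

theorem dotProduct_le_eNorm (x z : ι → ℝ) : x ⬝ᵥ z ≤ eNorm x * eNorm z :=
  Real.sum_mul_le_sqrt_mul_sqrt _ _ _

theorem abs_le_eNorm (x : ι → ℝ) (i : ι) : |x i| ≤ eNorm x :=
  Real.abs_le_sqrt (Finset.single_le_sum (f := fun j => x j ^ 2) (fun _ _ => sq_nonneg _)
    (Finset.mem_univ i))

end Norm

variable {ι : Type*} [Fintype ι] [DecidableEq ι]

/-- The regularized Gram matrix `∑_{t < k} φ_t φ_tᵀ + α I`. -/
def gram (φ : ℕ → ι → ℝ) (α : ℝ) (k : ℕ) : Matrix ι ι ℝ :=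
  ∑ t ∈ Finset.range k, Matrix.vecMulVec (φ t) (φ t) + α • (1 : Matrix ι ι ℝ)

omit [Fintype ι] in
theorem gram_succ (φ : ℕ → ι → ℝ) (α : ℝ) (k : ℕ) :
    gram φ α (k + 1) = gram φ α k + Matrix.vecMulVec (φ k) (φ k) := by
  rw [gram, gram, Finset.sum_range_succ]
  abel

theorem gram_mulVec (φ : ℕ → ι → ℝ) (α : ℝ) (k : ℕ) (x : ι → ℝ) :
    gram φ α k *ᵥ x = ∑ t ∈ Finset.range k, (φ t ⬝ᵥ x) • φ t + α • x := by
  induction k with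
  | zero => simp [gram, Matrix.smul_mulVec]
  | succ k ih =>
    rw [gram_succ, Matrix.add_mulVec, ih, Finset.sum_range_succ, Matrix.vecMulVec_mulVec]
    simp only [op_smul_eq_smul]
    abel

theorem dotProduct_gram_mulVec (φ : ℕ → ι → ℝ) (α : ℝ) (k : ℕ) (x : ι → ℝ) :
    x ⬝ᵥ (gram φ α k *ᵥ x) = ∑ t ∈ Finset.range k, (φ t ⬝ᵥ x) ^ 2 + α * (x ⬝ᵥ x) := by
  rw [gram_mulVec, dotProduct_add, dotProduct_sum, dotProduct_smul, smul_eq_mul]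
  congr 1
  refine Finset.sum_congr rfl fun t _ => ?_
  rw [dotProduct_smul, smul_eq_mul, dotProduct_comm x, sq]

omit [Fintype ι] in
theorem isHermitian_gram (φ : ℕ → ι → ℝ) (α : ℝ) (k : ℕ) : (gram φ α k).IsHermitian := by
  ext i j
  simp only [Matrix.conjTranspose_apply, star_trivial, gram, Matrix.add_apply, Matrix.sum_apply,
    Matrix.vecMulVec_apply, Matrix.smul_apply, Matrix.one_apply, eq_comm (a := i)]
  congr 1
  exact Finset.sum_congr rfl fun t _ => mul_comm _ _

/-- Subtracting the smallest eigenvalue times the identity shifts the spectrum into the nonnegative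
reals, which leaves a positive semidefinite matrix. -/
theorem lambdaMin_mul_le {M : Matrix ι ι ℝ} (hM : M.IsHermitian) (x : ι → ℝ) :
    lambdaMin M * (x ⬝ᵥ x) ≤ x ⬝ᵥ (M *ᵥ x) := by
  have hb : BddBelow (spectrum ℝ M) := M.finite_real_spectrum.bddBelow
  have hp : (M - algebraMap ℝ (Matrix ι ι ℝ) (lambdaMin M)).PosSemidef := by
    rw [Matrix.posSemidef_iff_isHermitian_and_spectrum_nonneg]
    refine ⟨?_, fun a ha => ?_⟩
    · refine hM.sub ?_
      rw [Algebra.algebraMap_eq_smul_one]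
      simp [Matrix.IsHermitian]
    · have ha' : a ∈ spectrum ℝ (M - algebraMap ℝ (Matrix ι ι ℝ) (lambdaMin M)) := ha
      rw [← spectrum.sub_singleton_eq] at ha'
      obtain ⟨r, hr, s, rfl, rfl⟩ := Set.mem_sub.1 ha'
      exact sub_nonneg.2 (csInf_le hb hr)
  have := hp.dotProduct_mulVec_nonneg x
  rw [Matrix.sub_mulVec, dotProduct_sub, Algebra.algebraMap_eq_smul_one, Matrix.smul_mulVec,
    Matrix.one_mulVec, dotProduct_smul, smul_eq_mul] at this
  simp only [star_trivial] at this
  linarith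

/-- A weighted least-squares estimate: if `(∑ φ_t φ_tᵀ + α I) e = ∑ x_t φ_t + g`, then `e` is
controlled by the energy of `x`, by `g` and by a lower bound of the Gram matrix. -/
theorem eNorm_le_of_gram_mulVec_eq {φ : ℕ → ι → ℝ} {α : ℝ} (hα : 0 ≤ α) {k : ℕ} {e g : ι → ℝ}
    {x : ℕ → ℝ} (h : gram φ α k *ᵥ e = ∑ t ∈ Finset.range k, x t • φ t + g) {K : ℝ} (hK : 0 < K)
    (hlow : K * (e ⬝ᵥ e) ≤ e ⬝ᵥ (gram φ α k *ᵥ e)) :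
    eNorm e ≤ Real.sqrt ((∑ t ∈ Finset.range k, x t ^ 2) / K) + eNorm g / K := by
  set a := eNorm e
  set X := ∑ t ∈ Finset.range k, x t ^ 2 with hX
  set Q := e ⬝ᵥ (gram φ α k *ᵥ e) with hQ
  have ha : 0 ≤ a := eNorm_nonneg e
  have hg : 0 ≤ eNorm g := eNorm_nonneg g
  rw [← eNorm_sq] at hlow
  have hQ0 : 0 ≤ Q := le_trans (by positivity) hlow
  -- Pair the equation with `e`. Cauchy-Schwarz is applied to the sequences `⟨φ_t, e⟩` and `x_t`,
  -- and the energy of the first is at most `Q` itself; estimating `∑ x_t φ_t` by norms would lose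
  -- this.
  have hcs : Q ≤ Real.sqrt Q * Real.sqrt X + a * eNorm g := by
    have h1 : Q = ∑ t ∈ Finset.range k, (φ t ⬝ᵥ e) * x t + e ⬝ᵥ g := by
      rw [hQ, h, dotProduct_add, dotProduct_sum]
      congr 1
      refine Finset.sum_congr rfl fun t _ => ?_
      rw [dotProduct_smul, smul_eq_mul, dotProduct_comm, mul_comm]
    have h2 := Real.sum_mul_le_sqrt_mul_sqrt (Finset.range k) (fun t => φ t ⬝ᵥ e) x
    have h3 : ∑ t ∈ Finset.range k, (φ t ⬝ᵥ e) ^ 2 ≤ Q := by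
      rw [hQ, dotProduct_gram_mulVec, ← eNorm_sq]
      have : 0 ≤ α * eNorm e ^ 2 := by positivity
      linarith
    have h4 := Real.sqrt_le_sqrt h3
    have h5 := mul_le_mul_of_nonneg_right h4 (Real.sqrt_nonneg X)
    have h6 := dotProduct_le_eNorm e g
    linarith
  rcases ha.eq_or_lt with h0 | h0
  · rw [← h0]
    positivity
  have hsK : 0 < Real.sqrt K := Real.sqrt_pos.2 hK
  have hsQ : Real.sqrt K * a ≤ Real.sqrt Q := by
    rw [← Real.sqrt_sq ha, ← Real.sqrt_mul hK.le]
    exact Real.sqrt_le_sqrt hlow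
  have hsQ0 : 0 < Real.sqrt Q := lt_of_lt_of_le (by positivity) hsQ
  -- Divide by `√Q`, after trading `a` for `√Q / √K` in the term with `g`.
  have h7 : Real.sqrt Q ≤ Real.sqrt X + eNorm g / Real.sqrt K := by
    have h8 : Real.sqrt Q * Real.sqrt Q ≤
        Real.sqrt Q * (Real.sqrt X + eNorm g / Real.sqrt K) := by
      rw [Real.mul_self_sqrt hQ0, mul_add]
      have h9 : a * eNorm g ≤ Real.sqrt Q * (eNorm g / Real.sqrt K) :=
        calc a * eNorm g = Real.sqrt K * a * (eNorm g / Real.sqrt K) := by field_simp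
          _ ≤ _ := by gcongr
      linarith
    exact le_of_mul_le_mul_left h8 hsQ0
  have h9 : a ≤ (Real.sqrt X + eNorm g / Real.sqrt K) / Real.sqrt K := by
    rw [le_div_iff₀ hsK, mul_comm]
    exact hsQ.trans h7
  rw [Real.sqrt_div' _ hK.le]
  refine h9.trans (le_of_eq ?_)
  rw [add_div, div_div, Real.mul_self_sqrt hK.le]

end Gram

/-! ### The recursion solves the regularised normal equation. -/

section RLS

variable {m : ℕ} (S : MPARX m)

/-- The gain update is the Sherman-Morrison formula for a rank-one change of the Gram matrix.
Multiplying the estimate update by the new Gram matrix turns it into the addition of one term to the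
right side. -/
theorem rls_spec {α : ℝ} (hα : 0 < α) (θ0 : S.Idx → ℝ) (ybar : ℕ → ℝ) (ubar : Fin m → ℕ → ℝ)
    (k : ℕ) :
    gram (S.regressor ybar ubar) α k * S.gain α θ0 ybar ubar k = 1 ∧
    gram (S.regressor ybar ubar) α k *ᵥ S.estimate α θ0 ybar ubar k =
      ∑ t ∈ Finset.range k, ybar (t + 1) • S.regressor ybar ubar t + α • θ0 := by
  induction k with
  | zero =>
    simp only [gram, gain, estimate, rls, Finset.range_zero, Finset.sum_empty, zero_add]
    constructor
    · rw [smul_mul_smul_comm, mul_inv_cancel₀ hα.ne', one_smul, one_mul]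
    · rw [Matrix.smul_mulVec, Matrix.one_mulVec]
  | succ k ih =>
    obtain ⟨ih1, ih2⟩ := ih
    have hg : S.gain α θ0 ybar ubar (k + 1) = S.gain α θ0 ybar ubar k -
        (1 + S.regressor ybar ubar k ⬝ᵥ (S.gain α θ0 ybar ubar k *ᵥ S.regressor ybar ubar k))⁻¹ •
          Matrix.vecMulVec (S.gain α θ0 ybar ubar k *ᵥ S.regressor ybar ubar k)
            (S.regressor ybar ubar k ᵥ* S.gain α θ0 ybar ubar k) := rfl
    have he : S.estimate α θ0 ybar ubar (k + 1) = S.estimate α θ0 ybar ubar k +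
        ((1 + S.regressor ybar ubar k ⬝ᵥ (S.gain α θ0 ybar ubar k *ᵥ S.regressor ybar ubar k))⁻¹ *
          (ybar (k + 1) - S.regressor ybar ubar k ⬝ᵥ S.estimate α θ0 ybar ubar k)) •
          (S.gain α θ0 ybar ubar k *ᵥ S.regressor ybar ubar k) := rfl
    rw [hg, he, gram_succ, Finset.sum_range_succ]
    set P := S.gain α θ0 ybar ubar k
    set φ := S.regressor ybar ubar k
    set R := gram (S.regressor ybar ubar) α k
    set θ := S.estimate α θ0 ybar ubar k
    have hRP : R *ᵥ (P *ᵥ φ) = φ := by rw [Matrix.mulVec_mulVec, ih1, Matrix.one_mulVec]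
    -- This number is the quadratic form of the Gram matrix at `P φ`; so the denominator `1 + c`
    -- cannot vanish.
    have hpos : 0 ≤ φ ⬝ᵥ (P *ᵥ φ) := by
      have h1 := dotProduct_gram_mulVec (S.regressor ybar ubar) α k (P *ᵥ φ)
      have h2 : (P *ᵥ φ) ⬝ᵥ (R *ᵥ (P *ᵥ φ)) = φ ⬝ᵥ (P *ᵥ φ) := by rw [hRP, dotProduct_comm]
      rw [h2, ← eNorm_sq] at h1
      rw [h1]
      positivity
    set c := φ ⬝ᵥ (P *ᵥ φ) with hc
    have hne : 1 + c ≠ 0 := by positivity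
    constructor
    · rw [add_mul, mul_sub, mul_sub, ih1, Matrix.mul_smul, Matrix.mul_smul, Matrix.mul_vecMulVec,
        hRP, Matrix.vecMulVec_mul, Matrix.vecMulVec_mul_vecMulVec, ← hc, Matrix.vecMulVec_smul]
      have : (1 + c)⁻¹ • Matrix.vecMulVec φ (φ ᵥ* P) +
          (1 + c)⁻¹ • c • Matrix.vecMulVec φ (φ ᵥ* P) = Matrix.vecMulVec φ (φ ᵥ* P) := by
        rw [smul_smul, ← add_smul]
        have : (1 + c)⁻¹ + (1 + c)⁻¹ * c = 1 := by field_simp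
        rw [this, one_smul]
      nth_rewrite 2 [← this]
      abel
    · rw [Matrix.mulVec_add, Matrix.mulVec_smul, Matrix.add_mulVec, Matrix.add_mulVec, ih2, hRP,
        Matrix.vecMulVec_mulVec, Matrix.vecMulVec_mulVec, ← hc]
      simp only [op_smul_eq_smul]
      have h3 : ((1 + c)⁻¹ * (ybar (k + 1) - φ ⬝ᵥ θ)) • (φ + c • φ) =
          ybar (k + 1) • φ - (φ ⬝ᵥ θ) • φ := by
        have : φ + c • φ = (1 + c) • φ := by rw [add_smul, one_smul]
        rw [this, smul_smul, ← sub_smul]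
        congr 1
        field_simp
      rw [h3]
      abel

/-- The normal equation for the estimation error. -/
theorem gram_mulVec_error {α : ℝ} (hα : 0 < α) (θ0 : S.Idx → ℝ) (ybar : ℕ → ℝ)
    (ubar : Fin m → ℕ → ℝ) (k : ℕ) :
    gram (S.regressor ybar ubar) α k *ᵥ (S.theta - S.estimate α θ0 ybar ubar k) =
      ∑ t ∈ Finset.range k, (S.regressor ybar ubar t ⬝ᵥ S.theta - ybar (t + 1)) •
        S.regressor ybar ubar t + α • (S.theta - θ0) := by
  rw [Matrix.mulVec_sub, (S.rls_spec hα θ0 ybar ubar k).2, gram_mulVec]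
  simp only [sub_smul, Finset.sum_sub_distrib, smul_sub]
  abel

end RLS

/-! ### Asymptotic size of the solutions of perturbed normal equations. -/

section Limit

/-- The averages `(x_0 + ... + x_{k-1}) / k` converge to `l`. -/
def AvgTo (x : ℕ → ℝ) (l : ℝ) : Prop :=
  Tendsto (fun k : ℕ => (∑ t ∈ Finset.range k, x t) / k) atTop (𝓝 l)

theorem AvgTo.add {x z : ℕ → ℝ} {a b : ℝ} (hx : AvgTo x a) (hz : AvgTo z b) :
    AvgTo (fun t => x t + z t) (a + b) := by
  refine (Tendsto.add hx hz).congr fun k => ?_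
  rw [Finset.sum_add_distrib, add_div]

theorem AvgTo.const_mul {x : ℕ → ℝ} {a : ℝ} (c : ℝ) (hx : AvgTo x a) :
    AvgTo (fun t => c * x t) (c * a) := by
  refine (Tendsto.const_mul c hx).congr fun k => ?_
  rw [← Finset.mul_sum, mul_div_assoc]

theorem AvgTo.sum {ι : Type*} {s : Finset ι} {x : ι → ℕ → ℝ} {a : ι → ℝ}
    (hx : ∀ i ∈ s, AvgTo (x i) (a i)) : AvgTo (fun t => ∑ i ∈ s, x i t) (∑ i ∈ s, a i) := by
  refine (tendsto_finsetSum s hx).congr fun k => ?_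
  rw [Finset.sum_comm, Finset.sum_div]

variable {ι : Type*} [Fintype ι] [DecidableEq ι]

/-- Asymptotic size of the solutions `e_k` of the normal equations
`(∑_{t<k} φ̄_t φ̄_tᵀ + α I) e_k = ∑_{t<k} (⟨ζ_t, θ⟩ - n_t) φ̄_t + α d` with `φ̄ = φ + ζ`. -/
theorem limsup_eNorm_le {φ ζ : ℕ → ι → ℝ} {n : ℕ → ℝ} {e : ℕ → ι → ℝ} {θ d : ι → ℝ} {α γ v₀ : ℝ}
    {v : ι → ℝ} (hα : 0 < α) (hγ : 0 < γ) (hv₀ : 0 ≤ v₀) (hv : ∀ a, v₀ ≤ v a)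
    (he : ∀ k, gram (fun t => φ t + ζ t) α k *ᵥ e k =
      ∑ t ∈ Finset.range k, (ζ t ⬝ᵥ θ - n t) • (φ t + ζ t) + α • d)
    (hφζ : ∀ a b, AvgTo (fun t => φ t a * ζ t b) 0)
    (hζζ : ∀ a b, AvgTo (fun t => ζ t a * ζ t b) (if a = b then v a else 0))
    (hn : ∀ a, AvgTo (fun t => (φ t a + ζ t a) * n t) 0)
    (hexc : (γ : EReal) < liminf (fun k : ℕ => ((lambdaMin (gram φ α k) / k : ℝ) : EReal)) atTop) :
    limsup (fun k => ((eNorm (e k) : ℝ) : EReal)) atTop ≤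
      ((Real.sqrt ((∑ a, θ a ^ 2 * v a) / (γ + v₀)) : ℝ) : EReal) := by
  set κ := γ + v₀ with hκ
  have hκ0 : 0 < κ := by positivity
  set g : ℕ → ι → ℝ := fun k => -∑ t ∈ Finset.range k, n t • (φ t + ζ t) + α • d with hg
  have he' : ∀ k, gram (fun t => φ t + ζ t) α k *ᵥ e k =
      ∑ t ∈ Finset.range k, (ζ t ⬝ᵥ θ) • (φ t + ζ t) + g k := by
    intro k
    rw [he, hg]
    simp only [sub_smul, Finset.sum_sub_distrib]
    abel
  -- the perturbation `g` is negligible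
  have hglim : Tendsto (fun k : ℕ => eNorm (g k) / k) atTop (𝓝 0) := by
    have h1 : ∀ a, Tendsto (fun k : ℕ => g k a / k) atTop (𝓝 0) := by
      intro a
      have h2 : Tendsto (fun k : ℕ => α * d a / (k : ℝ)) atTop (𝓝 0) :=
        tendsto_const_nhds.div_atTop tendsto_natCast_atTop_atTop
      have h3 := (Tendsto.neg (hn a)).add h2
      rw [neg_zero, zero_add] at h3
      refine h3.congr fun k => ?_
      simp only [hg, Pi.add_apply, Pi.neg_apply, Finset.sum_apply, Pi.smul_apply, smul_eq_mul,
        mul_comm (n _)]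
      ring
    have h4 : Tendsto (fun k : ℕ => Real.sqrt (∑ a, (g k a / k) ^ 2)) atTop (𝓝 0) := by
      have := (tendsto_finsetSum Finset.univ fun a _ => (h1 a).pow 2).sqrt
      simpa using this
    refine h4.congr fun k => ?_
    rw [eNorm]
    simp_rw [div_pow]
    rw [← Finset.sum_div, Real.sqrt_div' _ (sq_nonneg _), Real.sqrt_sq (Nat.cast_nonneg k)]
  -- the energy of `⟨ζ_t, θ⟩`
  have hX : AvgTo (fun t => (ζ t ⬝ᵥ θ) ^ 2) (∑ a, θ a ^ 2 * v a) := by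
    have h1 : AvgTo (fun t => ∑ a, ∑ b, (θ a * θ b) * (ζ t a * ζ t b))
        (∑ a, ∑ b, (θ a * θ b) * (if a = b then v a else 0)) :=
      AvgTo.sum fun a _ => AvgTo.sum fun b _ => (hζζ a b).const_mul _
    have h2 : ∑ a, ∑ b, (θ a * θ b) * (if a = b then v a else 0) = ∑ a, θ a ^ 2 * v a := by
      refine Finset.sum_congr rfl fun a _ => ?_
      simp [sq]
    rw [h2] at h1
    convert h1 using 2 with t
    rw [sq, dotProduct, Finset.sum_mul_sum]
    refine Finset.sum_congr rfl fun a _ => Finset.sum_congr rfl fun b _ => ?_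
    ring
  -- the perturbed Gram matrix
  set M : ℕ → ι → ι → ℝ := fun k a b =>
    (∑ t ∈ Finset.range k, (2 * (φ t a * ζ t b) + ζ t a * ζ t b)) / k -
      if a = b then v a else 0 with hM
  have hMlim : Tendsto (fun k => ∑ a, ∑ b, |M k a b|) atTop (𝓝 0) := by
    have h1 : ∀ a b, Tendsto (fun k => |M k a b|) atTop (𝓝 0) := by
      intro a b
      have := (((hφζ a b).const_mul 2).add (hζζ a b)).sub_const (if a = b then v a else 0)
      simpa using this.abs
    simpa using tendsto_finsetSum Finset.univ fun a _ =>
      tendsto_finsetSum Finset.univ fun b _ => h1 a b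
  -- The gap between `γ` and `γ'` absorbs the vanishing matrix `M`, so that the limit bound holds
  -- with `γ` exactly.
  obtain ⟨γ', hγ', hγ'2⟩ := EReal.lt_iff_exists_real_btwn.1 hexc
  have hγγ : γ < γ' := by exact_mod_cast hγ'
  have hev := eventually_lt_of_lt_liminf hγ'2
  have hMev := hMlim.eventually_lt_const (sub_pos.2 hγγ)
  have hbound : ∀ᶠ k : ℕ in atTop, eNorm (e k) ≤
      Real.sqrt (((∑ t ∈ Finset.range k, (ζ t ⬝ᵥ θ) ^ 2) / k) / κ) + eNorm (g k) / k / κ := by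
    filter_upwards [hev, hMev, eventually_gt_atTop 0] with k h1 h2 hk
    have hk0 : (0 : ℝ) < k := by exact_mod_cast hk
    have h3 : γ' < lambdaMin (gram φ α k) / k := by exact_mod_cast h1
    rw [lt_div_iff₀ hk0] at h3
    -- Only the quadratic form matters, so `M` may carry the cross term as `2 φ_a ζ_b` without being
    -- symmetric. What remains besides `M` is the unperturbed form and the limiting noise variances.
    have hquad : e k ⬝ᵥ (gram (fun t => φ t + ζ t) α k *ᵥ e k) =
        e k ⬝ᵥ (gram φ α k *ᵥ e k) + k * (∑ a, ∑ b, e k a * e k b * M k a b) +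
          k * ∑ a, e k a ^ 2 * v a := by
      have h4 : ∑ a, ∑ b, e k a * e k b * M k a b = (∑ t ∈ Finset.range k,
          (2 * ((φ t ⬝ᵥ e k) * (ζ t ⬝ᵥ e k)) + (ζ t ⬝ᵥ e k) ^ 2)) / k -
          ∑ a, e k a ^ 2 * v a := by
        have h5 : ∑ a, ∑ b, e k a * e k b * M k a b =
            ∑ a, ∑ b, (∑ t ∈ Finset.range k,
              e k a * e k b * (2 * (φ t a * ζ t b) + ζ t a * ζ t b)) / k -
            ∑ a, ∑ b, e k a * e k b * (if a = b then v a else 0) := by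
          simp only [hM, mul_sub, Finset.sum_sub_distrib, ← Finset.mul_sum, mul_div_assoc]
        rw [h5]
        congr 1
        · simp_rw [← Finset.sum_div]
          congr 1
          simp_rw [Finset.sum_comm (t := Finset.range k)]
          refine Finset.sum_congr rfl fun t _ => ?_
          rw [sq, dotProduct, dotProduct, Finset.sum_mul_sum, Finset.sum_mul_sum, Finset.mul_sum,
            ← Finset.sum_add_distrib]
          refine Finset.sum_congr rfl fun a _ => ?_
          rw [Finset.mul_sum, ← Finset.sum_add_distrib]
          exact Finset.sum_congr rfl fun b _ => by ring
        · refine Finset.sum_congr rfl fun a _ => ?_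
          simp [sq]
      rw [h4, dotProduct_gram_mulVec, dotProduct_gram_mulVec]
      have h6 : ∑ t ∈ Finset.range k, ((φ t + ζ t) ⬝ᵥ e k) ^ 2 =
          ∑ t ∈ Finset.range k, (φ t ⬝ᵥ e k) ^ 2 + ∑ t ∈ Finset.range k,
            (2 * ((φ t ⬝ᵥ e k) * (ζ t ⬝ᵥ e k)) + (ζ t ⬝ᵥ e k) ^ 2) := by
        rw [← Finset.sum_add_distrib]
        refine Finset.sum_congr rfl fun t _ => ?_
        rw [add_dotProduct]
        ring
      rw [h6]
      field_simp
      ring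
    have hlow : (κ * k) * (e k ⬝ᵥ e k) ≤ e k ⬝ᵥ (gram (fun t => φ t + ζ t) α k *ᵥ e k) := by
      rw [hquad]
      have h7 := lambdaMin_mul_le (isHermitian_gram φ α k) (e k)
      have hee : 0 ≤ e k ⬝ᵥ e k := by rw [← eNorm_sq]; positivity
      have h8 : v₀ * (e k ⬝ᵥ e k) ≤ ∑ a, e k a ^ 2 * v a := by
        rw [dotProduct, Finset.mul_sum]
        refine Finset.sum_le_sum fun a _ => ?_
        nlinarith [hv a, sq_nonneg (e k a)]
      have h9 : -((γ' - γ) * (e k ⬝ᵥ e k)) ≤ ∑ a, ∑ b, e k a * e k b * M k a b := by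
        have h10 : -((∑ a, ∑ b, |M k a b|) * (e k ⬝ᵥ e k)) ≤
            ∑ a, ∑ b, e k a * e k b * M k a b := by
          rw [Finset.sum_mul, ← Finset.sum_neg_distrib]
          refine Finset.sum_le_sum fun a _ => ?_
          rw [Finset.sum_mul, ← Finset.sum_neg_distrib]
          refine Finset.sum_le_sum fun b _ => ?_
          refine neg_le_of_neg_le ?_
          refine (neg_le_abs _).trans ?_
          rw [abs_mul, abs_mul, mul_comm, ← eNorm_sq, sq]
          have := abs_le_eNorm (e k) a
          have := abs_le_eNorm (e k) b
          have := eNorm_nonneg (e k)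
          gcongr
        refine le_trans ?_ h10
        refine neg_le_neg ?_
        gcongr
      have h11 : γ' * k * (e k ⬝ᵥ e k) ≤ lambdaMin (gram φ α k) * (e k ⬝ᵥ e k) := by gcongr
      have h12 := mul_le_mul_of_nonneg_left h8 hk0.le
      have h13 := mul_le_mul_of_nonneg_left h9 hk0.le
      rw [hκ]
      nlinarith
    have := eNorm_le_of_gram_mulVec_eq hα.le (he' k) (mul_pos hκ0 hk0) hlow
    rwa [mul_comm κ, ← div_div, ← div_div] at this
  have hlim : Tendsto (fun k : ℕ =>
      Real.sqrt (((∑ t ∈ Finset.range k, (ζ t ⬝ᵥ θ) ^ 2) / k) / κ) + eNorm (g k) / k / κ) atTop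
      (𝓝 (Real.sqrt ((∑ a, θ a ^ 2 * v a) / κ))) := by
    have := (Tendsto.sqrt (Tendsto.div_const hX κ)).add (hglim.div_const κ)
    simpa using this
  have hlimE := (continuous_coe_real_ereal.tendsto _).comp hlim
  rw [← hlimE.limsup_eq]
  refine limsup_le_limsup ?_
  filter_upwards [hbound] with k hk
  exact EReal.coe_le_coe_iff.2 hk

end Limit

end MPARX

namespace MPARX

/-! ### Coordinates of the regressors and the combined noise family. -/

section Signals

variable {m : ℕ} (S : MPARX m)

theorem lag_succ_succ (x : ℕ → ℝ) (k j : ℕ) : lag x (k + 1) (j + 1) = lag x k j := by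
  simp [lag]

theorem lag_add (x z : ℕ → ℝ) (k j : ℕ) : lag (fun n => x n + z n) k j = lag x k j + lag z k j := by
  unfold lag
  split_ifs <;> simp

theorem regressor_add (y η : ℕ → ℝ) (u ξ : Fin m → ℕ → ℝ) (k : ℕ) :
    S.regressor (fun n => y n + η n) (fun i n => u i n + ξ i n) k =
      S.regressor y u k + S.regressor η ξ k := by
  ext a
  rcases a with j | z <;> simp [regressor, lag_add]

/-- The participant and the delay belonging to a coordinate of the regression vector `φ_k`, where
delays are counted from time `k + 1`. -/
def slot : S.Idx → Fin (m + 1) × ℕ :=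
  Sum.elim (fun j => (0, (j : ℕ) + 1)) (fun z => (z.1.succ, (z.2 : ℕ) + 1))

/-- Distinct coordinates carry distinct noise variables, which is why the off-diagonal noise
correlations average out. -/
theorem slot_injective : Function.Injective S.slot := by
  rintro (j | ⟨i, l⟩) (j' | ⟨i', l'⟩) h
  · simp only [slot, Sum.elim_inl, Prod.mk.injEq, true_and, Nat.add_right_cancel_iff] at h
    rw [Fin.ext h]
  · exact absurd (congrArg Prod.fst h).symm (Fin.succ_ne_zero _)
  · exact absurd (congrArg Prod.fst h) (Fin.succ_ne_zero _)
  · simp only [slot, Sum.elim_inr, Prod.mk.injEq, Fin.succ_inj, Nat.add_right_cancel_iff] at h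
    obtain ⟨rfl, h⟩ := h
    rw [Fin.ext h]

/-- The pair `(0, 0)` belongs to `η_{t+1}`, the noise of the newly received output; it never occurs
in the regressor at time `t`. -/
theorem slot_ne_zero (a : S.Idx) : S.slot a ≠ (0, 0) := by
  rcases a with j | z <;> intro h <;> exact absurd (congrArg Prod.snd h) (Nat.succ_ne_zero _)

/-- The noises of all participants as one family. -/
def allNoise {Ω : Type*} (η : ℕ → Ω → ℝ) (ξ : Fin m → ℕ → Ω → ℝ) : Fin (m + 1) → ℕ → Ω → ℝ :=
  Fin.cons η ξ

theorem regressor_noise_apply {Ω : Type*} (η : ℕ → Ω → ℝ) (ξ : Fin m → ℕ → Ω → ℝ) (ω : Ω) (t : ℕ)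
    (a : S.Idx) : S.regressor (fun n => η n ω) (fun i n => ξ i n ω) t a =
      lag (fun n => allNoise η ξ (S.slot a).1 n ω) (t + 1) (S.slot a).2 := by
  rcases a with j | z <;> simp [regressor, slot, lag_succ_succ, allNoise]

theorem summable_regressor_sq_div {φ : ℕ → S.Idx → ℝ}
    (h : (fun k : ℕ => ∑ t ∈ Finset.Icc 1 k, eNorm (φ t) ^ 2) =O[atTop] (fun k : ℕ => (k : ℝ)))
    (a : S.Idx) : Summable fun t : ℕ => φ t a ^ 2 / ((t : ℝ) + 1) ^ 2 := by
  -- Both sides vanish at `k = 0`, so the asymptotic bound holds for all `k` with one constant.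
  rw [Asymptotics.isBigO_nat_atTop_iff (by
    intro k hk
    have : k = 0 := by exact_mod_cast hk
    simp [this])] at h
  obtain ⟨C, hC⟩ := h
  -- The assumed sums start at time `1`; the first summand of the constant pays for time `0`.
  refine summable_div_sq_of_sum_le (C := φ 0 a ^ 2 + C) (fun t => sq_nonneg _) fun k => ?_
  have hsplit : ∀ k : ℕ, ∑ t ∈ Finset.range (k + 1), φ t a ^ 2 =
      φ 0 a ^ 2 + ∑ t ∈ Finset.Icc 1 k, φ t a ^ 2 := by
    intro k
    induction k with
    | zero => simp
    | succ k ih => rw [Finset.sum_range_succ, ih, Finset.sum_Icc_succ_top (by omega), add_assoc]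
  have hC0 : 0 ≤ C := by
    have := (norm_nonneg _).trans (hC 1)
    simpa using this
  rcases k with _ | k
  · simp
  rw [hsplit]
  have h1 : ∑ t ∈ Finset.Icc 1 k, φ t a ^ 2 ≤ ∑ t ∈ Finset.Icc 1 k, eNorm (φ t) ^ 2 := by
    refine Finset.sum_le_sum fun t _ => ?_
    rw [← sq_abs]
    have := abs_le_eNorm (φ t) a
    gcongr
  have h2 := (Real.le_norm_self _).trans (hC k)
  rw [Real.norm_natCast] at h2
  push_cast
  nlinarith [sq_nonneg (φ 0 a), (Nat.cast_nonneg k : (0 : ℝ) ≤ k)]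

variable {Ω : Type*} [MeasurableSpace Ω] {μ : Measure Ω}

theorem measurable_output {y : ℕ → Ω → ℝ} {u : Fin m → ℕ → Ω → ℝ} {w : ℕ → Ω → ℝ}
    (hu : ∀ i k, Measurable (u i k)) (hw : ∀ k, Measurable (w k))
    (hsys : ∀ ω, S.IsOutput (fun k => y k ω) (fun i k => u i k ω) (fun k => w k ω)) (k : ℕ) :
    Measurable (y k) := by
  induction k using Nat.strong_induction_on with
  | _ k ih =>
    rcases k with _ | k
    · have : y 0 = fun _ => 0 := funext fun ω => (hsys ω).1
      rw [this]
      exact measurable_const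
    · have : y (k + 1) = fun ω => S.theta ⬝ᵥ
          S.regressor (fun n => y n ω) (fun i n => u i n ω) k + w (k + 1) ω :=
        funext fun ω => (hsys ω).2 k
      rw [this]
      refine Measurable.add (Finset.measurable_fun_sum _ fun a _ => Measurable.const_mul ?_ _) (hw _)
      rcases a with j | z
      · simp only [regressor, Sum.elim_inl, lag]
        split_ifs
        · exact ih _ (by omega)
        · exact measurable_const
      · simp only [regressor, Sum.elim_inr, lag]
        split_ifs
        · exact hu _ _
        · exact measurable_const

/-- The signals of the system. -/
abbrev systemMap (y : ℕ → Ω → ℝ) (u : Fin m → ℕ → Ω → ℝ) (w : ℕ → Ω → ℝ) (ω : Ω) :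
    (ℕ → ℝ) × (Fin m → ℕ → ℝ) × (ℕ → ℝ) :=
  ((fun k => y k ω), (fun i k => u i k ω), (fun k => w k ω))

variable {s : Fin (m + 1) → ℝ} {y : ℕ → Ω → ℝ} {u : Fin m → ℕ → Ω → ℝ} {w : ℕ → Ω → ℝ}
  {η : ℕ → Ω → ℝ} {ξ : Fin m → ℕ → Ω → ℝ}

theorem PrivacyNoise.law (h : PrivacyNoise μ s y u w η ξ) (i : Fin (m + 1)) (t : ℕ) :
    μ.map (allNoise η ξ i (t + 1)) = laplace (s i) := by
  induction i using Fin.cases with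
  | zero => exact h.law_output t
  | succ i => exact h.law_input i (t + 1)

theorem PrivacyNoise.measurable (h : PrivacyNoise μ s y u w η ξ) (i : Fin (m + 1)) (t : ℕ) :
    Measurable (allNoise η ξ i t) := by
  induction i using Fin.cases with
  | zero => exact h.meas_output t
  | succ i => exact h.meas_input i t

theorem PrivacyNoise.zero_or_law (h : PrivacyNoise μ s y u w η ξ) (i : Fin (m + 1)) (t : ℕ) :
    allNoise η ξ i t = (fun _ => 0) ∨ μ.map (allNoise η ξ i t) = laplace (s i) := by
  induction i using Fin.cases with
  | zero =>
    rcases t with _ | t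
    · exact Or.inl (funext h.zero)
    · exact Or.inr (h.law_output t)
  | succ i => exact Or.inr (h.law_input i t)

theorem PrivacyNoise.indepNoise [IsProbabilityMeasure μ] (h : PrivacyNoise μ s y u w η ξ)
    (hs : ∀ i, 0 < s i) (hy : ∀ k, Measurable (y k)) (hu : ∀ i k, Measurable (u i k))
    (hw : ∀ k, Measurable (w k)) :
    IndepNoise (MeasurableSpace.comap (systemMap y u w) inferInstance) μ (allNoise η ξ) where
  le := by
    refine Measurable.comap_le ?_
    refine (measurable_pi_lambda _ hy).prodMk (Measurable.prodMk ?_ (measurable_pi_lambda _ hw))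
    exact measurable_pi_lambda _ fun i => measurable_pi_lambda _ (hu i)
  meas := h.measurable
  indep := by
    -- The noises are given as a disjoint union of outputs and inputs; participant `0` is matched
    -- with the outputs and `i + 1` with input `i`.
    have hinj : Function.Injective (fun z : Fin (m + 1) × ℕ =>
        (Fin.cases (Sum.inl z.2) (fun i => Sum.inr (i, z.2)) z.1 : ℕ ⊕ (Fin m × ℕ))) := by
      rintro ⟨i, t⟩ ⟨i', t'⟩ hit
      induction i using Fin.cases <;> induction i' using Fin.cases <;> simp_all
    have h1 := h.indep.precomp hinj
    have h2 : iIndepFun (fun z : Fin (m + 1) × ℕ => allNoise η ξ z.1 z.2) μ := by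
      convert h1 using 1
      funext ⟨i, t⟩
      induction i using Fin.cases <;> rfl
    refine iIndep_option_elim h2 ?_
    refine indep_of_indep_of_le_left h.indep_system (iSup_le fun z => ?_)
    obtain ⟨i, t⟩ := z
    refine Measurable.comap_le ?_
    have hm := comap_measurable (m := inferInstance)
      (fun ω => ((fun k => η k ω), (fun i k => ξ i k ω)))
    induction i using Fin.cases with
    | zero => exact (measurable_pi_apply t).comp (measurable_fst.comp hm)
    | succ i =>
      exact (measurable_pi_apply t).comp ((measurable_pi_apply i).comp (measurable_snd.comp hm))
  memLp i t := by
    rcases h.zero_or_law i t with h0 | h0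
    · rw [h0]
      exact MemLp.zero'
    · have := memLp_id_laplace (hs i)
      rw [← h0] at this
      exact (memLp_map_measure_iff this.aestronglyMeasurable (h.measurable i t).aemeasurable).1 this
  mean i t := by
    rcases h.zero_or_law i t with h0 | h0
    · simp [h0]
    · rw [← integral_id_laplace (hs i), ← h0, integral_map (h.measurable i t).aemeasurable]
      exact measurable_id'.aestronglyMeasurable
  moment := by
    -- Summing over the finitely many participants gives one bound for all of them.
    refine ⟨∑ i, ∫⁻ x, ‖x‖ₑ ^ 2 ∂laplace (s i), ?_, fun i t => ?_⟩
    · refine ENNReal.sum_lt_top.2 fun i _ => ?_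
      have := (memLp_id_laplace (hs i)).eLpNorm_lt_top
      rw [eLpNorm_lt_top_iff_lintegral_rpow_enorm_lt_top (by norm_num) (by norm_num)] at this
      simpa using this
    · rcases h.zero_or_law i t with h0 | h0
      · simp [h0]
      · refine le_trans (le_of_eq ?_) (Finset.single_le_sum
          (f := fun i => ∫⁻ x, ‖x‖ₑ ^ 2 ∂laplace (s i)) (fun _ _ => zero_le) (Finset.mem_univ i))
        rw [← h0, lintegral_map (measurable_enorm_sq measurable_id') (h.measurable i t)]

end Signals

/-! ### Conditional variance of the system noise. -/

section SystemNoise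

variable {Ω : Type*} [mΩ : MeasurableSpace Ω] {μ : Measure Ω} [IsProbabilityMeasure μ]
  {ℱ : Filtration ℕ mΩ} {β : ℝ} {w : ℕ → Ω → ℝ}

/-- A bound of the conditional second moment of the system noise. -/
def noiseVar (μ : Measure Ω) (ℱ : Filtration ℕ mΩ) (β : ℝ) (w : ℕ → Ω → ℝ) (t : ℕ) (ω : Ω) :
    ℝ≥0∞ :=
  1 + (μ⁻[fun ω' => ‖w (t + 1) ω'‖ₑ ^ β | ℱ t]) ω

omit [IsProbabilityMeasure μ] in
theorem measurable_noiseVar (t : ℕ) : Measurable[ℱ t] (noiseVar μ ℱ β w t) :=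
  measurable_const.add (measurable_condLExp _ _ _)

/-- For `β ≥ 2` one has `x² ≤ 1 + |x|^β`, which explains the summand `1` in `noiseVar`. -/
theorem setLIntegral_noise_sq_le (hβ : 2 ≤ β) (t : ℕ) {A : Set Ω} (hA : MeasurableSet[ℱ t] A) :
    ∫⁻ ω in A, ‖w (t + 1) ω‖ₑ ^ 2 ∂μ ≤ ∫⁻ ω in A, noiseVar μ ℱ β w t ω ∂μ := by
  unfold noiseVar
  rw [lintegral_add_left measurable_const, setLIntegral_condLExp (ℱ.le t) _ _ hA,
    ← lintegral_add_left measurable_const]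
  refine lintegral_mono fun ω => ?_
  rcases le_total ‖w (t + 1) ω‖ₑ 1 with h | h
  · exact (pow_le_one₀ zero_le h).trans le_self_add
  · refine le_trans ?_ le_add_self
    rw [← ENNReal.rpow_natCast]
    exact ENNReal.rpow_le_rpow_of_exponent_le h (by exact_mod_cast hβ)

omit [IsProbabilityMeasure μ] in
theorem NoiseMDS.ae_iSup_noiseVar_lt_top (h : NoiseMDS μ ℱ β w) :
    ∀ᵐ ω ∂μ, ⨆ t, noiseVar μ ℱ β w t ω < ∞ := by
  filter_upwards [h.moment] with ω hω
  refine lt_of_le_of_lt (iSup_le fun t => ?_) (ENNReal.add_lt_top.2 ⟨ENNReal.one_lt_top, hω⟩)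
  unfold noiseVar
  gcongr
  exact le_iSup (fun k => (μ⁻[fun ω' => ‖w (k + 1) ω'‖ₑ ^ β | ℱ k]) ω) t

end SystemNoise

/-! ### The almost sure error bound. -/

section ErrorBound

variable {m : ℕ} (S : MPARX m)

/-- A coordinate belonging to a participant exists only if its order is at least `1`, so its squared
level enters the numerator with weight at least `1`. -/
theorem le_objective_numerator (s : Fin (m + 1) → ℝ) (a : S.Idx) :
    s (S.slot a).1 ^ 2 ≤ S.p * s 0 ^ 2 + ∑ i : Fin m, S.q i * s i.succ ^ 2 := by
  have h0 : ∀ i : Fin m, 0 ≤ (S.q i : ℝ) * s i.succ ^ 2 := fun i => by positivity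
  rcases a with j | ⟨i, l⟩
  · have hp : (1 : ℝ) ≤ S.p := by exact_mod_cast (Fin.pos j)
    have := Finset.sum_nonneg fun i (_ : i ∈ Finset.univ) => h0 i
    simp only [slot, Sum.elim_inl]
    nlinarith [sq_nonneg (s 0)]
  · have hq : (1 : ℝ) ≤ S.q i := by exact_mod_cast (Fin.pos l)
    have h1 := Finset.single_le_sum (fun i _ => h0 i) (Finset.mem_univ i)
    have h2 : 0 ≤ (S.p : ℝ) * s 0 ^ 2 := by positivity
    simp only [slot, Sum.elim_inr]
    nlinarith [sq_nonneg (s i.succ)]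

theorem iInf_sq_nonneg (s : Fin (m + 1) → ℝ) : 0 ≤ ⨅ i, s i ^ 2 :=
  le_ciInf fun i => sq_nonneg (s i)

theorem iInf_sq_le (s : Fin (m + 1) → ℝ) (i : Fin (m + 1)) : ⨅ i, s i ^ 2 ≤ s i ^ 2 :=
  ciInf_le (Set.finite_range fun i => s i ^ 2).bddBelow i

/-- Each occurring variance `2 b²` is at most twice the numerator; the factor `4` under the root is
not sharp. -/
theorem sqrt_noise_energy_le {γ : ℝ} (hγ : 0 < γ) (s : Fin (m + 1) → ℝ) :
    Real.sqrt ((∑ a, S.theta a ^ 2 * (2 * s (S.slot a).1 ^ 2)) / (γ + 2 * ⨅ i, s i ^ 2)) ≤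
      2 * eNorm S.theta * Real.sqrt (S.objective γ s) := by
  have hκ : 0 < γ + 2 * ⨅ i, s i ^ 2 := by
    have := iInf_sq_nonneg s
    positivity
  set num := S.p * s 0 ^ 2 + ∑ i : Fin m, S.q i * s i.succ ^ 2 with hnum
  have hnum0 : 0 ≤ num := by positivity
  have h1 : ∑ a, S.theta a ^ 2 * (2 * s (S.slot a).1 ^ 2) ≤ 4 * eNorm S.theta ^ 2 * num := by
    rw [eNorm_sq, dotProduct, Finset.mul_sum, Finset.sum_mul]
    refine Finset.sum_le_sum fun a _ => ?_
    have := S.le_objective_numerator s a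
    nlinarith [mul_le_mul_of_nonneg_left this (sq_nonneg (S.theta a)),
      mul_nonneg (sq_nonneg (S.theta a)) hnum0]
  have h2 : 2 * eNorm S.theta * Real.sqrt (S.objective γ s) =
      Real.sqrt (4 * eNorm S.theta ^ 2 * num / (γ + 2 * ⨅ i, s i ^ 2)) := by
    have h3 : 0 ≤ 2 * eNorm S.theta := by
      have := eNorm_nonneg S.theta
      positivity
    rw [objective, ← hnum, ← Real.sqrt_sq h3, ← Real.sqrt_mul (sq_nonneg _)]
    congr 1
    ring
  rw [h2]
  exact Real.sqrt_le_sqrt (by gcongr)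

theorem errorBound {Ω : Type*} [mΩ : MeasurableSpace Ω] (μ : Measure Ω) [IsProbabilityMeasure μ]
    {y : ℕ → Ω → ℝ} {u : Fin m → ℕ → Ω → ℝ} {w : ℕ → Ω → ℝ}
    (hu : ∀ i k, Measurable (u i k)) (hw : ∀ k, Measurable (w k))
    (hsys : ∀ ω, S.IsOutput (fun k => y k ω) (fun i k => u i k ω) (fun k => w k ω))
    {ℱ : Filtration ℕ mΩ} {β : ℝ} (hβ : 2 ≤ β) (hmds : NoiseMDS μ ℱ β w)
    (hadapted : ∀ k, StronglyMeasurable[ℱ k]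
      (fun ω => S.regressor (fun n => y n ω) (fun i n => u i n ω) k))
    (hmean : ∀ᵐ ω ∂μ, (fun k : ℕ => ∑ t ∈ Finset.Icc 1 k,
        eNorm (S.regressor (fun n => y n ω) (fun i n => u i n ω) t) ^ 2)
      =O[atTop] (fun k : ℕ => (k : ℝ)))
    {α : ℝ} (hα : 0 < α) (θ0 : S.Idx → ℝ) {γ : ℝ} (hγ : 0 < γ)
    (hexc : ∀ᵐ ω ∂μ, (γ : EReal) < liminf (fun k : ℕ =>
      ((lambdaMin (S.information α (fun n => y n ω) (fun i n => u i n ω) k) / k : ℝ) :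
        EReal)) atTop)
    {s : Fin (m + 1) → ℝ} (hs : ∀ i, 0 < s i) {η : ℕ → Ω → ℝ} {ξ : Fin m → ℕ → Ω → ℝ}
    (hnoise : PrivacyNoise μ s y u w η ξ) :
    S.ErrorBound μ α θ0 y u η ξ (2 * eNorm S.theta * Real.sqrt (S.objective γ s)) := by
  have hy := S.measurable_output hu hw hsys
  have hN := hnoise.indepNoise hs hy hu hw
  set φ : ℕ → Ω → S.Idx → ℝ :=
    fun t ω => S.regressor (fun n => y n ω) (fun i n => u i n ω) t with hφ
  set ζ : ℕ → Ω → S.Idx → ℝ :=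
    fun t ω => S.regressor (fun n => η n ω) (fun i n => ξ i n ω) t with hζ
  have hζN : ∀ t ω a, ζ t ω a =
      lag (fun n => allNoise η ξ (S.slot a).1 n ω) (t + 1) (S.slot a).2 :=
    fun t ω a => S.regressor_noise_apply η ξ ω t a
  have hηN : ∀ t ω, η (t + 1) ω = lag (fun n => allNoise η ξ 0 n ω) (t + 1) 0 := by
    intro t ω
    simp [lag, allNoise]
  -- measurability with respect to the system
  have hsm := comap_measurable (m := inferInstance) (systemMap y u w)
  have hφm : ∀ t a, Measurable[MeasurableSpace.comap (systemMap y u w) inferInstance]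
      (fun ω => φ t ω a) := by
    intro t a
    rcases a with j | z
    · simp only [hφ, regressor, Sum.elim_inl, lag]
      split_ifs
      · exact (measurable_pi_apply _).comp (measurable_fst.comp hsm)
      · exact measurable_const
    · simp only [hφ, regressor, Sum.elim_inr, lag]
      split_ifs
      · exact (measurable_pi_apply _).comp ((measurable_pi_apply _).comp
          (measurable_fst.comp (measurable_snd.comp hsm)))
      · exact measurable_const
  have hwm : ∀ t, Measurable[MeasurableSpace.comap (systemMap y u w) inferInstance]
      (w (t + 1)) := fun t =>
    (measurable_pi_apply _).comp (measurable_snd.comp (measurable_snd.comp hsm))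
  -- summability of the weights
  have hφsum : ∀ a, ∀ᵐ ω ∂μ, Summable fun t : ℕ => φ t ω a ^ 2 / ((t : ℝ) + 1) ^ 2 := by
    intro a
    filter_upwards [hmean] with ω hω
    exact S.summable_regressor_sq_div hω a
  have hwsum : ∀ᵐ ω ∂μ, Summable fun t : ℕ => w (t + 1) ω ^ 2 / ((t : ℝ) + 1) ^ 2 :=
    ae_summable_sq_div_of_condVar (n := fun t => w (t + 1)) (fun t => hw _)
      (fun t => measurable_noiseVar (μ := μ) (β := β) (w := w) t)
      (fun t A hA => setLIntegral_noise_sq_le hβ t hA) hmds.ae_iSup_noiseVar_lt_top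
  -- laws of large numbers
  have hφζ : ∀ a b, ∀ᵐ ω ∂μ, AvgTo (fun t => φ t ω a * ζ t ω b) 0 := by
    intro a b
    simp only [hζN]
    exact hN.ae_tendsto_average_mul _ _
      (fun t => hN.measurable_past_of_system _ _ t (hφm t a)) (hφsum a)
  have hφη : ∀ a, ∀ᵐ ω ∂μ, AvgTo (fun t => φ t ω a * η (t + 1) ω) 0 := by
    intro a
    simp only [hηN]
    exact hN.ae_tendsto_average_mul _ _
      (fun t => hN.measurable_past_of_system _ _ t (hφm t a)) (hφsum a)
  have hwζ : ∀ a, ∀ᵐ ω ∂μ, AvgTo (fun t => w (t + 1) ω * ζ t ω a) 0 := by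
    intro a
    simp only [hζN]
    exact hN.ae_tendsto_average_mul _ _
      (fun t => hN.measurable_past_of_system _ _ t (hwm t)) hwsum
  have hζη : ∀ a, ∀ᵐ ω ∂μ, AvgTo (fun t => ζ t ω a * η (t + 1) ω) 0 := by
    intro a
    simp only [hζN, hηN]
    exact hN.ae_tendsto_average_lag_mul_lag (S.slot_ne_zero a)
  have hζζ : ∀ a b, ∀ᵐ ω ∂μ, AvgTo (fun t => ζ t ω a * ζ t ω b)
      (if a = b then 2 * s (S.slot a).1 ^ 2 else 0) := by
    intro a b
    simp only [hζN]
    split_ifs with hab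
    · subst hab
      simp only [← sq]
      exact hN.ae_tendsto_average_lag_sq _ (hs _) (fun t => hnoise.law _ t) _
    · exact hN.ae_tendsto_average_lag_mul_lag (S.slot_injective.ne hab)
  -- The regressor may depend on past system noise through feedback, so here the martingale property
  -- along `ℱ` replaces independence.
  have hφw : ∀ a, ∀ᵐ ω ∂μ, AvgTo (fun t => φ t ω a * w (t + 1) ω) 0 := by
    intro a
    exact ae_tendsto_average_mul_of_condVar (ℱ := ℱ) (c := fun t ω => φ t ω a)
      (n := fun t => w (t + 1))
      (fun t => (measurable_pi_apply a).comp (hadapted t).measurable) hmds.adapted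
      hmds.integrable hmds.condExp_zero (fun t => measurable_noiseVar (μ := μ) (β := β) (w := w) t)
      (fun t A hA => setLIntegral_noise_sq_le hβ t hA) hmds.ae_iSup_noiseVar_lt_top (hφsum a)
  filter_upwards [ae_all_iff.2 fun a => ae_all_iff.2 (hφζ a), ae_all_iff.2 hφη, ae_all_iff.2 hwζ,
    ae_all_iff.2 hζη, ae_all_iff.2 fun a => ae_all_iff.2 (hζζ a), ae_all_iff.2 hφw, hexc]
    with ω h1 h2 h3 h4 h5 h6 h7
  have key := limsup_eNorm_le (φ := fun t => φ t ω) (ζ := fun t => ζ t ω)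
    (n := fun t => w (t + 1) ω + η (t + 1) ω)
    (e := fun k => S.theta - S.estimate α θ0 (fun n => y n ω + η n ω)
      (fun i n => u i n ω + ξ i n ω) k)
    (θ := S.theta) (d := S.theta - θ0) (v₀ := 2 * ⨅ i, s i ^ 2)
    (v := fun a => 2 * s (S.slot a).1 ^ 2) hα hγ
    (mul_nonneg zero_le_two (iInf_sq_nonneg s))
    (fun a => mul_le_mul_of_nonneg_left (iInf_sq_le s _) zero_le_two) (fun k => ?_) h1 h5
    (fun a => ?_) h7
  · exact key.trans (EReal.coe_le_coe_iff.2 (S.sqrt_noise_energy_le hγ s))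
  · have hreg : (fun t => φ t ω + ζ t ω) =
        S.regressor (fun n => y n ω + η n ω) (fun i n => u i n ω + ξ i n ω) :=
      funext fun t => (S.regressor_add _ _ _ _ t).symm
    rw [hreg, S.gram_mulVec_error hα]
    congr 1
    refine Finset.sum_congr rfl fun t _ => ?_
    rw [← hreg]
    congr 1
    have := (hsys ω).2 t
    simp only at this
    rw [this, add_dotProduct, dotProduct_comm S.theta]
    ring
  -- The product `(φ + ζ)(w + η)` splits into four terms, each with vanishing average.
  · have := (((h6 a).add (h3 a)).add (h2 a)).add (h4 a)
    simp only [add_zero] at this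
    convert this using 2 with t
    ring

end ErrorBound

end MPARX

namespace MPARX

/-! ### Stability and geometric decay of the companion matrix. -/

section Decay

/-- By Gelfand's formula any `r` strictly between the spectral radius and `1` dominates all large
powers; the constant covers the finitely many others. -/
theorem exists_norm_pow_le_of_spectrum {A : Type*} [NormedRing A] [NormedAlgebra ℂ A]
    [CompleteSpace A] [Nontrivial A] (a : A) (h : ∀ z ∈ spectrum ℂ a, ‖z‖ < 1) :
    ∃ c r : ℝ, 0 < c ∧ 0 < r ∧ r < 1 ∧ ∀ n : ℕ, ‖a ^ n‖ ≤ c * r ^ n := by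
  have h1 : spectralRadius ℂ a < (1 : NNReal) :=
    spectrum.spectralRadius_lt_of_forall_lt a fun z hz => by exact_mod_cast h z hz
  obtain ⟨r, hr1, hr2⟩ := ENNReal.lt_iff_exists_nnreal_btwn.1 h1
  have hr2' : r < 1 := by exact_mod_cast hr2
  have hr0 : 0 < r := by
    have : (0 : ℝ≥0∞) < r := lt_of_le_of_lt zero_le hr1
    exact_mod_cast this
  have hr0' : (0 : ℝ) < r := by exact_mod_cast hr0
  have hev := (spectrum.pow_nnnorm_pow_one_div_tendsto_nhds_spectralRadius a).eventually_lt_const hr1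
  obtain ⟨N, hN⟩ := eventually_atTop.1 hev
  have hlarge : ∀ n, N ≤ n → 1 ≤ n → ‖a ^ n‖ ≤ (r : ℝ) ^ n := by
    intro n hn hn1
    have h2 := hN n hn
    have hn0 : (0 : ℝ) < n := by exact_mod_cast hn1
    rw [one_div, ENNReal.rpow_inv_lt_iff hn0, ENNReal.rpow_natCast] at h2
    have h3 : ‖a ^ n‖₊ < r ^ n := by exact_mod_cast h2
    exact_mod_cast h3.le
  refine ⟨1 + ∑ n ∈ Finset.range (N + 1), ‖a ^ n‖ / (r : ℝ) ^ n, r, ?_, hr0', by exact_mod_cast hr2',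
    fun n => ?_⟩
  · have : 0 ≤ ∑ n ∈ Finset.range (N + 1), ‖a ^ n‖ / (r : ℝ) ^ n :=
      Finset.sum_nonneg fun n _ => by positivity
    linarith
  · have hpow : (0 : ℝ) < (r : ℝ) ^ n := by positivity
    have hnn : ∀ n ∈ Finset.range (N + 1), 0 ≤ ‖a ^ n‖ / (r : ℝ) ^ n := fun n _ => by positivity
    by_cases hn : n < N + 1
    · have := Finset.single_le_sum hnn (Finset.mem_range.2 hn)
      rw [← div_le_iff₀ hpow]
      linarith
    · refine (hlarge n (by omega) (by omega)).trans ?_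
      have := Finset.sum_nonneg hnn
      nlinarith

variable {m : ℕ} (S : MPARX m)

/-- The superdiagonal forces an eigenvector to be geometric, `v_c = z^c v_0`, and the last row then
says that `1/z` is a root of `1 - ∑ a_j z^j`. Stability excludes this when `|z| ≥ 1`. -/
theorem norm_lt_one_of_companion_mulVec (hst : S.Stable) {z : ℂ} {v : Fin S.p → ℂ} (hv : v ≠ 0)
    (h : (S.companion.map (fun x : ℝ => (x : ℂ))) *ᵥ v = z • v) : ‖z‖ < 1 := by
  by_contra hz
  rw [not_lt] at hz
  have hz0 : z ≠ 0 := by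
    intro h0
    rw [h0, norm_zero] at hz
    linarith
  have hp : 0 < S.p := by
    by_contra hp
    have : S.p = 0 := by omega
    apply hv
    ext i
    exact absurd i.2 (by omega)
  have hcomp : ∀ r : Fin S.p, ∑ c, ((S.companion r c : ℝ) : ℂ) * v c = z * v r := fun r => by
    have := congrFun h r
    simpa [Matrix.mulVec, dotProduct] using this
  have hstep : ∀ r c : Fin S.p, (c : ℕ) = r + 1 → v c = z * v r := by
    intro r c hrc
    rw [← hcomp r, Finset.sum_eq_single c]
    · have : ¬ ((r : ℕ) + 1 = S.p) := by have := c.2; omega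
      simp [companion, this, hrc]
    · intro b _ hb
      have h1 : ¬ ((r : ℕ) + 1 = S.p) := by have := c.2; omega
      have h2 : ¬ ((b : ℕ) = r + 1) := fun h2 => hb (Fin.ext (by omega))
      simp [companion, h1, h2]
    · simp
  have hpow : ∀ c : ℕ, ∀ hc : c < S.p, v ⟨c, hc⟩ = z ^ c * v ⟨0, hp⟩ := by
    intro c
    induction c with
    | zero => simp
    | succ c ih =>
      intro hc
      rw [hstep ⟨c, by omega⟩ ⟨c + 1, hc⟩ rfl, ih (by omega), pow_succ]
      ring
  have hv0 : v ⟨0, hp⟩ ≠ 0 := by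
    intro h0
    apply hv
    ext c
    have := hpow c c.2
    simpa [h0] using this
  have hlast := hcomp ⟨S.p - 1, by omega⟩
  have h1 : S.p - 1 + 1 = S.p := by omega
  simp only [companion, h1, if_true] at hlast
  have hsum : ∑ j : Fin S.p, (S.a j : ℂ) * z⁻¹ ^ ((j : ℕ) + 1) = 1 := by
    rw [← Equiv.sum_comp Fin.revPerm]
    have h2 : z ^ S.p * v ⟨0, hp⟩ ≠ 0 := mul_ne_zero (pow_ne_zero _ hz0) hv0
    apply mul_right_cancel₀ h2
    rw [one_mul, Finset.sum_mul]
    have h3 : z * v ⟨S.p - 1, by omega⟩ = z ^ S.p * v ⟨0, hp⟩ := by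
      rw [hpow (S.p - 1) (by omega), ← mul_assoc, ← pow_succ', h1]
    conv_rhs => rw [← h3, ← hlast]
    refine Finset.sum_congr rfl fun c _ => ?_
    rw [hpow c c.2, Fin.revPerm_apply]
    have h4 : ((c.rev : Fin S.p) : ℕ) + 1 = S.p - c := by
      rw [Fin.val_rev]
      omega
    have h5 : z ^ S.p = z ^ (S.p - (c : ℕ)) * z ^ (c : ℕ) := by
      rw [← pow_add]
      congr 1
      omega
    rw [h4, h5, inv_pow]
    have := pow_ne_zero (S.p - (c : ℕ)) hz0
    field_simp
  refine hst z⁻¹ ?_ (by rw [hsum, sub_self])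
  rw [norm_inv]
  exact inv_le_one_of_one_le₀ hz

/-- Real vectors keep their norm in the complexification; this transfers the decay obtained from the
complex spectrum. -/
theorem norm_toEuclideanCLM_le_map {n : ℕ} (M : Matrix (Fin n) (Fin n) ℝ) :
    ‖Matrix.toEuclideanCLM (𝕜 := ℝ) M‖ ≤
      ‖Matrix.toEuclideanCLM (𝕜 := ℂ) (M.map (fun x : ℝ => (x : ℂ)))‖ := by
  refine ContinuousLinearMap.opNorm_le_bound _ (norm_nonneg _) fun x => ?_
  have hnorm : ∀ z : Fin n → ℝ, ‖(WithLp.toLp 2 z : EuclideanSpace ℝ (Fin n))‖ =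
      ‖(WithLp.toLp 2 (fun i => (z i : ℂ)) : EuclideanSpace ℂ (Fin n))‖ := by
    intro z
    simp [EuclideanSpace.norm_eq]
  have h1 := ContinuousLinearMap.le_opNorm
    (Matrix.toEuclideanCLM (𝕜 := ℂ) (M.map (fun x : ℝ => (x : ℂ))))
    (WithLp.toLp 2 (fun i => ((WithLp.ofLp x i : ℝ) : ℂ)))
  rw [← hnorm, Matrix.toEuclideanCLM_toLp] at h1
  have h2 : M.map (fun x : ℝ => (x : ℂ)) *ᵥ (fun i => ((WithLp.ofLp x i : ℝ) : ℂ)) =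
      fun i => (((M *ᵥ WithLp.ofLp x) i : ℝ) : ℂ) := by
    ext i
    simp [Matrix.mulVec, dotProduct]
  rw [h2, ← hnorm] at h1
  exact h1

/-- A stable system has exponentially decaying powers of its companion matrix. -/
theorem exists_isDecay (hst : S.Stable) : ∃ c0 lam, S.IsDecay c0 lam := by
  -- For `p = 0` the operator algebra is trivial and Gelfand's formula is not available, but all
  -- operators vanish.
  rcases Nat.eq_zero_or_pos S.p with hp | hp
  · have : IsEmpty (Fin S.p) := by rw [hp]; infer_instance
    refine ⟨1, 1 / 2, one_pos, by norm_num, by norm_num, fun k => ?_⟩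
    have : Matrix.toEuclideanCLM (𝕜 := ℝ) (S.companion ^ k) = 0 := Subsingleton.elim _ _
    rw [this, norm_zero]
    positivity
  · have : Nonempty (Fin S.p) := ⟨⟨0, hp⟩⟩
    set B := S.companion.map (fun x : ℝ => (x : ℂ)) with hB
    have hspec : ∀ z ∈ spectrum ℂ (Matrix.toEuclideanCLM (𝕜 := ℂ) B), ‖z‖ < 1 := by
      intro z hz
      rw [AlgEquiv.spectrum_eq, spectrum.mem_iff, Matrix.isUnit_iff_isUnit_det, isUnit_iff_ne_zero,
        not_not, ← Matrix.exists_mulVec_eq_zero_iff] at hz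
      obtain ⟨v, hv, h⟩ := hz
      rw [Matrix.sub_mulVec, Algebra.algebraMap_eq_smul_one, Matrix.smul_mulVec,
        Matrix.one_mulVec, sub_eq_zero] at h
      exact S.norm_lt_one_of_companion_mulVec hst hv h.symm
    obtain ⟨c, r, hc, hr, hr1, hcr⟩ := exists_norm_pow_le_of_spectrum _ hspec
    refine ⟨c, r, hc, hr, hr1, fun k => ?_⟩
    refine (norm_toEuclideanCLM_le_map _).trans ?_
    have : (S.companion ^ k).map (fun x : ℝ => (x : ℂ)) = B ^ k :=
      Matrix.map_pow S.companion Complex.ofRealHom k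
    rw [this, map_pow]
    exact hcr k

end Decay

/-! ### Sensitivity of the outputs in `ℓ¹`. -/

section Sensitivity

variable {m : ℕ} {S : MPARX m} {c0 lam : ℝ}

theorem eNorm_le_sum_abs {ι : Type*} [Fintype ι] (v : ι → ℝ) : eNorm v ≤ ∑ i, |v i| := by
  refine Real.sqrt_le_iff.2 ⟨Finset.sum_nonneg fun _ _ => abs_nonneg _, ?_⟩
  have := Finset.sum_sq_le_sq_sum_of_nonneg (s := Finset.univ) (f := fun i => |v i|)
    (fun _ _ => abs_nonneg _)
  simpa using this

theorem IsDecay.abs_pow_mulVec_le (h : S.IsDecay c0 lam) (n : ℕ) (v : Fin S.p → ℝ) (i : Fin S.p) :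
    |((S.companion ^ n) *ᵥ v) i| ≤ c0 * lam ^ n * ∑ c, |v c| := by
  have h1 := ContinuousLinearMap.le_of_opNorm_le _ (h.2.2.2 n) (WithLp.toLp 2 v)
  rw [Matrix.toEuclideanCLM_toLp] at h1
  have hnorm : ∀ z : Fin S.p → ℝ, ‖(WithLp.toLp 2 z : EuclideanSpace ℝ (Fin S.p))‖ = eNorm z := by
    intro z
    simp [EuclideanSpace.norm_eq, eNorm]
  rw [hnorm, hnorm] at h1
  refine (abs_le_eNorm _ i).trans (h1.trans ?_)
  have := eNorm_le_sum_abs v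
  have := h.1
  have := h.2.1
  gcongr

theorem IsDecay.sum_geometric_le (h : S.IsDecay c0 lam) (n : ℕ) :
    ∑ k ∈ Finset.range n, c0 * lam ^ (k + 1) ≤ c0 * lam / (1 - lam) := by
  obtain ⟨hc, hl, hl1, -⟩ := h
  have h1 : 0 < 1 - lam := by linarith
  have h2 : ∑ k ∈ Finset.range n, c0 * lam ^ (k + 1) = c0 * lam * ((1 - lam ^ n) / (1 - lam)) := by
    rw [← neg_div_neg_eq, neg_sub, neg_sub, ← geom_sum_eq hl1.ne, Finset.mul_sum]
    refine Finset.sum_congr rfl fun k _ => ?_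
    ring
  have h3 : (1 - lam ^ n) / (1 - lam) ≤ 1 / (1 - lam) := by
    have : 0 < lam ^ n := by positivity
    gcongr
    linarith
  rw [h2, ← mul_one_div (c0 * lam)]
  gcongr

/-- The sensitivity estimates below produce the constant without `√p`; the stated `C_1` is larger.
-/
theorem IsDecay.geometric_le_C1 (h : S.IsDecay c0 lam) (hp : 0 < S.p) :
    1 + c0 * lam / (1 - lam) ≤ S.C1 c0 lam := by
  obtain ⟨hc, hl, hl1, -⟩ := h
  have h1 : 0 < 1 - lam := by linarith
  have h2 : 1 ≤ Real.sqrt S.p := Real.one_le_sqrt.2 (by exact_mod_cast hp)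
  have h3 : 0 ≤ c0 * lam / (1 - lam) := by positivity
  have h4 : Real.sqrt S.p * c0 * lam / (1 - lam) = Real.sqrt S.p * (c0 * lam / (1 - lam)) := by ring
  rw [C1, h4]
  nlinarith

theorem IsDecay.one_le_C1 (h : S.IsDecay c0 lam) : 1 ≤ S.C1 c0 lam := by
  obtain ⟨hc, hl, hl1, -⟩ := h
  have h1 : 0 < 1 - lam := by linarith
  unfold C1
  have : 0 ≤ Real.sqrt S.p * c0 * lam / (1 - lam) := by positivity
  linarith

/-- The last `p` values of a signal, oldest first. -/
def state (S : MPARX m) (d : ℕ → ℝ) (k : ℕ) (c : Fin S.p) : ℝ := lag d k c.rev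

theorem state_succ (d : ℕ → ℝ) {k : ℕ} {f : ℝ}
    (hd : d (k + 1) = ∑ j : Fin S.p, S.a j * lag d k j + f) (r : Fin S.p) :
    S.state d (k + 1) r = (S.companion *ᵥ S.state d k) r + if (r : ℕ) + 1 = S.p then f else 0 := by
  simp only [Matrix.mulVec, dotProduct, companion, state]
  split_ifs with hr
  · have : ((r.rev : Fin S.p) : ℕ) = 0 := by rw [Fin.val_rev]; omega
    rw [this]
    simp only [lag, Nat.zero_le, if_true, Nat.sub_zero, hd]
    congr 1
    rw [← Equiv.sum_comp Fin.revPerm]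
    rfl
  · have hr' : (r : ℕ) + 1 < S.p := by have := r.2; omega
    rw [add_zero, Finset.sum_eq_single ⟨r + 1, hr'⟩]
    · have : ((r.rev : Fin S.p) : ℕ) = ((⟨r + 1, hr'⟩ : Fin S.p).rev : ℕ) + 1 := by
        simp only [Fin.val_rev]
        omega
      rw [this, lag_succ_succ]
      simp
    · intro b _ hb
      have : ¬ ((b : ℕ) = r + 1) := fun h => hb (Fin.ext h)
      simp [this]
    · simp

theorem sum_abs_lag_le (x : ℕ → ℝ) (l T : ℕ) :
    ∑ k ∈ Finset.range T, |lag x k l| ≤ ∑ k ∈ Finset.range T, |x k| := by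
  induction l generalizing T with
  | zero => simp [lag]
  | succ l ih =>
    rcases T with _ | T
    · simp
    · rw [Finset.sum_range_succ']
      have h0 : lag x 0 (l + 1) = 0 := by simp [lag]
      simp_rw [lag_succ_succ, h0, abs_zero, add_zero]
      refine (ih T).trans ?_
      rw [Finset.sum_range_succ]
      linarith [abs_nonneg (x T)]

theorem sum_abs_state_le (d : ℕ → ℝ) (k : ℕ) :
    ∑ c, |S.state d k c| ≤ ∑ n ∈ Finset.range (k + 1), |d n| := by
  have h1 : ∑ c, |S.state d k c| = ∑ j ∈ Finset.range S.p, |lag d k j| := by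
    rw [← Equiv.sum_comp Fin.revPerm, Finset.sum_range fun j => |lag d k j|]
    refine Finset.sum_congr rfl fun c _ => ?_
    simp [state]
  rw [h1, ← Finset.sum_range_reflect (fun n => |d n|)]
  have h2 : ∀ n, ∑ j ∈ Finset.range n, |lag d k j| ≤
      ∑ j ∈ Finset.range (k + 1), |d (k + 1 - 1 - j)| := by
    intro n
    have h3 : ∑ j ∈ Finset.range n, |lag d k j| =
        ∑ j ∈ (Finset.range n).filter (· ≤ k), |d (k - j)| := by
      rw [Finset.sum_filter]
      refine Finset.sum_congr rfl fun j _ => ?_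
      unfold lag
      split_ifs <;> simp
    rw [h3]
    refine Finset.sum_le_sum_of_subset_of_nonneg ?_ fun _ _ _ => abs_nonneg _
    intro j hj
    simp only [Finset.mem_filter, Finset.mem_range] at hj ⊢
    omega
  exact h2 _

/-- Free motion: total deviation after time `T` of a signal following the homogeneous recursion. -/
theorem IsDecay.sum_abs_free_le (h : S.IsDecay c0 lam) {d : ℕ → ℝ} {T : ℕ}
    (hd : ∀ k, T ≤ k → d (k + 1) = ∑ j : Fin S.p, S.a j * lag d k j) (n : ℕ) :
    ∑ k ∈ Finset.range n, |d (T + (k + 1))| ≤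
      (S.C1 c0 lam - 1) * ∑ k ∈ Finset.range (T + 1), |d k| := by
  have hnn : 0 ≤ ∑ k ∈ Finset.range (T + 1), |d k| := Finset.sum_nonneg fun _ _ => abs_nonneg _
  rcases Nat.eq_zero_or_pos S.p with hp | hp
  · have h1 := h.one_le_C1
    have h2 : ∀ k, d (T + (k + 1)) = 0 := by
      intro k
      have h3 := hd (T + k) (by omega)
      have : IsEmpty (Fin S.p) := by rw [hp]; infer_instance
      simpa [← add_assoc] using h3
    simp_rw [h2, abs_zero, Finset.sum_const_zero]
    exact mul_nonneg (by linarith) hnn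
  · have hst : ∀ k, S.state d (T + k) = (S.companion ^ k) *ᵥ S.state d T := by
      intro k
      induction k with
      | zero => simp
      | succ k ih =>
        funext r
        have := state_succ (S := S) d (k := T + k) (f := 0) (by rw [hd _ (by omega), add_zero]) r
        rw [← add_assoc, this, ih, pow_succ', Matrix.mulVec_mulVec]
        simp
    have hlast : ∀ k, d k = S.state d k ⟨S.p - 1, by omega⟩ := by
      intro k
      have : ((⟨S.p - 1, by omega⟩ : Fin S.p).rev : ℕ) = 0 := by
        simp only [Fin.val_rev]
        omega
      rw [state, this]
      simp [lag]
    -- The value is the last coordinate of the companion power applied to the state at time `T`,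
    -- whose entries are past values of `d` or zero.
    have hb : ∀ k, |d (T + (k + 1))| ≤
        c0 * lam ^ (k + 1) * ∑ k ∈ Finset.range (T + 1), |d k| := by
      intro k
      rw [hlast, hst]
      refine (h.abs_pow_mulVec_le _ _ _).trans ?_
      have := sum_abs_state_le (S := S) d T
      have := h.1
      have := h.2.1
      gcongr
    refine (Finset.sum_le_sum fun k _ => hb k).trans ?_
    rw [← Finset.sum_mul]
    refine mul_le_mul_of_nonneg_right ?_ hnn
    have h1 := h.sum_geometric_le n
    have h2 := h.geometric_le_C1 hp
    linarith

/-- Forced motion: total deviation of a signal started at rest under the forcing `f`. -/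
theorem IsDecay.sum_abs_forced_le (h : S.IsDecay c0 lam) {d f : ℕ → ℝ} (h0 : d 0 = 0)
    (hd : ∀ k, d (k + 1) = ∑ j : Fin S.p, S.a j * lag d k j + f k) (T : ℕ) :
    ∑ k ∈ Finset.range T, |d (k + 1)| ≤ S.C1 c0 lam * ∑ k ∈ Finset.range T, |f k| := by
  rcases Nat.eq_zero_or_pos S.p with hp | hp
  · have h2 : ∀ k, d (k + 1) = f k := by
      intro k
      have h3 := hd k
      have : IsEmpty (Fin S.p) := by rw [hp]; infer_instance
      simpa using h3
    simp_rw [h2]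
    have hnn : 0 ≤ ∑ k ∈ Finset.range T, |f k| := Finset.sum_nonneg fun _ _ => abs_nonneg _
    nlinarith [h.one_le_C1]
  · set e : Fin S.p → ℝ := fun r => if (r : ℕ) + 1 = S.p then 1 else 0 with he
    set last : Fin S.p := ⟨S.p - 1, by omega⟩ with hlastdef
    -- Variation of constants: the state is a superposition of impulse responses, started from rest.
    have hst : ∀ k, S.state d (k + 1) =
        ∑ s ∈ Finset.range (k + 1), f s • ((S.companion ^ (k - s)) *ᵥ e) := by
      have hzero : S.state d 0 = 0 := by
        funext c
        unfold state lag
        split_ifs <;> simp [h0]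
      have hsucc : ∀ k, S.state d (k + 1) = S.companion *ᵥ S.state d k + f k • e := by
        intro k
        funext r
        rw [state_succ (S := S) d (hd k) r]
        simp [he]
      intro k
      induction k with
      | zero => rw [hsucc, hzero]; simp
      | succ k ih =>
        rw [hsucc, ih, Finset.sum_range_succ _ (k + 1), Matrix.mulVec_sum]
        congr 1
        · refine Finset.sum_congr rfl fun s hs => ?_
          have : k + 1 - s = k - s + 1 := by
            have := Finset.mem_range.1 hs
            omega
          rw [Matrix.mulVec_smul, Matrix.mulVec_mulVec, this, pow_succ']
        · simp
    have hlast : ∀ k, d k = S.state d k last := by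
      intro k
      have : (last.rev : ℕ) = 0 := by
        simp only [hlastdef, Fin.val_rev]
        omega
      rw [state, this]
      simp [lag]
    have hesum : ∑ c, |e c| = 1 := by
      rw [Finset.sum_eq_single last]
      · have : (last : ℕ) + 1 = S.p := by simp only [hlastdef]; omega
        simp [he, this]
      · intro b _ hb
        have : ¬ ((b : ℕ) + 1 = S.p) := fun h => hb (Fin.ext (by simp only [hlastdef]; omega))
        simp [he, this]
      · simp
    -- At lag zero the impulse response is exactly `1`; using `1` instead of `c0` there gives the
    -- total `1 + c0 λ / (1 - λ)`.
    set G : ℕ → ℝ := fun n => if n = 0 then 1 else c0 * lam ^ n with hG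
    have hc := h.1
    have hl := h.2.1
    have hG0 : ∀ n, 0 ≤ G n := by
      intro n
      simp only [hG]
      split_ifs <;> positivity
    have himp : ∀ n, |((S.companion ^ n) *ᵥ e) last| ≤ G n := by
      intro n
      simp only [hG]
      split_ifs with hn
      · subst hn
        simp only [pow_zero, Matrix.one_mulVec]
        rw [← hesum]
        exact Finset.single_le_sum (f := fun c => |e c|) (fun _ _ => abs_nonneg _)
          (Finset.mem_univ last)
      · have := h.abs_pow_mulVec_le n e last
        rwa [hesum, mul_one] at this
    have hGsum : ∀ n, ∑ k ∈ Finset.range n, G k ≤ S.C1 c0 lam := by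
      intro n
      have h1 := h.geometric_le_C1 hp
      have h2 := h.one_le_C1
      rcases n with _ | n
      · simp only [Finset.range_zero, Finset.sum_empty]
        linarith
      · rw [Finset.sum_range_succ']
        have h3 := h.sum_geometric_le n
        simp only [hG, Nat.succ_ne_zero, if_false, if_true]
        linarith
    have hdk : ∀ k, |d (k + 1)| ≤ ∑ s ∈ Finset.range (k + 1), |f s| * G (k - s) := by
      intro k
      rw [hlast, hst, Finset.sum_apply]
      refine (Finset.abs_sum_le_sum_abs _ _).trans (Finset.sum_le_sum fun s _ => ?_)
      rw [Pi.smul_apply, smul_eq_mul, abs_mul]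
      exact mul_le_mul_of_nonneg_left (himp _) (abs_nonneg _)
    refine (Finset.sum_le_sum fun k _ => hdk k).trans ?_
    -- Exchanging the sums is Young's inequality: an `ℓ¹` convolution is bounded by the product of
    -- the `ℓ¹` norms.
    have hswap : ∑ k ∈ Finset.range T, ∑ s ∈ Finset.range (k + 1), |f s| * G (k - s) =
        ∑ s ∈ Finset.range T, ∑ k ∈ Finset.Ico s T, |f s| * G (k - s) := by
      refine Finset.sum_comm' fun k s => ?_
      simp only [Finset.mem_range, Finset.mem_Ico]
      omega
    rw [hswap, Finset.mul_sum]
    refine Finset.sum_le_sum fun s _ => ?_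
    rw [← Finset.mul_sum, mul_comm, Finset.sum_Ico_eq_sum_range]
    refine mul_le_mul_of_nonneg_right ?_ (abs_nonneg _)
    simpa using hGsum (T - s)

/-- Sensitivity of the outputs to the outputs of the first `T₁` steps. -/
theorem IsDecay.outputFrom_sensitivity (h : S.IsDecay c0 lam) (u : Fin m → ℕ → ℝ) (w : ℕ → ℝ)
    {T₁ T₂ : ℕ} (hT : T₁ ≤ T₂) (x x' : ℕ → ℝ) :
    ∑ k ∈ Finset.range T₂, |S.outputFrom T₁ x u w (k + 1) - S.outputFrom T₁ x' u w (k + 1)| ≤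
      S.C1 c0 lam * ∑ k ∈ Finset.range T₁, |x (k + 1) - x' (k + 1)| := by
  set d : ℕ → ℝ := fun k => S.outputFrom T₁ x u w k - S.outputFrom T₁ x' u w k with hd
  have hd0 : d 0 = 0 := by simp [hd, outputFrom]
  have hd1 : ∀ k, k < T₁ → d (k + 1) = x (k + 1) - x' (k + 1) := by
    intro k hk
    have : k + 1 ≤ T₁ := hk
    simp [hd, outputFrom, this]
  have hd2 : ∀ k, T₁ ≤ k → d (k + 1) = ∑ j : Fin S.p, S.a j * lag d k j := by
    intro k hk
    have : ¬ (k + 1 ≤ T₁) := by omega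
    have hlag : ∀ j : Fin S.p, S.a j * lag d k j =
        S.a j * (if (j : ℕ) ≤ k then S.outputFrom T₁ x u w (k - j) else 0) -
        S.a j * (if (j : ℕ) ≤ k then S.outputFrom T₁ x' u w (k - j) else 0) := by
      intro j
      simp only [lag, hd]
      split_ifs <;> ring
    simp_rw [hlag, Finset.sum_sub_distrib]
    simp only [hd]
    rw [outputFrom, outputFrom, if_neg this, if_neg this]
    ring
  -- The prescribed outputs account for the `1` in `C_1`, the subsequent free motion for the rest.
  have hsplit : ∑ k ∈ Finset.range T₂, |d (k + 1)| =
      ∑ k ∈ Finset.range T₁, |d (k + 1)| + ∑ k ∈ Finset.range (T₂ - T₁), |d (T₁ + (k + 1))| := by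
    obtain ⟨n, rfl⟩ := Nat.exists_eq_add_of_le hT
    rw [Finset.sum_range_add]
    simp [add_assoc]
  have hfirst : ∑ k ∈ Finset.range T₁, |d (k + 1)| =
      ∑ k ∈ Finset.range T₁, |x (k + 1) - x' (k + 1)| :=
    Finset.sum_congr rfl fun k hk => by rw [hd1 k (Finset.mem_range.1 hk)]
  have hfree := h.sum_abs_free_le hd2 (T₂ - T₁)
  rw [Finset.sum_range_succ', hd0, abs_zero, add_zero, hfirst] at hfree
  change ∑ k ∈ Finset.range T₂, |d (k + 1)| ≤ _
  rw [hsplit, hfirst]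
  linarith

/-- Sensitivity of the outputs to the inputs of one participant. -/
theorem IsDecay.input_sensitivity (h : S.IsDecay c0 lam) (w : ℕ → ℝ) (i : Fin m)
    {v v' : Fin m → ℕ → ℝ} (hv : ∀ j, j ≠ i → v j = v' j) (x : ℕ → ℝ) (T : ℕ) :
    ∑ k ∈ Finset.range T, |S.outputFrom 0 x v w (k + 1) - S.outputFrom 0 x v' w (k + 1)| ≤
      S.C2 c0 lam i * ∑ k ∈ Finset.range T, |v i k - v' i k| := by
  set d : ℕ → ℝ := fun k => S.outputFrom 0 x v w k - S.outputFrom 0 x v' w k with hd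
  -- The two outputs share the system noise and all other inputs, so their difference is driven only
  -- by the changed input filtered through the coefficients `b i`.
  set f : ℕ → ℝ := fun k => ∑ l : Fin (S.q i), S.b i l * lag (fun n => v i n - v' i n) k l with hf
  have hd0 : d 0 = 0 := by simp [hd, outputFrom]
  have hd2 : ∀ k, d (k + 1) = ∑ j : Fin S.p, S.a j * lag d k j + f k := by
    intro k
    have hlag : ∀ j : Fin S.p, S.a j * lag d k j =
        S.a j * (if (j : ℕ) ≤ k then S.outputFrom 0 x v w (k - j) else 0) -
        S.a j * (if (j : ℕ) ≤ k then S.outputFrom 0 x v' w (k - j) else 0) := by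
      intro j
      simp only [lag, hd]
      split_ifs <;> ring
    have hin : ∑ j : Fin m, ∑ l : Fin (S.q j), S.b j l * lag (v j) k l -
        ∑ j : Fin m, ∑ l : Fin (S.q j), S.b j l * lag (v' j) k l = f k := by
      rw [← Finset.sum_sub_distrib, Finset.sum_eq_single i]
      · rw [hf, ← Finset.sum_sub_distrib]
        refine Finset.sum_congr rfl fun l _ => ?_
        simp only [lag]
        split_ifs <;> ring
      · intro j _ hj
        rw [hv j hj, sub_self]
      · simp
    simp_rw [hlag, Finset.sum_sub_distrib]
    simp only [hd]
    rw [outputFrom, outputFrom, if_neg (Nat.not_succ_le_zero k), if_neg (Nat.not_succ_le_zero k),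
      ← hin]
    ring
  refine (h.sum_abs_forced_le hd0 hd2 T).trans ?_
  have hfsum : ∑ k ∈ Finset.range T, |f k| ≤
      (∑ l, |S.b i l|) * ∑ k ∈ Finset.range T, |v i k - v' i k| := by
    calc ∑ k ∈ Finset.range T, |f k|
        ≤ ∑ k ∈ Finset.range T, ∑ l : Fin (S.q i),
            |S.b i l| * |lag (fun n => v i n - v' i n) k l| := by
          refine Finset.sum_le_sum fun k _ => (Finset.abs_sum_le_sum_abs _ _).trans ?_
          simp_rw [abs_mul]
          exact le_rfl
      _ = ∑ l : Fin (S.q i), |S.b i l| *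
            ∑ k ∈ Finset.range T, |lag (fun n => v i n - v' i n) k l| := by
          rw [Finset.sum_comm]
          simp_rw [Finset.mul_sum]
      _ ≤ _ := by
          rw [Finset.sum_mul]
          exact Finset.sum_le_sum fun l _ =>
            mul_le_mul_of_nonneg_left (sum_abs_lag_le _ _ _) (abs_nonneg _)
  have hC2 : S.C2 c0 lam i = S.C1 c0 lam * ∑ l, |S.b i l| := rfl
  rw [hC2, mul_assoc]
  exact mul_le_mul_of_nonneg_left hfsum (by linarith [h.one_le_C1])

end Sensitivity

end MPARX

namespace MPARX

/-! ### The multidimensional Laplace mechanism. -/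

section LaplaceMechanism

instance (b : ℝ) : SigmaFinite (laplace b) :=
  SigmaFinite.withDensity_ofReal _

theorem laplace_map_add_apply (b v : ℝ) {D : Set ℝ} (hD : MeasurableSet D) :
    (laplace b).map (· + v) D =
      ∫⁻ z in D, ENNReal.ofReal (1 / (2 * b) * Real.exp (-|z - v| / b)) := by
  have hm : Measurable fun x : ℝ => x + v := by fun_prop
  rw [Measure.map_apply hm hD, laplace, withDensity_apply _ (hm hD), ← lintegral_indicator (hm hD),
    ← lintegral_indicator hD, ← lintegral_sub_right_eq_self _ v]
  refine lintegral_congr fun z => ?_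
  have : z - v ∈ (· + v) ⁻¹' D ↔ z ∈ D := by
    rw [Set.mem_preimage, sub_add_cancel]
  by_cases hz : z ∈ D
  · rw [Set.indicator_of_mem hz, Set.indicator_of_mem (this.2 hz)]
  · rw [Set.indicator_of_notMem hz, Set.indicator_of_notMem (mt this.1 hz)]

/-- Shifting a Laplace distribution changes it by a bounded factor only. -/
theorem laplace_map_add_le {b : ℝ} (hb : 0 < b) (v v' : ℝ) :
    (laplace b).map (· + v) ≤
      ENNReal.ofReal (Real.exp (|v - v'| / b)) • (laplace b).map (· + v') := by
  refine Measure.le_iff.2 fun D hD => ?_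
  rw [Measure.smul_apply, laplace_map_add_apply b v hD, laplace_map_add_apply b v' hD, smul_eq_mul,
    ← lintegral_const_mul _ (by fun_prop)]
  refine lintegral_mono fun z => ?_
  simp only
  rw [← ENNReal.ofReal_mul (Real.exp_nonneg _)]
  refine ENNReal.ofReal_le_ofReal ?_
  have h1 : Real.exp (-|z - v| / b) ≤ Real.exp (|v - v'| / b) * Real.exp (-|z - v'| / b) := by
    rw [← Real.exp_add, ← add_div]
    refine Real.exp_le_exp.2 ?_
    gcongr
    have := abs_sub_le z v v'
    linarith
  calc 1 / (2 * b) * Real.exp (-|z - v| / b)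
      ≤ 1 / (2 * b) * (Real.exp (|v - v'| / b) * Real.exp (-|z - v'| / b)) := by gcongr
    _ = _ := by ring

/-- The product outer measure is the largest one that is bounded on boxes by the products, so a
comparison on boxes suffices. -/
theorem pi_le_pi_of_le {K : Type*} [Fintype K] {ν ν' : K → Measure ℝ} [∀ κ, SigmaFinite (ν κ)]
    (h : ∀ κ, ν κ ≤ ν' κ) : Measure.pi ν ≤ Measure.pi ν' := by
  have h1 : (Measure.pi ν).toOuterMeasure ≤ OuterMeasure.pi fun κ => (ν' κ).toOuterMeasure := by
    refine OuterMeasure.le_pi.2 fun D _ => ?_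
    refine (Measure.pi_pi ν D).le.trans ?_
    exact Finset.prod_le_prod' fun κ _ => h κ _
  refine Measure.le_iff.2 fun D hD => ?_
  rw [Measure.pi, Measure.pi, toMeasure_apply _ _ hD, toMeasure_apply _ _ hD]
  refine le_trans (le_of_eq ?_) (h1 D)
  rw [Measure.coe_toOuterMeasure, Measure.pi, toMeasure_apply _ _ hD]

theorem pi_smul_of_sigmaFinite {K : Type*} [Fintype K] (c : K → NNReal) (ν : K → Measure ℝ)
    [∀ κ, SigmaFinite (ν κ)] :
    Measure.pi (fun κ => c κ • ν κ) = (∏ κ, c κ) • Measure.pi ν := by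
  refine (Measure.pi_eq fun D _ => ?_)
  rw [Measure.smul_apply, Measure.pi_pi]
  simp only [Measure.smul_apply, ENNReal.smul_def, smul_eq_mul, Finset.prod_mul_distrib]
  push_cast
  rfl

/-- The one-dimensional factors multiply, so their exponents add up to the weighted `ℓ¹` distance of
the shifts. -/
theorem pi_laplace_map_add_le {K : Type*} [Fintype K] {b : K → ℝ} (hb : ∀ κ, 0 < b κ) {ε : ℝ}
    {g g' : K → ℝ} (hg : ∑ κ, |g κ - g' κ| / b κ ≤ ε) {D : Set (K → ℝ)} (hD : MeasurableSet D) :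
    Measure.pi (fun κ => laplace (b κ)) {x | (fun κ => x κ + g κ) ∈ D} ≤
      ENNReal.ofReal (Real.exp ε) *
        Measure.pi (fun κ => laplace (b κ)) {x | (fun κ => x κ + g' κ) ∈ D} := by
  have hsf : ∀ (c : ℝ) (κ : K), SigmaFinite ((laplace (b κ)).map (· + c)) := fun c κ =>
    (MeasurableEquiv.addRight c).sigmaFinite_map
  have := fun κ => hsf (g κ) κ
  have := fun κ => hsf (g' κ) κ
  have hmap : ∀ g : K → ℝ, (∀ κ, SigmaFinite ((laplace (b κ)).map (· + g κ))) →
      Measure.pi (fun κ => laplace (b κ)) {x | (fun κ => x κ + g κ) ∈ D} =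
        Measure.pi (fun κ => (laplace (b κ)).map (· + g κ)) D := by
    intro g _
    rw [← Measure.pi_map_pi (fun κ => (measurable_add_const (g κ)).aemeasurable),
      Measure.map_apply (by fun_prop) hD]
    rfl
  rw [hmap g inferInstance, hmap g' inferInstance]
  have hle := pi_le_pi_of_le (ν := fun κ => (laplace (b κ)).map (· + g κ))
    (ν' := fun κ => (Real.exp (|g κ - g' κ| / b κ)).toNNReal • (laplace (b κ)).map (· + g' κ))
    (fun κ => laplace_map_add_le (hb κ) (g κ) (g' κ))
  rw [pi_smul_of_sigmaFinite] at hle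
  refine (hle D).trans ?_
  rw [Measure.smul_apply, ENNReal.smul_def, smul_eq_mul]
  gcongr
  rw [← Real.toNNReal_prod_of_nonneg fun κ _ => Real.exp_nonneg _, ← Real.exp_sum]
  exact ENNReal.ofReal_le_ofReal (Real.exp_le_exp.2 hg)

/-- The **Laplace mechanism**: adding independent Laplace noises to a quantity of bounded weighted
`ℓ¹` sensitivity, where the quantity also depends on randomness independent of the noises. -/
theorem laplace_mechanism_le {Ω 𝒵 K : Type*} [MeasurableSpace Ω] [MeasurableSpace 𝒵] [Fintype K]
    {μ : Measure Ω} [IsProbabilityMeasure μ] {b : K → ℝ} (hb : ∀ κ, 0 < b κ) {N : K → Ω → ℝ}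
    (hN : ∀ κ, Measurable (N κ)) (hlaw : ∀ κ, μ.map (N κ) = laplace (b κ)) (hind : iIndepFun N μ)
    {Z : Ω → 𝒵} (hZ : Measurable Z) (hNZ : IndepFun (fun ω κ => N κ ω) Z μ) {g g' : 𝒵 → K → ℝ}
    (hg : ∀ κ, Measurable fun z => g z κ) (hg' : ∀ κ, Measurable fun z => g' z κ) {ε : ℝ}
    (hs : ∀ z, ∑ κ, |g z κ - g' z κ| / b κ ≤ ε) {D : Set (K → ℝ)} (hD : MeasurableSet D) :
    μ {ω | (fun κ => g (Z ω) κ + N κ ω) ∈ D} ≤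
      ENNReal.ofReal (Real.exp ε) * μ {ω | (fun κ => g' (Z ω) κ + N κ ω) ∈ D} := by
  have hNm : Measurable fun ω κ => N κ ω := measurable_pi_lambda _ hN
  have : IsProbabilityMeasure (μ.map Z) := Measure.isProbabilityMeasure_map hZ.aemeasurable
  have hpi : μ.map (fun ω κ => N κ ω) = Measure.pi fun κ => laplace (b κ) := by
    rw [(iIndepFun_iff_map_fun_eq_pi_map fun κ => (hN κ).aemeasurable).1 hind]
    simp_rw [hlaw]
  have hprod : μ.map (fun ω => (Z ω, fun κ => N κ ω)) =
      (μ.map Z).prod (Measure.pi fun κ => laplace (b κ)) := by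
    rw [← hpi]
    exact (indepFun_iff_map_prod_eq_prod_map_map hZ.aemeasurable hNm.aemeasurable).1 hNZ.symm
  -- Fubini: for a fixed value of `Z` the observation is a deterministic shift of the product
  -- Laplace law, so the inequality can be integrated over `Z`.
  have key : ∀ f : 𝒵 → K → ℝ, (∀ κ, Measurable fun z => f z κ) →
      μ {ω | (fun κ => f (Z ω) κ + N κ ω) ∈ D} = ∫⁻ z, Measure.pi (fun κ => laplace (b κ))
        {x | (fun κ => x κ + f z κ) ∈ D} ∂(μ.map Z) := by
    intro f hf
    have hfm : Measurable fun q : 𝒵 × (K → ℝ) => fun κ => q.2 κ + f q.1 κ :=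
      measurable_pi_lambda _ fun κ =>
        ((measurable_pi_apply κ).comp measurable_snd).add ((hf κ).comp measurable_fst)
    have h1 := Measure.prod_apply (μ := μ.map Z) (ν := Measure.pi fun κ => laplace (b κ)) (hfm hD)
    rw [← hprod, Measure.map_apply (hZ.prodMk hNm) (hfm hD)] at h1
    refine Eq.trans ?_ h1
    congr 1
    ext ω
    simp [add_comm]
  have hmeas : Measurable fun z => Measure.pi (fun κ => laplace (b κ))
      {x | (fun κ => x κ + g' z κ) ∈ D} := by
    have hfm : Measurable fun q : 𝒵 × (K → ℝ) => fun κ => q.2 κ + g' q.1 κ :=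
      measurable_pi_lambda _ fun κ =>
        ((measurable_pi_apply κ).comp measurable_snd).add ((hg' κ).comp measurable_fst)
    exact measurable_measure_prodMk_left (hfm hD)
  rw [key g hg, key g' hg', ← lintegral_const_mul _ hmeas]
  exact lintegral_mono fun z => pi_laplace_map_add_le hb (hs z) hD

end LaplaceMechanism

/-! ### Privacy of the output and input mechanisms. -/

section Privacy

variable {m : ℕ} {S : MPARX m} {Ω : Type*} [MeasurableSpace Ω] {μ : Measure Ω}
  [IsProbabilityMeasure μ]
  {s : Fin (m + 1) → ℝ} {y : ℕ → Ω → ℝ} {u : Fin m → ℕ → Ω → ℝ} {w : ℕ → Ω → ℝ}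
  {η : ℕ → Ω → ℝ} {ξ : Fin m → ℕ → Ω → ℝ}

theorem measurable_outputFrom {𝒵 : Type*} [MeasurableSpace 𝒵] (T : ℕ) (x : ℕ → ℝ)
    {v : 𝒵 → Fin m → ℕ → ℝ} {e : 𝒵 → ℕ → ℝ} (hv : ∀ i k, Measurable fun z => v z i k)
    (he : ∀ k, Measurable fun z => e z k) (k : ℕ) :
    Measurable fun z => S.outputFrom T x (v z) (e z) k := by
  induction k using Nat.strong_induction_on with
  | _ k ih =>
    rcases k with _ | k
    · simp [outputFrom]
    · simp only [outputFrom]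
      split_ifs with hk
      · exact measurable_const
      · refine ((Finset.measurable_fun_sum _ fun j _ => Measurable.const_mul ?_ _).add
          (Finset.measurable_fun_sum _ fun i _ => Finset.measurable_fun_sum _ fun l _ =>
            Measurable.const_mul ?_ _)).add (he _)
        · split_ifs
          · exact ih _ (by omega)
          · exact measurable_const
        · simp only [lag]
          split_ifs
          · exact hv _ _
          · exact measurable_const

/-- The injection `e` selects the noises that are actually sent; everything else in a message is a
function of the system signals. -/
theorem PrivacyNoise.mechanism_le (h : PrivacyNoise μ s y u w η ξ) (hy : ∀ k, Measurable (y k))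
    (hu : ∀ i k, Measurable (u i k)) (hw : ∀ k, Measurable (w k)) {K : Type*} [Fintype K]
    {e : K → ℕ ⊕ (Fin m × ℕ)} (he : Function.Injective e) {b : K → ℝ} (hb : ∀ κ, 0 < b κ)
    (hlaw : ∀ κ, μ.map (Sum.elim η (fun z => ξ z.1 z.2) (e κ)) = laplace (b κ))
    {g g' : (ℕ → ℝ) × (Fin m → ℕ → ℝ) × (ℕ → ℝ) → K → ℝ}
    (hg : ∀ κ, Measurable fun z => g z κ) (hg' : ∀ κ, Measurable fun z => g' z κ) {ε : ℝ}
    (hs : ∀ z, ∑ κ, |g z κ - g' z κ| / b κ ≤ ε) {D : Set (K → ℝ)} (hD : MeasurableSet D) :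
    μ {ω | (fun κ => g (systemMap y u w ω) κ + Sum.elim η (fun z => ξ z.1 z.2) (e κ) ω) ∈ D} ≤
      ENNReal.ofReal (Real.exp ε) *
        μ {ω | (fun κ => g' (systemMap y u w ω) κ +
          Sum.elim η (fun z => ξ z.1 z.2) (e κ) ω) ∈ D} := by
  have hN : ∀ n, Measurable (Sum.elim η (fun z : Fin m × ℕ => ξ z.1 z.2) n) := by
    rintro (k | z)
    · exact h.meas_output k
    · exact h.meas_input _ _
  have hZ : Measurable (systemMap y u w) :=
    (measurable_pi_lambda _ hy).prodMk ((measurable_pi_lambda _ fun i =>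
      measurable_pi_lambda _ (hu i)).prodMk (measurable_pi_lambda _ hw))
  refine laplace_mechanism_le hb (fun κ => hN (e κ)) hlaw (h.indep.precomp he) hZ ?_ hg hg' hs hD
  have hp : Measurable fun q : (ℕ → ℝ) × (Fin m → ℕ → ℝ) => fun κ =>
      Sum.elim q.1 (fun z : Fin m × ℕ => q.2 z.1 z.2) (e κ) := by
    refine measurable_pi_lambda _ fun κ => ?_
    rcases e κ with k | z
    · exact (measurable_pi_apply k).comp measurable_fst
    · exact (measurable_pi_apply z.2).comp ((measurable_pi_apply z.1).comp measurable_snd)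
  have h1 := h.indep_system.comp hp measurable_id
  have h2 : (fun ω κ => Sum.elim η (fun z : Fin m × ℕ => ξ z.1 z.2) (e κ) ω) =
      (fun q κ => Sum.elim q.1 (fun z : Fin m × ℕ => q.2 z.1 z.2) (e κ)) ∘
        fun ω => ((fun k => η k ω), (fun i k => ξ i k ω)) := by
    funext ω κ
    simp only [Function.comp]
    rcases e κ with k | z <;> rfl
  rw [h2]
  exact h1

theorem diffPrivate_outputMechanism {c0 lam ε δ : ℝ} (hdecay : S.IsDecay c0 lam)
    (hs : ∀ i, 0 < s i) (h0 : S.C1 c0 lam / s 0 * δ ≤ ε) (h : PrivacyNoise μ s y u w η ξ)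
    (hy : ∀ k, Measurable (y k)) (hu : ∀ i k, Measurable (u i k)) (hw : ∀ k, Measurable (w k))
    {T₁ T₂ : ℕ} (hT : T₁ ≤ T₂) : DiffPrivate μ ε δ (S.outputMechanism u w η T₁ T₂) := by
  intro x x' hx D hD
  -- The data are indexed from `0` and outputs from `1`. The value at `n = 0` is never read, since
  -- `outputFrom` starts at zero.
  set X : (Fin T₁ → ℝ) → ℕ → ℝ := fun x n => if h : n - 1 < T₁ then x ⟨n - 1, h⟩ else 0 with hX
  refine h.mechanism_le hy hu hw (e := fun k : Fin T₂ => Sum.inl ((k : ℕ) + 1)) ?_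
    (b := fun _ => s 0) (fun _ => hs 0) (fun k => h.law_output k)
    (g := fun z k => S.outputFrom T₁ (X x) z.2.1 z.2.2 (k + 1))
    (g' := fun z k => S.outputFrom T₁ (X x') z.2.1 z.2.2 (k + 1)) ?_ ?_ (fun z => ?_) hD
  · intro k k' hk
    exact Fin.ext (by simpa using hk)
  · exact fun k => measurable_outputFrom _ _ (by fun_prop) (by fun_prop) _
  · exact fun k => measurable_outputFrom _ _ (by fun_prop) (by fun_prop) _
  · rw [← Finset.sum_div, ← Finset.sum_range (fun k => |S.outputFrom T₁ (X x) z.2.1 z.2.2 (k + 1) -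
      S.outputFrom T₁ (X x') z.2.1 z.2.2 (k + 1)|)]
    have h1 := hdecay.outputFrom_sensitivity z.2.1 z.2.2 hT (X x) (X x')
    have h2 : ∑ k ∈ Finset.range T₁, |X x (k + 1) - X x' (k + 1)| = ∑ k, |x k - x' k| := by
      rw [Finset.sum_range fun k => |X x (k + 1) - X x' (k + 1)|]
      refine Finset.sum_congr rfl fun k _ => ?_
      simp [hX]
    rw [h2] at h1
    have h3 : 0 ≤ S.C1 c0 lam := by linarith [hdecay.one_le_C1]
    refine le_trans ?_ h0
    rw [div_mul_eq_mul_div]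
    have := hs 0
    gcongr
    exact h1.trans (mul_le_mul_of_nonneg_left hx h3)

/-- Both blocks of the message are treated as one noisy vector: the outputs cost `C_{i,2} δ / b_0`
and the inputs `δ / b_i`, which together form the constraint. -/
theorem diffPrivate_inputMechanism {c0 lam ε δ : ℝ} (hdecay : S.IsDecay c0 lam)
    (hs : ∀ i, 0 < s i) (i : Fin m) (hi : (S.C2 c0 lam i / s 0 + 1 / s i.succ) * δ ≤ ε)
    (h : PrivacyNoise μ s y u w η ξ)
    (hy : ∀ k, Measurable (y k)) (hu : ∀ i k, Measurable (u i k)) (hw : ∀ k, Measurable (w k))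
    {T₁ T₂ : ℕ} (hT : T₁ ≤ T₂) : DiffPrivate μ ε δ (S.inputMechanism u w η ξ i T₁ T₂) := by
  intro x x' hx D hD
  set G : (Fin T₁ → ℝ) → (ℕ → ℝ) × (Fin m → ℕ → ℝ) × (ℕ → ℝ) → Fin T₂ ⊕ Fin T₂ → ℝ :=
    fun x z => Sum.elim
      (fun k => S.outputFrom 0 (fun _ => 0) (replaceInput i T₁ x z.2.1) z.2.2 (k + 1))
      (fun k => replaceInput i T₁ x z.2.1 i k) with hG
  have hrep : ∀ (x : Fin T₁ → ℝ) (j : Fin m) (k : ℕ), Measurable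
      fun z : (ℕ → ℝ) × (Fin m → ℕ → ℝ) × (ℕ → ℝ) => replaceInput i T₁ x z.2.1 j k := by
    intro x j k
    by_cases hj : j = i
    · subst hj
      simp only [replaceInput, Function.update_self]
      split_ifs <;> fun_prop
    · simp only [replaceInput, Function.update_of_ne hj]
      fun_prop
  have hGm : ∀ x κ, Measurable fun z => G x z κ := by
    rintro x (k | k)
    · exact measurable_outputFrom _ _ (hrep x) (by fun_prop) _
    · exact hrep x i k
  have hsplit : Measurable fun f : Fin T₂ ⊕ Fin T₂ → ℝ =>
      ((fun k => f (Sum.inl k), fun k => f (Sum.inr k)) : (Fin T₂ → ℝ) × (Fin T₂ → ℝ)) := by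
    fun_prop
  refine h.mechanism_le hy hu hw (e := Sum.elim (fun k : Fin T₂ => Sum.inl ((k : ℕ) + 1))
    (fun k : Fin T₂ => Sum.inr (i, (k : ℕ)))) ?_
    (b := Sum.elim (fun _ => s 0) (fun _ => s i.succ)) ?_ ?_ (g := G x) (g' := G x') (hGm x)
    (hGm x') (fun z => ?_) (hsplit hD)
  · rintro (k | k) (k' | k') hk
    · simpa [Fin.ext_iff] using hk
    · cases hk
    · cases hk
    · simpa [Fin.ext_iff] using hk
  · rintro (k | k)
    · exact hs 0
    · exact hs i.succ
  · rintro (k | k)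
    · exact h.law_output k
    · exact h.law_input i k
  · rw [Fintype.sum_sum_type]
    simp only [hG, Sum.elim_inl, Sum.elim_inr]
    rw [← Finset.sum_div, ← Finset.sum_div,
      ← Finset.sum_range (fun k => |S.outputFrom 0 (fun _ => 0) (replaceInput i T₁ x z.2.1) z.2.2
        (k + 1) - S.outputFrom 0 (fun _ => 0) (replaceInput i T₁ x' z.2.1) z.2.2 (k + 1)|),
      ← Finset.sum_range (fun k => |replaceInput i T₁ x z.2.1 i k -
        replaceInput i T₁ x' z.2.1 i k|)]
    have h1 := hdecay.input_sensitivity z.2.2 i (v := replaceInput i T₁ x z.2.1)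
      (v' := replaceInput i T₁ x' z.2.1) (fun j hj => by
        simp [replaceInput, Function.update_of_ne hj]) (fun _ => 0) T₂
    have h2 : ∑ k ∈ Finset.range T₂, |replaceInput i T₁ x z.2.1 i k -
        replaceInput i T₁ x' z.2.1 i k| ≤ δ := by
      refine le_trans (le_of_eq ?_) hx
      obtain ⟨n, rfl⟩ := Nat.exists_eq_add_of_le hT
      rw [Finset.sum_range_add, Finset.sum_range fun k => |replaceInput i T₁ x z.2.1 i k -
        replaceInput i T₁ x' z.2.1 i k|]
      simp [replaceInput]
    have hC2 : 0 ≤ S.C2 c0 lam i := by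
      have h3 : S.C2 c0 lam i = S.C1 c0 lam * ∑ l, |S.b i l| := rfl
      rw [h3]
      have := hdecay.one_le_C1
      positivity
    refine le_trans ?_ hi
    rw [add_mul, div_mul_eq_mul_div, div_mul_eq_mul_div, one_mul]
    have := hs 0
    have := hs i.succ
    gcongr
    exact h1.trans (mul_le_mul_of_nonneg_left h2 hC2)

theorem privateForAll {c0 lam ε δ : ℝ} (hdecay : S.IsDecay c0 lam)
    (hs : s ∈ S.admissible c0 lam ε δ) (h : PrivacyNoise μ s y u w η ξ)
    (hy : ∀ k, Measurable (y k)) (hu : ∀ i k, Measurable (u i k)) (hw : ∀ k, Measurable (w k)) :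
    S.PrivateForAll μ ε δ u w η ξ := fun _ _ _ hT =>
  ⟨diffPrivate_outputMechanism hdecay hs.1 hs.2.1 h hy hu hw hT,
    fun i => diffPrivate_inputMechanism hdecay hs.1 i (hs.2.2 i) h hy hu hw hT⟩

end Privacy

end MPARX

namespace MPARX

/-! ### Existence and boundedness of minimizers. -/

section Minimizer

variable {m : ℕ} {S : MPARX m} {c0 lam ε δ γ : ℝ}

/-- The numerator of the objective function. -/
def noisePower (S : MPARX m) (s : Fin (m + 1) → ℝ) : ℝ :=
  S.p * s 0 ^ 2 + ∑ i : Fin m, S.q i * s i.succ ^ 2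

theorem objective_eq (s : Fin (m + 1) → ℝ) :
    S.objective γ s = S.noisePower s / (γ + 2 * ⨅ i, s i ^ 2) := rfl

theorem objective_denom_pos (hγ : 0 < γ) (s : Fin (m + 1) → ℝ) : 0 < γ + 2 * ⨅ i, s i ^ 2 := by
  have := iInf_sq_nonneg s
  positivity

theorem dim_mul_iInf_le_noisePower (s : Fin (m + 1) → ℝ) :
    (S.p + ∑ i : Fin m, (S.q i : ℝ)) * ⨅ i, s i ^ 2 ≤ S.noisePower s := by
  unfold noisePower
  rw [add_mul, Finset.sum_mul]
  gcongr with i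
  · exact iInf_sq_le s 0
  · exact iInf_sq_le s i.succ

theorem continuous_objective (hγ : 0 < γ) : Continuous (S.objective γ) := by
  have h1 : Continuous fun s : Fin (m + 1) → ℝ => ⨅ i, s i ^ 2 := by
    have : (fun s : Fin (m + 1) → ℝ => ⨅ i, s i ^ 2) =
        fun s => Finset.univ.inf' Finset.univ_nonempty fun i => s i ^ 2 := by
      funext s
      exact (Finset.inf'_univ_eq_ciInf _).symm
    rw [this]
    exact Continuous.finset_inf'_apply _ fun i _ => (continuous_apply i).pow 2
  unfold objective
  refine Continuous.div ?_ (continuous_const.add (continuous_const.mul h1)) fun s =>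
    (objective_denom_pos hγ s).ne'
  fun_prop

theorem C2_nonneg (h : S.IsDecay c0 lam) (i : Fin m) : 0 ≤ S.C2 c0 lam i := by
  have h3 : S.C2 c0 lam i = S.C1 c0 lam * ∑ l, |S.b i l| := rfl
  rw [h3]
  have := h.one_le_C1
  positivity

theorem C2_eq_zero {i : Fin m} (hq : S.q i = 0) : S.C2 c0 lam i = 0 := by
  have : IsEmpty (Fin (S.q i)) := by rw [hq]; infer_instance
  simp [C2]

/-- Lower bounds of admissible noise levels. -/
theorem admissible_lower (h : S.IsDecay c0 lam) (hε : 0 < ε) (hδ : 0 < δ) {s : Fin (m + 1) → ℝ}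
    (hs : s ∈ S.admissible c0 lam ε δ) (i : Fin (m + 1)) : δ / ε ≤ s i := by
  obtain ⟨hpos, h0, hi⟩ := hs
  rw [div_le_iff₀ hε]
  induction i using Fin.cases with
  | zero =>
    have := hpos 0
    rw [div_mul_eq_mul_div, div_le_iff₀ this] at h0
    nlinarith [h.one_le_C1]
  | succ i =>
    have h1 := hpos i.succ
    have h2 := hi i
    have h3 : 0 ≤ S.C2 c0 lam i / s 0 := div_nonneg (C2_nonneg h i) (hpos 0).le
    have h4 : 1 / s i.succ * δ ≤ ε := le_trans (by gcongr; linarith) h2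
    rw [div_mul_eq_mul_div, one_mul, div_le_iff₀ h1] at h4
    linarith

/-- Large constant noise levels are admissible. -/
theorem const_mem_admissible (h : S.IsDecay c0 lam) (hε : 0 < ε) (hδ : 0 < δ) :
    ∃ b : ℝ, 0 < b ∧ (fun _ => b) ∈ S.admissible c0 lam ε δ := by
  -- `C` dominates `C_1` and every `C_{i,2} + 1`, the numerators occurring in the constraints at
  -- constant levels.
  set C := S.C1 c0 lam + ∑ i, S.C2 c0 lam i + 1 with hC
  have h1 := h.one_le_C1
  have h2 : ∀ i ∈ Finset.univ, 0 ≤ S.C2 c0 lam i := fun i _ => C2_nonneg h i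
  have h3 := Finset.sum_nonneg h2
  have hC0 : 0 < C := by linarith
  have hb : 0 < C * δ / ε := by positivity
  have key : ∀ c, c ≤ C → c / (C * δ / ε) * δ ≤ ε := by
    intro c hc
    have : c / (C * δ / ε) * δ = c / C * ε := by field_simp
    rw [this]
    have : c / C ≤ 1 := (div_le_one hC0).2 hc
    nlinarith
  refine ⟨C * δ / ε, hb, fun _ => hb, key _ (by linarith), fun i => ?_⟩
  rw [← add_div]
  refine key _ ?_
  have := Finset.single_le_sum h2 (Finset.mem_univ i)
  linarith

/-- The noise levels in a box form a compact part of the admissible set. -/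
theorem isCompact_admissible_inter (h : S.IsDecay c0 lam) (hε : 0 < ε) (hδ : 0 < δ) (R : ℝ) :
    IsCompact (S.admissible c0 lam ε δ ∩ {s | ∀ i, s i ≤ R}) := by
  have hl : 0 < δ / ε := by positivity
  -- The lower bound `δ / ε` replaces strict positivity by a closed condition, and clearing
  -- denominators makes the constraints polynomial.
  have heq : S.admissible c0 lam ε δ ∩ {s | ∀ i, s i ≤ R} =
      Set.Icc (fun _ => δ / ε) (fun _ => R) ∩ {s | S.C1 c0 lam * δ ≤ ε * s 0 ∧
        ∀ i : Fin m, (S.C2 c0 lam i * s i.succ + s 0) * δ ≤ ε * (s 0 * s i.succ)} := by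
    have hiff : ∀ s : Fin (m + 1) → ℝ, (∀ i, 0 < s i) →
        ((S.C1 c0 lam / s 0 * δ ≤ ε ∧
          ∀ i : Fin m, (S.C2 c0 lam i / s 0 + 1 / s i.succ) * δ ≤ ε) ↔
        (S.C1 c0 lam * δ ≤ ε * s 0 ∧
          ∀ i : Fin m, (S.C2 c0 lam i * s i.succ + s 0) * δ ≤ ε * (s 0 * s i.succ))) := by
      intro s hs
      refine and_congr ?_ (forall_congr' fun i => ?_)
      · rw [div_mul_eq_mul_div, div_le_iff₀ (hs 0)]
      · rw [div_add_div _ _ (hs 0).ne' (hs _).ne', div_mul_eq_mul_div,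
          div_le_iff₀ (mul_pos (hs 0) (hs _)), mul_one]
    ext s
    constructor
    · rintro ⟨hs, hR⟩
      exact ⟨⟨fun i => admissible_lower h hε hδ hs i, hR⟩, (hiff s hs.1).1 hs.2⟩
    · rintro ⟨⟨h1, h2⟩, h3⟩
      have hpos : ∀ i, 0 < s i := fun i => hl.trans_le (h1 i)
      exact ⟨⟨hpos, (hiff s hpos).2 h3⟩, h2⟩
  rw [heq]
  refine isCompact_Icc.inter_right ?_
  rw [Set.ofPred_and, Set.ofPred_forall]
  refine IsClosed.inter (isClosed_le continuous_const (by fun_prop)) (isClosed_iInter fun i => ?_)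
  exact isClosed_le (by fun_prop) (by fun_prop)

/-- A truncated entry equals `R`, which is not below the entry at `0`, so truncation leaves the
minimum alone. -/
theorem iInf_sq_min {s : Fin (m + 1) → ℝ} (hs : ∀ i, 0 < s i) {R : ℝ} (h0 : s 0 ≤ R) :
    ⨅ i, (min (s i) R) ^ 2 = ⨅ i, s i ^ 2 := by
  have hR : 0 < R := (hs 0).trans_le h0
  refine le_antisymm (le_ciInf fun i => ?_) (le_ciInf fun i => ?_)
  · refine (iInf_sq_le (fun i => min (s i) R) i).trans ?_
    have := lt_min (hs i) hR
    exact pow_le_pow_left₀ this.le (min_le_left _ _) 2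
  · rcases le_total (s i) R with hi | hi
    · rw [min_eq_left hi]
      exact iInf_sq_le s i
    · rw [min_eq_right hi]
      exact (iInf_sq_le s 0).trans (pow_le_pow_left₀ (hs 0).le h0 2)

/-- The objective function attains its minimum in a bounded set. -/
theorem exists_bounded_minimizer (h : S.IsDecay c0 lam) (hp : 0 < S.p) (hγ : 0 < γ) (hε : 0 < ε)
    (hδ : 0 < δ) : ∃ r : ℝ,
      (∃ s ∈ S.admissible c0 lam ε δ, (∀ i, s i ≤ r) ∧
        IsMinOn (S.objective γ) (S.admissible c0 lam ε δ) s) ∧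
      (∀ s ∈ S.admissible c0 lam ε δ,
        IsMinOn (S.objective γ) (S.admissible c0 lam ε δ) s →
        s 0 ≤ r ∧ ∀ i : Fin m, 0 < S.q i → s i.succ ≤ r) := by
  obtain ⟨b, hb, hbad⟩ := const_mem_admissible h hε hδ
  set n : ℝ := S.p + ∑ i : Fin m, (S.q i : ℝ) with hn
  have hp1 : (1 : ℝ) ≤ S.p := by exact_mod_cast hp
  have hq0 : ∀ i : Fin m, 0 ≤ (S.q i : ℝ) := fun i => Nat.cast_nonneg _
  have hn0 : 0 < n := by
    have := Finset.sum_nonneg fun i (_ : i ∈ Finset.univ) => hq0 i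
    linarith
  set v := S.objective γ (fun _ => b) with hv
  have hvb : v = n * b ^ 2 / (γ + 2 * b ^ 2) := by
    rw [hv, objective_eq, ciInf_const, noisePower, ← Finset.sum_mul, ← add_mul]
  have hv0 : 0 ≤ v := by
    rw [hvb]
    positivity
  -- The positive `γ` in the denominator puts `v` strictly below `n / 2`, the supremum of `f` over
  -- constant levels.
  have hvn : 0 < n - 2 * v := by
    have : n - 2 * v = n * γ / (γ + 2 * b ^ 2) := by
      rw [hvb]
      field_simp
      ring
    rw [this]
    positivity
  -- If `f ≤ v` and `I` is the minimum of the squares, then `n I ≤ v (γ + 2 I)`, so `I ≤ M`, and the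
  -- numerator is at most `E`.
  set M := v * γ / (n - 2 * v) with hM
  set E := v * (γ + 2 * M) with hE
  have hM0 : 0 ≤ M := by positivity
  have hE0 : 0 ≤ E := by positivity
  have hbound : ∀ s, S.objective γ s ≤ v → S.noisePower s ≤ E := by
    intro s hs
    rw [objective_eq, div_le_iff₀ (objective_denom_pos hγ s)] at hs
    have h1 := dim_mul_iInf_le_noisePower (S := S) s
    have h2 : ⨅ i, s i ^ 2 ≤ M := by
      rw [hM, le_div_iff₀ hvn]
      linarith
    refine hs.trans ?_
    rw [hE]
    gcongr
  -- `√E` bounds the levels of positive weight, `b` keeps the constant point in the box, and `δ / ε`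
  -- keeps truncated levels of weight zero admissible.
  set R := max (Real.sqrt E) (max b (δ / ε)) with hR
  have hRE : ∀ t, t ^ 2 ≤ E → t ≤ R := fun t ht =>
    (Real.le_sqrt_of_sq_le ht).trans (le_max_left _ _)
  have hcoord : ∀ s, S.objective γ s ≤ v → s 0 ≤ R ∧ ∀ i : Fin m, 0 < S.q i → s i.succ ≤ R := by
    intro s hs
    have h1 := hbound s hs
    constructor
    · exact hRE _ ((S.le_objective_numerator s (Sum.inl ⟨0, hp⟩)).trans h1)
    · intro i hi
      exact hRE _ ((S.le_objective_numerator s (Sum.inr ⟨i, ⟨0, hi⟩⟩)).trans h1)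
  have hbR : (fun _ => b) ∈ S.admissible c0 lam ε δ ∩ {s | ∀ i, s i ≤ R} :=
    ⟨hbad, fun _ => (le_max_left _ _).trans (le_max_right _ _)⟩
  obtain ⟨s, hs, hmin⟩ := (isCompact_admissible_inter h hε hδ R).exists_isMinOn ⟨_, hbR⟩
    (continuous_objective (S := S) hγ).continuousOn
  refine ⟨R, ⟨s, hs.1, hs.2, ?_⟩, fun s' _ hmin' => hcoord s' (hmin' hbad)⟩
  intro t ht
  -- A competitor in the sublevel set is moved into the box by truncation. Only levels with `q_i =
  -- 0` change; these have weight zero and `C_{i,2} = 0`, so neither the objective nor admissibility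
  -- is affected.
  rcases le_total (S.objective γ t) v with htv | htv
  · obtain ⟨h0, hi⟩ := hcoord t htv
    have hR0 : 0 < R := (ht.1 0).trans_le h0
    have hpos : ∀ i, 0 < min (t i) R := fun i => lt_min (ht.1 i) hR0
    have hobj : S.objective γ (fun i => min (t i) R) = S.objective γ t := by
      rw [objective_eq, objective_eq, iInf_sq_min ht.1 h0]
      congr 1
      simp only [noisePower, min_eq_left h0]
      congr 1
      refine Finset.sum_congr rfl fun i _ => ?_
      rcases Nat.eq_zero_or_pos (S.q i) with hq | hq
      · simp [hq]
      · rw [min_eq_left (hi i hq)]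
    have hmem : (fun i => min (t i) R) ∈ S.admissible c0 lam ε δ ∩ {s | ∀ i, s i ≤ R} := by
      refine ⟨⟨hpos, ?_, fun i => ?_⟩, fun i => min_le_right _ _⟩
      · simp only [min_eq_left h0]
        exact ht.2.1
      · rcases Nat.eq_zero_or_pos (S.q i) with hq | hq
        · rw [C2_eq_zero hq, zero_div, zero_add, div_mul_eq_mul_div, one_mul,
            div_le_iff₀ (hpos i.succ), ← div_le_iff₀' hε]
          exact le_min (admissible_lower h hε hδ ht _)
            ((le_max_right _ _).trans (le_max_right _ _))
        · simp only [min_eq_left h0, min_eq_left (hi i hq)]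
          exact ht.2.2 i
    have h1 : S.objective γ s ≤ S.objective γ fun i => min (t i) R := hmin hmem
    exact h1.trans_eq hobj
  · have h1 : S.objective γ s ≤ v := hmin hbR
    exact h1.trans htv

end Minimizer

end MPARX

end

theorem theorem6 {Ω : Type*} [MeasurableSpace Ω] (μ : Measure Ω) [IsProbabilityMeasure μ]
    {m : ℕ} (S : MPARX m)
    -- outputs, inputs and noise of the system
    (y : ℕ → Ω → ℝ) (u : Fin m → ℕ → Ω → ℝ) (w : ℕ → Ω → ℝ)
    (hu : ∀ i k, Measurable (u i k)) (hw : ∀ k, Measurable (w k))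
    (hsys : ∀ ω, S.IsOutput (fun k => y k ω) (fun i k => u i k ω) (fun k => w k ω))
    -- asymptotic stability
    (hstable : S.Stable)
    -- the system noise is a martingale difference sequence, the regressors are adapted
    (ℱ : Filtration ℕ ‹MeasurableSpace Ω›) (β : ℝ) (hβ : 2 ≤ β)
    (hmds : MPARX.NoiseMDS μ ℱ β w)
    (hadapted : ∀ k, StronglyMeasurable[ℱ k]
      (fun ω => S.regressor (fun n => y n ω) (fun i n => u i n ω) k))
    -- the regressors have bounded mean energy and are persistently exciting
    (hmean : ∀ᵐ ω ∂μ, (fun k : ℕ => ∑ t ∈ Finset.Icc 1 k,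
        MPARX.eNorm (S.regressor (fun n => y n ω) (fun i n => u i n ω) t) ^ 2)
      =O[atTop] (fun k : ℕ => (k : ℝ)))
    (α : ℝ) (hα : 0 < α) (θ0 : S.Idx → ℝ) (γ : ℝ) (hγ : 0 < γ)
    (hexc : ∀ᵐ ω ∂μ, (γ : EReal) < liminf (fun k : ℕ =>
      ((MPARX.lambdaMin (S.information α (fun n => y n ω) (fun i n => u i n ω) k) / k : ℝ) :
        EReal)) atTop)
    -- privacy indexes
    (ε δ : ℝ) (hε : 0 < ε) (hδ : 0 < δ) :
    -- constants as required in the privacy constraints exist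
    (∃ c0 lam, S.IsDecay c0 lam) ∧
    ∀ c0 lam : ℝ, S.IsDecay c0 lam →
      -- the minimum is attained, in a bounded set
      (0 < S.p → ∃ r : ℝ,
        (∃ s ∈ S.admissible c0 lam ε δ, (∀ i, s i ≤ r) ∧
          IsMinOn (S.objective γ) (S.admissible c0 lam ε δ) s) ∧
        (∀ s ∈ S.admissible c0 lam ε δ,
          IsMinOn (S.objective γ) (S.admissible c0 lam ε δ) s →
          s 0 ≤ r ∧ ∀ i : Fin m, 0 < S.q i → s i.succ ≤ r)) ∧
      -- admissible noise levels: privacy, and the error bound of these levels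
      (∀ s ∈ S.admissible c0 lam ε δ, ∀ (η : ℕ → Ω → ℝ) (ξ : Fin m → ℕ → Ω → ℝ),
        MPARX.PrivacyNoise μ s y u w η ξ →
        S.PrivateForAll μ ε δ u w η ξ ∧
        ((∃ κ : ℝ, 1 < κ ∧ ∀ᵐ ω ∂μ, S.Excited α β κ θ0
            (fun n => y n ω + η n ω) (fun i n => u i n ω + ξ i n ω)) →
          S.ErrorBound μ α θ0 y u η ξ
            (2 * MPARX.eNorm S.theta * Real.sqrt (S.objective γ s)) ∧
          -- minimizing noise levels: the error bound given by the minimal value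
          ∀ fstar : ℝ, IsLeast (S.objective γ '' S.admissible c0 lam ε δ) fstar →
            S.objective γ s = fstar →
            S.ErrorBound μ α θ0 y u η ξ (2 * MPARX.eNorm S.theta * Real.sqrt fstar))) := by
  refine ⟨S.exists_isDecay hstable, fun c0 lam hdecay => ⟨fun hp =>
    MPARX.exists_bounded_minimizer hdecay hp hγ hε hδ, fun s hs η ξ hnoise => ?_⟩⟩
  refine ⟨MPARX.privateForAll hdecay hs hnoise (S.measurable_output hu hw hsys) hu hw, fun _ => ?_⟩
  have hbound := S.errorBound μ hu hw hsys hβ hmds hadapted hmean hα θ0 hγ hexc hs.1 hnoise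
  exact ⟨hbound, fun _ _ hf => hf ▸ hbound⟩
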